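/- Let $\ell>0$ and let $\gamma\in C^2([0,\ell];\mathbb R^2)$ be a closed curve parametrized by arc length, i.e. $|\partial_s\gamma|=1$ on $[0,\ell]$, $\gamma(0)=\gamma(\ell)$, $\dot\gamma(0)=\dot\gamma(\ell)$ and $\ddot\gamma(0)=\ddot\gamma(\ell)$. Let $X_\ell$ be the set of closed arc-length parametrized curves $\eta\in H^2([0,\ell];\mathbb R^2)$ of length $\ell$, i.e. $|\partial_s\eta|=1$, $\eta(0)=\eta(\ell)$, $\dot\eta(0)=\dot\eta(\ell)$. Let $\kappa_\eta$ denote the signed curvature of $\eta$ and, for $\epsilon>0$, set $$\mathcal G_\epsilon(\eta)=\epsilon^{1/2}\int_0^\ell\kappa_\eta^2\,ds+\frac1{2\epsilon^{1/2}}\int_0^\ell|\partial_s\eta-\partial_s\gamma|^2\,ds .$$ For a finite signed Borel measure $\mu$ on $[0,\ell]$ let $\|\mu\|_{\rm flat}=\sup\int_{[0,\ell]}\varphi\,d\mu$, the supremum being over the Lipschitz functions $\varphi$ on $[0,\ell]$ with $\varphi(0)=\varphi(\ell)$ and $\|\varphi\|_\infty+\mathrm{Lip}(\varphi)\le1$.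 Let $\mathcal K(\gamma)$ be the set of measures $\mu=\kappa_\gamma\,ds+2\pi\sum_{j=1}^Nc_j\delta_{s_j}$ with $N\in\mathbb N$ (possibly $N=0$), $c_j\in\mathbb Z\setminus\{0\}$ and $s_j\in[0,\ell]$ distinct as points of the closed curve ($0$ and $\ell$ are identified, so that they do not both occur among the $s_j$), and put $G(\gamma,\mu)=\sum_{j=1}^N|c_j|$. For curves $\eta_i\in X_\ell$ we say that $(\eta_i,\kappa_{\eta_i})$ converges to $(\gamma,\mu)$ if $\eta_i\to\gamma$ in $H^1([0,\ell];\mathbb R^2)$ and $\|\kappa_{\eta_i}\,ds-\mu\|_{\rm flat}\to0$. (i) (Compactness) Let $\epsilon_k>0$, $\epsilon_k\to0$, and let $\eta_k\in X_\ell$ satisfy $\sup_k\mathcal G_{\epsilon_k}(\eta_k)<\infty$. Then there are a subsequence (not relabelled) and $\mu\in\mathcal K(\gamma)$ such that the translated curves $\tilde\eta_k=\eta_k-\eta_k(0)+\gamma(0)$ satisfy: $(\tilde\eta_k,\kappa_{\tilde\eta_k})$ converges to $(\gamma,\mu)$. ($\Gamma$-liminf) If $\epsilon_k>0$, $\epsilon_k\to0$,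 $\eta_k\in X_\ell$, $\mu\in\mathcal K(\gamma)$ and $(\eta_k,\kappa_{\eta_k})$ converges to $(\gamma,\mu)$, then $$\liminf_{k\to\infty}\mathcal G_{\epsilon_k}(\eta_k)\ \ge\ 8\sqrt2\,G(\gamma,\mu).$$ (ii) ($\Gamma$-limsup) For every $\mu\in\mathcal K(\gamma)$ there are curves $\gamma_\epsilon\in X_\ell$, $\epsilon>0$, such that $(\gamma_\epsilon,\kappa_{\gamma_\epsilon})$ converges to $(\gamma,\mu)$ and $\mathcal G_\epsilon(\gamma_\epsilon)\to8\sqrt2\,G(\gamma,\mu)$ as $\epsilon\to0^+$. -/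

import Mathlib

open Set Filter Topology MeasureTheory
open scoped ENNReal NNReal

noncomputable section

namespace PointedClosedCurve

/-- The Euclidean plane. -/
abbrev Plane : Type := EuclideanSpace ℝ (Fin 2)

/-! Curves are functions `γ : ℝ → Plane` of which only the values on `[0, ℓ]` matter. -/

/-- The derivative `∂ₛγ` of a curve on `[0, ℓ]` (one-sided at the two endpoints). -/
def tangent (ℓ : ℝ) (γ : ℝ → Plane) : ℝ → Plane :=
  derivWithin γ (Icc 0 ℓ)

/-- The second derivative `∂ₛₛγ` of a curve on `[0, ℓ]` (one-sided at the two endpoints). -/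
def secondDeriv (ℓ : ℝ) (γ : ℝ → Plane) : ℝ → Plane :=
  derivWithin (tangent ℓ γ) (Icc 0 ℓ)

/-- The signed curvature of a curve parametrized by arc length: the component of `∂ₛₛγ` along the
unit normal obtained by rotating `∂ₛγ` by `+π/2`. If `∂ₛγ = (cos θ, sin θ)` then it is `∂ₛθ`,
see `curvature_eq_of_lift`. -/
def curvature (ℓ : ℝ) (γ : ℝ → Plane) (s : ℝ) : ℝ :=
  tangent ℓ γ s 0 * secondDeriv ℓ γ s 1 - tangent ℓ γ s 1 * secondDeriv ℓ γ s 0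

/-- The curvature is the derivative of any lifting `θ` of the tangent. -/
theorem curvature_eq_of_lift {ℓ : ℝ} {γ : ℝ → Plane} {θ : ℝ → ℝ} {k s : ℝ}
    (hs : s ∈ Ioo 0 ℓ)
    (hlift : ∀ t ∈ Icc 0 ℓ, tangent ℓ γ t = !₂[Real.cos (θ t), Real.sin (θ t)])
    (hθ : HasDerivAt θ k s) : curvature ℓ γ s = k := by
  have hs' : s ∈ Icc 0 ℓ := Ioo_subset_Icc_self hs
  have hu : UniqueDiffWithinAt ℝ (Icc 0 ℓ) s :=
    uniqueDiffOn_Icc (hs.1.trans hs.2) s hs'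
  have hd : HasDerivWithinAt (tangent ℓ γ)
      (!₂[-Real.sin (θ s) * k, Real.cos (θ s) * k] : Plane) (Icc 0 ℓ) s := by
    have h0 : HasDerivAt (fun t => (!₂[Real.cos (θ t), Real.sin (θ t)] : Plane))
        (!₂[-Real.sin (θ s) * k, Real.cos (θ s) * k] : Plane) s := by
      have hpi : HasDerivAt (fun t => ![Real.cos (θ t), Real.sin (θ t)])
          ![-Real.sin (θ s) * k, Real.cos (θ s) * k] s := by
        rw [hasDerivAt_pi]
        intro i
        fin_cases i
        · simpa using hθ.cos
        · simpa using hθ.sin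
      exact (PiLp.continuousLinearEquiv 2 ℝ
        (fun _ : Fin 2 => ℝ)).symm.toContinuousLinearMap.hasFDerivAt.comp_hasDerivAt s hpi
    exact h0.hasDerivWithinAt.congr (fun t ht => hlift t ht) (hlift s hs')
  have h2 : secondDeriv ℓ γ s = !₂[-Real.sin (θ s) * k, Real.cos (θ s) * k] :=
    hd.derivWithin hu
  have hsq := Real.sin_sq_add_cos_sq (θ s)
  simp only [curvature, h2, hlift s hs', PiLp.toLp_apply, Matrix.cons_val_zero,
    Matrix.cons_val_one]
  linear_combination k * hsq

/-- `γ ∈ H²([0, ℓ]; ℝ²)`, for the continuous representative: `γ` is `C¹` up to the boundary, its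
derivative is absolutely continuous, and its second derivative is in `L²`. -/
structure IsH2 (ℓ : ℝ) (γ : ℝ → Plane) : Prop where
  contDiffOn : ContDiffOn ℝ 1 γ (Icc 0 ℓ)
  absolutelyContinuous : AbsolutelyContinuousOnInterval (tangent ℓ γ) 0 ℓ
  memLp : MemLp (secondDeriv ℓ γ) 2 (volume.restrict (Icc 0 ℓ))

/-- Closed planar `H²` curves of length `ℓ`, parametrized by arc length on `[0, ℓ]`. -/
structure IsClosedH2Curve (ℓ : ℝ) (γ : ℝ → Plane) : Prop where
  isH2 : IsH2 ℓ γ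
  unitSpeed : ∀ s ∈ Icc 0 ℓ, ‖tangent ℓ γ s‖ = 1
  closed : γ 0 = γ ℓ
  tangent_closed : tangent ℓ γ 0 = tangent ℓ γ ℓ

/-- Closed planar `C²` curves of length `ℓ`, parametrized by arc length on `[0, ℓ]`. -/
structure IsClosedC2Curve (ℓ : ℝ) (γ : ℝ → Plane) : Prop where
  contDiffOn : ContDiffOn ℝ 2 γ (Icc 0 ℓ)
  unitSpeed : ∀ s ∈ Icc 0 ℓ, ‖tangent ℓ γ s‖ = 1
  closed : γ 0 = γ ℓ
  tangent_closed : tangent ℓ γ 0 = tangent ℓ γ ℓ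
  secondDeriv_closed : secondDeriv ℓ γ 0 = secondDeriv ℓ γ ℓ

/-- The squared `H¹([0, ℓ]; ℝ²)` distance of two curves. -/
def h1DistSq (ℓ : ℝ) (γ₁ γ₂ : ℝ → Plane) : ℝ :=
  (∫ s in (0)..ℓ, ‖γ₁ s - γ₂ s‖ ^ 2) + ∫ s in (0)..ℓ, ‖tangent ℓ γ₁ s - tangent ℓ γ₂ s‖ ^ 2

/-- The energy `𝒢_ε(η) = ε^{1/2} ∫ κ_η² ds + (2 ε^{1/2})⁻¹ ∫ |∂ₛη - ∂ₛγ|² ds`. -/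
def energy (ℓ : ℝ) (γ : ℝ → Plane) (ε : ℝ) (η : ℝ → Plane) : ℝ :=
  √ε * (∫ s in (0)..ℓ, curvature ℓ η s ^ 2) +
    1 / (2 * √ε) * ∫ s in (0)..ℓ, ‖tangent ℓ η s - tangent ℓ γ s‖ ^ 2

/-- Test functions for the periodic flat norm: Lipschitz functions `φ` on `[0, ℓ]` with
`φ(0) = φ(ℓ)` and `‖φ‖_∞ + Lip(φ) ≤ 1`. -/
def IsFlatTest (ℓ : ℝ) (φ : ℝ → ℝ) : Prop :=
  φ 0 = φ ℓ ∧ ∃ M K : ℝ≥0, M + K ≤ 1 ∧ (∀ x ∈ Icc 0 ℓ, |φ x| ≤ M) ∧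
    LipschitzOnWith K φ (Icc 0 ℓ)

/-- The periodic flat norm on `[0, ℓ]` of a signed measure: the supremum of `∫_{[0, ℓ]} φ dμ` over
the test functions `φ`. (The set of test functions is symmetric, so only the nonnegative
integrals matter, and the supremum may be taken in `[0, ∞]`.) -/
def flatNorm (ℓ : ℝ) (μ : SignedMeasure ℝ) : ℝ≥0∞ :=
  ⨆ (φ : ℝ → ℝ) (_ : IsFlatTest ℓ φ),
    ENNReal.ofReal (VectorMeasure.integral (μ.restrict (Icc 0 ℓ)) φ
      (ContinuousLinearMap.lsmul ℝ ℝ).flip)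

/-- The measure `κ_γ ds` on `[0, ℓ]`. -/
def curvatureMeasure (ℓ : ℝ) (γ : ℝ → Plane) : SignedMeasure ℝ :=
  (volume.restrict (Icc 0 ℓ)).withDensityᵥ (curvature ℓ γ)

/-- The atomic measure `2π ∑ⱼ cⱼ δ_{sⱼ}`; the `sⱼ` are the points of the support of `c` and
`cⱼ = c sⱼ`. -/
def atomicMeasure (c : ℝ →₀ ℤ) : SignedMeasure ℝ :=
  ∑ s ∈ c.support, VectorMeasure.dirac s (2 * Real.pi * (c s : ℝ))

/-- The points `sⱼ` lie in `[0, ℓ]` and are distinct as points of the closed curve, that is, `0` and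
`ℓ` (which are the same point of the curve, and are not distinguished by the periodic flat norm)
do not both occur. -/
def IsSingularity (ℓ : ℝ) (c : ℝ →₀ ℤ) : Prop :=
  (∀ s ∈ c.support, s ∈ Icc 0 ℓ) ∧ ¬ (0 ∈ c.support ∧ ℓ ∈ c.support)

/-- The measure `κ_γ ds + 2π ∑ⱼ cⱼ δ_{sⱼ}` compatible with `γ`. -/
def pointedMeasure (ℓ : ℝ) (γ : ℝ → Plane) (c : ℝ →₀ ℤ) : SignedMeasure ℝ :=
  curvatureMeasure ℓ γ + atomicMeasure c

/-- `∑ⱼ |cⱼ|`. -/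
def totalMultiplicity (c : ℝ →₀ ℤ) : ℝ :=
  ∑ s ∈ c.support, |(c s : ℝ)|

/-- Convergence along `F` of the pairs `(η_i, κ_{η_i} ds)` to the pair `(γ, μ)`: the curves
converge in `H¹` and the measures in the periodic flat norm. -/
def ConvergesTo {ι : Type*} (F : Filter ι) (ℓ : ℝ) (η : ι → ℝ → Plane)
    (γ : ℝ → Plane) (μ : SignedMeasure ℝ) : Prop :=
  Tendsto (fun i => h1DistSq ℓ (η i) γ) F (𝓝 0) ∧
    Tendsto (fun i => flatNorm ℓ (curvatureMeasure ℓ (η i) - μ)) F (𝓝 0)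

end PointedClosedCurve

end

open PointedClosedCurve

/-!
# Γ-convergence of a phase-field energy for pointed closed curves

Everything is expressed through the angle `u` from `∂ₛγ` to `∂ₛη`: identifying the plane with `ℂ`,
`∂ₛη = e^{iu} ∂ₛγ` (`IsAngle`, `exists_isAngle`). Then `κ_η = κ_γ + u'` and
`|∂ₛη - ∂ₛγ| = 2 |sin (u / 2)|`, so that `𝒢_ε` is, up to `κ_γ`, the Modica–Mortola energy
`∫ (√ε u'² + (2 / √ε) sin² (u / 2))` with the wells `2πℤ`. A transition between neighbouring wells
costs `2√2 ∫₀^{2π} |sin (y / 2)| dy = 8√2` and contributes an atom of mass `±2π` to `u' ds`.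

*Lower bound.* By the Modica–Mortola inequality (`IsAngle.le_energy`), the energy is at least
`2√2 ∫ φ κ_η |sin (u / 2)|` for every `|φ| ≤ 1`. The function `|sin (y / 2)|` has mean `2 / π`, and
the primitive of its oscillation (`transitionDefect`) is periodic and bounded by
`π |sin (y / 2)|`. Hence, for periodic Lipschitz `φ`, an integration by parts replaces the weight
`|sin (u / 2)|` by `2 / π` up to an error which vanishes with `∂ₛη - ∂ₛγ` in `L¹`. What remains
is `(4√2 / π) ∫ φ (κ_η - κ_γ)`, which converges to `8√2 ∑ cⱼ φ(sⱼ)`; a `φ` with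
`φ(sⱼ) = sign cⱼ` gives the claim (`exists_tendsto_le_energy`).

*Compactness.* The same inequality bounds the variation of `cos u`. Following `u` with hysteresis,
one finds a step function with values in `2πℤ`, a bounded number of unit jumps, and distance at most
`3π/2` from `u`, hence at distance at most `10 |sin (u / 2)|`
(`exists_step_approximation`, `abs_le_mul_abs_sin_half`). In the flat norm, `(κ_η - κ_γ) ds` is
therefore close to an atomic measure with a bounded number of atoms of mass `0` or `±2π`
(`IsAngle.exists_atoms`), and these form a compact family.

*Recovery sequence.* Each atom is replaced by unit transitions with the optimal profile
`4 arctan (exp ((s - p) / w))`, `w = √2 √ε`, centered at mutual distance `ε^{1/4}`, so that their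
interaction is exponentially small (`integral_transitionsBound_sq_le`). The curve with this angle
does not close up; since `p ↦ ∫ ⟨p, ∂ₛγ⟩ ∂ₛγ` is invertible for a closed curve, an inverse function
argument provides a correction `⟨p, ∂ₛγ⟩` of the angle, of order `√ε`, which closes the curve
(`exists_closing_correction`) and does not affect the limits (`exists_recovery_of_transitions`).
-/

open Set Filter Topology MeasureTheory
open scoped ENNReal NNReal

noncomputable section

namespace PointedClosedCurve

/-! ### Absolute continuity -/

theorem absolutelyContinuousOnInterval_of_dist_le {X Y : Type*} [PseudoMetricSpace X]
    [PseudoMetricSpace Y] {f : ℝ → X} {g : ℝ → Y} {a b K : ℝ}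
    (hf : AbsolutelyContinuousOnInterval f a b)
    (h : ∀ x ∈ uIcc a b, ∀ y ∈ uIcc a b, dist (g x) (g y) ≤ K * dist (f x) (f y)) :
    AbsolutelyContinuousOnInterval g a b := by
  have hf' : Tendsto (fun E : ℕ × (ℕ → ℝ × ℝ) =>
      K * ∑ i ∈ Finset.range E.1, dist (f (E.2 i).1) (f (E.2 i).2))
      (AbsolutelyContinuousOnInterval.totalLengthFilter ⊓
        𝓟 (AbsolutelyContinuousOnInterval.disjWithin a b)) (𝓝 0) := by
    simpa using Tendsto.const_mul K hf
  refine squeeze_zero' (Eventually.of_forall fun E => Finset.sum_nonneg fun _ _ => dist_nonneg)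
    ?_ hf'
  have hmem : ∀ᶠ E in (AbsolutelyContinuousOnInterval.totalLengthFilter ⊓
        𝓟 (AbsolutelyContinuousOnInterval.disjWithin a b)),
      E ∈ AbsolutelyContinuousOnInterval.disjWithin a b :=
    mem_inf_of_right (mem_principal_self _)
  filter_upwards [hmem] with E hE
  rw [Finset.mul_sum]
  exact Finset.sum_le_sum fun i hi => h _ (hE.1 i hi).1 _ (hE.1 i hi).2

theorem ae_mem_Icc_imp_mem_Ioo (a b : ℝ) : ∀ᵐ x : ℝ, x ∈ Icc a b → x ∈ Ioo a b := by
  have h : ∀ᵐ x : ℝ, x ≠ a ∧ x ≠ b := by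
    have ha : ∀ᵐ x : ℝ, x ≠ a := by simp [ae_iff, measure_singleton]
    have hb : ∀ᵐ x : ℝ, x ≠ b := by simp [ae_iff, measure_singleton]
    filter_upwards [ha, hb] with x h1 h2 using ⟨h1, h2⟩
  filter_upwards [h] with x hx hx'
  exact ⟨lt_of_le_of_ne hx'.1 (Ne.symm hx.1), lt_of_le_of_ne hx'.2 hx.2⟩

/-! ### Arc length curves in the complex plane -/

/-- The identification of the Euclidean plane with `ℂ`. -/
def toC : Plane ≃ₗᵢ[ℝ] ℂ := Complex.orthonormalBasisOneI.repr.symm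

theorem toC_apply (v : Plane) : toC v = v 0 + v 1 * Complex.I :=
  Complex.orthonormalBasisOneI_repr_symm_apply v

@[simp] theorem toC_re (v : Plane) : (toC v).re = v 0 := by simp [toC_apply]
@[simp] theorem toC_im (v : Plane) : (toC v).im = v 1 := by simp [toC_apply]

variable {ℓ : ℝ} {γ η : ℝ → Plane}

theorem abs_coord_le (v : Plane) (i : Fin 2) : |v i| ≤ ‖v‖ := by
  simpa using PiLp.norm_apply_le v i

theorem sq_add_sq_eq_norm_sq (v : Plane) : v 0 ^ 2 + v 1 ^ 2 = ‖v‖ ^ 2 := by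
  rw [EuclideanSpace.norm_sq_eq]; simp

/-- A `C²` arc length curve is an `H²` arc length curve. -/
theorem isClosedH2Curve_of_contDiffOn_two (hℓ : 0 < ℓ) (h2 : ContDiffOn ℝ 2 γ (Icc 0 ℓ))
    (hunit : ∀ s ∈ Icc 0 ℓ, ‖tangent ℓ γ s‖ = 1) (hcl : γ 0 = γ ℓ)
    (htcl : tangent ℓ γ 0 = tangent ℓ γ ℓ) : IsClosedH2Curve ℓ γ := by
  have hu : UniqueDiffOn ℝ (Icc 0 ℓ) := uniqueDiffOn_Icc hℓ
  have h1 : ContDiffOn ℝ 1 (tangent ℓ γ) (Icc 0 ℓ) := h2.derivWithin hu (by norm_num)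
  have h0 : ContinuousOn (secondDeriv ℓ γ) (Icc 0 ℓ) :=
    h1.continuousOn_derivWithin hu (by norm_num)
  refine ⟨⟨h2.of_le (by norm_num), ?_, ?_⟩, hunit, hcl, htcl⟩
  · apply ContDiffOn.absolutelyContinuousOnInterval
    rwa [uIcc_of_le hℓ.le]
  · obtain ⟨C, hC⟩ := isCompact_Icc.exists_bound_of_continuousOn h0
    exact MemLp.of_bound (h0.aestronglyMeasurable measurableSet_Icc) C
      ((ae_restrict_iff' measurableSet_Icc).2 (Eventually.of_forall hC))

theorem IsClosedC2Curve.isClosedH2Curve (hℓ : 0 < ℓ) (hγ : IsClosedC2Curve ℓ γ) :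
    IsClosedH2Curve ℓ γ :=
  isClosedH2Curve_of_contDiffOn_two hℓ hγ.contDiffOn hγ.unitSpeed hγ.closed hγ.tangent_closed

theorem IsClosedH2Curve.continuousOn_tangent (hℓ : 0 < ℓ) (hη : IsClosedH2Curve ℓ η) :
    ContinuousOn (tangent ℓ η) (Icc 0 ℓ) :=
  hη.isH2.contDiffOn.continuousOn_derivWithin (uniqueDiffOn_Icc hℓ) (by norm_num)

theorem IsClosedH2Curve.hasDerivAt (hη : IsClosedH2Curve ℓ η) {s : ℝ}
    (hs : s ∈ Ioo 0 ℓ) : HasDerivAt η (tangent ℓ η s) s := by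
  have hd := (hη.isH2.contDiffOn.differentiableOn (by norm_num)) s (Ioo_subset_Icc_self hs)
  exact hd.hasDerivWithinAt.hasDerivAt (Icc_mem_nhds hs.1 hs.2)

theorem IsClosedH2Curve.sub_eq_integral (hℓ : 0 < ℓ) (hη : IsClosedH2Curve ℓ η) {s : ℝ}
    (hs : s ∈ Icc 0 ℓ) : η s - η 0 = ∫ t in (0)..s, tangent ℓ η t := by
  have hsub : Icc 0 s ⊆ Icc 0 ℓ := Icc_subset_Icc_right hs.2
  symm
  apply intervalIntegral.integral_eq_sub_of_hasDeriv_right_of_le hs.1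
    (hη.isH2.contDiffOn.continuousOn.mono hsub)
  · intro t ht
    exact (hη.hasDerivAt ⟨ht.1, ht.2.trans_le hs.2⟩).hasDerivWithinAt
  · exact ((hη.continuousOn_tangent hℓ).mono (by rwa [uIcc_of_le hs.1])).intervalIntegrable

theorem IsClosedH2Curve.memLp_curvature (hℓ : 0 < ℓ) (hη : IsClosedH2Curve ℓ η) :
    MemLp (curvature ℓ η) 2 (volume.restrict (Icc 0 ℓ)) := by
  have ht := (hη.continuousOn_tangent hℓ).aestronglyMeasurable (μ := volume) measurableSet_Icc
  have hm := hη.isH2.memLp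
  have hcoord : ∀ (f : ℝ → Plane), AEStronglyMeasurable f (volume.restrict (Icc 0 ℓ)) →
      ∀ i : Fin 2, AEStronglyMeasurable (fun s => f s i) (volume.restrict (Icc 0 ℓ)) :=
    fun f hf i => (EuclideanSpace.proj i : Plane →L[ℝ] ℝ).continuous.comp_aestronglyMeasurable hf
  refine MemLp.of_le_mul (c := 2) hm ?_ ?_
  · exact ((hcoord _ ht 0).mul (hcoord _ hm.1 1)).sub ((hcoord _ ht 1).mul (hcoord _ hm.1 0))
  · refine (ae_restrict_iff' measurableSet_Icc).2 (Eventually.of_forall fun s hs => ?_)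
    have h1 := hη.unitSpeed s hs
    have a0 := abs_coord_le (tangent ℓ η s) 0
    have a1 := abs_coord_le (tangent ℓ η s) 1
    have b0 := abs_coord_le (secondDeriv ℓ η s) 0
    have b1 := abs_coord_le (secondDeriv ℓ η s) 1
    rw [h1] at a0 a1
    rw [curvature, Real.norm_eq_abs]
    refine (abs_sub _ _).trans ?_
    rw [abs_mul, abs_mul]
    nlinarith [abs_nonneg (tangent ℓ η s 0), abs_nonneg (tangent ℓ η s 1),
      abs_nonneg (secondDeriv ℓ η s 0), abs_nonneg (secondDeriv ℓ η s 1)]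

theorem IsClosedH2Curve.integrable_curvature (hℓ : 0 < ℓ) (hη : IsClosedH2Curve ℓ η) :
    Integrable (curvature ℓ η) (volume.restrict (Icc 0 ℓ)) :=
  (hη.memLp_curvature hℓ).integrable (by norm_num)

theorem intervalIntegrable_of_integrable_Icc {E : Type*} [NormedAddCommGroup E] {f : ℝ → E}
    (hℓ : 0 ≤ ℓ) (hf : Integrable f (volume.restrict (Icc 0 ℓ))) :
    IntervalIntegrable f volume 0 ℓ := by
  rw [intervalIntegrable_iff_integrableOn_Icc_of_le hℓ]
  exact hf

theorem IsClosedH2Curve.intervalIntegrable_curvature (hℓ : 0 < ℓ) (hη : IsClosedH2Curve ℓ η) :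
    IntervalIntegrable (curvature ℓ η) volume 0 ℓ :=
  intervalIntegrable_of_integrable_Icc hℓ.le (hη.integrable_curvature hℓ)

theorem IsClosedH2Curve.intervalIntegrable_curvature_sq (hℓ : 0 < ℓ)
    (hη : IsClosedH2Curve ℓ η) :
    IntervalIntegrable (fun s => curvature ℓ η s ^ 2) volume 0 ℓ :=
  intervalIntegrable_of_integrable_Icc hℓ.le (hη.memLp_curvature hℓ).integrable_sq

theorem IsClosedC2Curve.continuousOn_curvature (hℓ : 0 < ℓ) (hγ : IsClosedC2Curve ℓ γ) :
    ContinuousOn (curvature ℓ γ) (Icc 0 ℓ) := by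
  have hu : UniqueDiffOn ℝ (Icc 0 ℓ) := uniqueDiffOn_Icc hℓ
  have h1 : ContDiffOn ℝ 1 (tangent ℓ γ) (Icc 0 ℓ) := hγ.contDiffOn.derivWithin hu (by norm_num)
  have h0 : ContinuousOn (secondDeriv ℓ γ) (Icc 0 ℓ) :=
    h1.continuousOn_derivWithin hu (by norm_num)
  have hcoord : ∀ (f : ℝ → Plane), ContinuousOn f (Icc 0 ℓ) →
      ∀ i : Fin 2, ContinuousOn (fun s => f s i) (Icc 0 ℓ) :=
    fun f hf i => (EuclideanSpace.proj i : Plane →L[ℝ] ℝ).continuous.comp_continuousOn hf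
  exact ((hcoord _ h1.continuousOn 0).mul (hcoord _ h0 1)).sub
    ((hcoord _ h1.continuousOn 1).mul (hcoord _ h0 0))

/-- The Frenet equation: wherever the tangent of an arc length curve has a derivative, that
derivative is the curvature times the rotated tangent. -/
theorem toC_secondDeriv_eq (hunit : ∀ s ∈ Icc 0 ℓ, ‖tangent ℓ η s‖ = 1) {s : ℝ}
    (hs : s ∈ Ioo 0 ℓ) (hd : HasDerivAt (tangent ℓ η) (secondDeriv ℓ η s) s) :
    toC (secondDeriv ℓ η s) = curvature ℓ η s * Complex.I * toC (tangent ℓ η s) := by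
  have hc : ∀ i : Fin 2, HasDerivAt (fun t => tangent ℓ η t i) (secondDeriv ℓ η s i) s :=
    fun i => (EuclideanSpace.proj i : Plane →L[ℝ] ℝ).hasFDerivAt.comp_hasDerivAt s hd
  have hsum : HasDerivAt (fun t => tangent ℓ η t 0 ^ 2 + tangent ℓ η t 1 ^ 2)
      (2 * tangent ℓ η s 0 * secondDeriv ℓ η s 0 +
        2 * tangent ℓ η s 1 * secondDeriv ℓ η s 1) s := by
    simpa using ((hc 0).fun_pow 2).fun_add ((hc 1).fun_pow 2)
  have hone : (fun t => tangent ℓ η t 0 ^ 2 + tangent ℓ η t 1 ^ 2) =ᶠ[𝓝 s] fun _ => 1 := by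
    filter_upwards [Icc_mem_nhds hs.1 hs.2] with t ht
    rw [sq_add_sq_eq_norm_sq, hunit t ht, one_pow]
  have hzero := hsum.unique ((hasDerivAt_const s (1 : ℝ)).congr_of_eventuallyEq hone)
  have h1 : tangent ℓ η s 0 ^ 2 + tangent ℓ η s 1 ^ 2 = 1 := hone.self_of_nhds
  apply Complex.ext
  · simp [curvature]
    linear_combination (-secondDeriv ℓ η s 0) * h1 + tangent ℓ η s 0 / 2 * hzero
  · simp [curvature]
    linear_combination (-secondDeriv ℓ η s 1) * h1 + tangent ℓ η s 1 / 2 * hzero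

theorem IsClosedH2Curve.ae_hasDerivAt_tangent (hη : IsClosedH2Curve ℓ η) :
    ∀ᵐ s, s ∈ Icc 0 ℓ → s ∈ Ioo 0 ℓ ∧ HasDerivAt (tangent ℓ η) (secondDeriv ℓ η s) s := by
  have hac : ∀ i : Fin 2, AbsolutelyContinuousOnInterval (fun s => tangent ℓ η s i) 0 ℓ := fun i =>
    absolutelyContinuousOnInterval_of_dist_le (K := 1) hη.isH2.absolutelyContinuous
      fun x _ y _ => by
        rw [one_mul, Real.dist_eq, dist_eq_norm]
        exact abs_coord_le (tangent ℓ η x - tangent ℓ η y) i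
  filter_upwards [ae_mem_Icc_imp_mem_Ioo 0 ℓ, (hac 0).ae_differentiableAt,
    (hac 1).ae_differentiableAt] with s hs h0 h1 hmem
  have hs' := hs hmem
  have hu : s ∈ uIcc 0 ℓ := Icc_subset_uIcc hmem
  refine ⟨hs', ?_⟩
  have hd : DifferentiableAt ℝ (tangent ℓ η) s := by
    rw [differentiableAt_euclidean]
    intro i
    fin_cases i
    · exact h0 hu
    · exact h1 hu
  rw [secondDeriv, derivWithin_of_mem_nhds (Icc_mem_nhds hs'.1 hs'.2)]
  exact hd.hasDerivAt

/-- The tangent of an `H²` arc length curve is determined by its initial value and the curvature. -/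
theorem IsClosedH2Curve.toC_tangent_eq (hℓ : 0 < ℓ) (hη : IsClosedH2Curve ℓ η) {s : ℝ}
    (hs : s ∈ Icc 0 ℓ) :
    toC (tangent ℓ η s) = toC (tangent ℓ η 0) *
      Complex.exp ((∫ t in (0)..s, curvature ℓ η t : ℝ) * Complex.I) := by
  have hκ := hη.intervalIntegrable_curvature hℓ
  set θ : ℝ → ℝ := fun s => ∫ t in (0)..s, curvature ℓ η t with hθ
  have hθac : AbsolutelyContinuousOnInterval θ 0 ℓ :=
    hκ.absolutelyContinuousOnInterval_intervalIntegral left_mem_uIcc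
  have hT : AbsolutelyContinuousOnInterval (fun s => toC (tangent ℓ η s)) 0 ℓ :=
    absolutelyContinuousOnInterval_of_dist_le (K := 1) hη.isH2.absolutelyContinuous
      fun x _ y _ => by rw [one_mul, toC.dist_map]
  have hE : AbsolutelyContinuousOnInterval (fun s => Complex.exp ((-θ s : ℝ) * Complex.I)) 0 ℓ := by
    refine absolutelyContinuousOnInterval_of_dist_le (K := 1) hθac fun x _ y _ => ?_
    rw [one_mul, dist_eq_norm, Real.dist_eq]
    have h1 : Complex.exp ((-θ x : ℝ) * Complex.I) - Complex.exp ((-θ y : ℝ) * Complex.I) =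
        Complex.exp ((-θ y : ℝ) * Complex.I) *
          (Complex.exp (Complex.I * ((θ y - θ x : ℝ) : ℂ)) - 1) := by
      rw [mul_sub, ← Complex.exp_add, mul_one]
      congr 2
      push_cast; ring
    rw [h1, norm_mul, Complex.norm_exp_ofReal_mul_I, one_mul, abs_sub_comm]
    exact Real.norm_exp_I_mul_ofReal_sub_one_le
  have hprod := hT.smul hE
  have hder : ∀ᵐ x, x ∈ uIcc 0 ℓ → HasDerivAt ((fun s => toC (tangent ℓ η s)) •
      (fun s => Complex.exp ((-θ s : ℝ) * Complex.I))) 0 x := by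
    filter_upwards [hη.ae_hasDerivAt_tangent, hκ.ae_hasDerivAt_integral] with x h1 h2 hx
    obtain ⟨hx', h1⟩ := h1 (by rwa [uIcc_of_le hℓ.le] at hx)
    have hd1 : HasDerivAt (fun s => toC (tangent ℓ η s)) (toC (secondDeriv ℓ η x)) x :=
      toC.toContinuousLinearEquiv.toContinuousLinearMap.hasFDerivAt.comp_hasDerivAt x h1
    have hd2 : HasDerivAt θ (curvature ℓ η x) x := h2 hx 0 left_mem_uIcc
    have hd3 : HasDerivAt (fun s => Complex.exp ((-θ s : ℝ) * Complex.I))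
        (Complex.exp ((-θ x : ℝ) * Complex.I) * ((-curvature ℓ η x : ℝ) * Complex.I)) x :=
      ((hd2.neg.ofReal_comp).mul_const Complex.I).cexp
    have := hd1.mul hd3
    convert! this using 1
    rw [toC_secondDeriv_eq hη.unitSpeed hx' h1]
    push_cast
    ring
  obtain ⟨C, hC⟩ := hprod.const_of_ae_hasDerivAt_zero hder
  have h0 := hC 0 left_mem_uIcc
  have h1 := hC s (by rwa [uIcc_of_le hℓ.le])
  simp only [Pi.smul_apply', smul_eq_mul] at h0 h1
  have hθ0 : θ 0 = 0 := by simp [hθ]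
  rw [hθ0] at h0
  simp only [neg_zero, Complex.ofReal_zero, zero_mul, Complex.exp_zero, mul_one] at h0
  rw [h0, ← h1, mul_assoc, ← Complex.exp_add]
  simp [hθ]

/-- `u` is an angle function from the tangent of `γ` to the tangent of `η`: it is absolutely
continuous, `∂ₛη = e^{iu} ∂ₛγ`, and its derivative is the difference of the curvatures. -/
structure IsAngle (ℓ : ℝ) (γ η : ℝ → Plane) (u : ℝ → ℝ) : Prop where
  absolutelyContinuous : AbsolutelyContinuousOnInterval u 0 ℓ
  ae_hasDerivAt : ∀ᵐ s, s ∈ Icc 0 ℓ → HasDerivAt u (curvature ℓ η s - curvature ℓ γ s) s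
  toC_tangent : ∀ s ∈ Icc 0 ℓ,
    toC (tangent ℓ η s) = toC (tangent ℓ γ s) * Complex.exp (u s * Complex.I)
  periodic : ∃ n : ℤ, u ℓ - u 0 = 2 * Real.pi * n

theorem norm_exp_sub_one (x : ℝ) : ‖Complex.exp (x * Complex.I) - 1‖ = 2 * |Real.sin (x / 2)| := by
  have := Complex.norm_exp_I_mul_ofReal_sub_one x
  rw [mul_comm, this, Real.norm_eq_abs, abs_mul]
  norm_num

/-- Every pair of closed curves has an angle function, since both tangents are obtained by
integration of the curvatures. -/
theorem exists_isAngle (hℓ : 0 < ℓ) (hγ : IsClosedH2Curve ℓ γ) (hη : IsClosedH2Curve ℓ η) :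
    ∃ u, IsAngle ℓ γ η u := by
  have hκη := hη.intervalIntegrable_curvature hℓ
  have hκγ := hγ.intervalIntegrable_curvature hℓ
  have hw := hκη.sub hκγ
  have h0mem : (0 : ℝ) ∈ Icc 0 ℓ := left_mem_Icc.2 hℓ.le
  have hℓmem : ℓ ∈ Icc 0 ℓ := right_mem_Icc.2 hℓ.le
  have hnγ : ∀ s ∈ Icc 0 ℓ, ‖toC (tangent ℓ γ s)‖ = 1 := fun s hs => by
    rw [toC.norm_map, hγ.unitSpeed s hs]
  have hγ0 : toC (tangent ℓ γ 0) ≠ 0 := norm_ne_zero_iff.1 (by rw [hnγ 0 h0mem]; norm_num)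
  set q := toC (tangent ℓ η 0) / toC (tangent ℓ γ 0) with hq
  have hqn : ‖q‖ = 1 := by
    rw [hq, norm_div, hnγ 0 h0mem, toC.norm_map, hη.unitSpeed 0 h0mem, div_one]
  have hqe : Complex.exp (q.arg * Complex.I) = q := by
    have := Complex.norm_mul_exp_arg_mul_I q
    rwa [hqn, Complex.ofReal_one, one_mul] at this
  set u : ℝ → ℝ := fun s => q.arg + ∫ t in (0)..s, (curvature ℓ η t - curvature ℓ γ t) with hu
  have hac : AbsolutelyContinuousOnInterval
      (fun s => ∫ t in (0)..s, (curvature ℓ η t - curvature ℓ γ t)) 0 ℓ :=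
    hw.absolutelyContinuousOnInterval_intervalIntegral left_mem_uIcc
  have htan : ∀ s ∈ Icc 0 ℓ,
      toC (tangent ℓ η s) = toC (tangent ℓ γ s) * Complex.exp (u s * Complex.I) := by
    intro s hs
    have hsub : uIcc 0 s ⊆ uIcc 0 ℓ := by
      rw [uIcc_of_le hs.1, uIcc_of_le hℓ.le]; exact Icc_subset_Icc_right hs.2
    have hus : u s = q.arg + ((∫ t in (0)..s, curvature ℓ η t) -
        ∫ t in (0)..s, curvature ℓ γ t) := by
      rw [hu]; simp only
      rw [intervalIntegral.integral_sub (hκη.mono_set hsub) (hκγ.mono_set hsub)]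
    rw [hη.toC_tangent_eq hℓ hs, hγ.toC_tangent_eq hℓ hs, hus]
    have h1 : toC (tangent ℓ η 0) = toC (tangent ℓ γ 0) * Complex.exp (q.arg * Complex.I) := by
      rw [hqe, hq]; field_simp
    rw [h1, mul_assoc, mul_assoc, ← Complex.exp_add, ← Complex.exp_add]
    congr 2
    push_cast; ring
  refine ⟨u, ?_, ?_, htan, ?_⟩
  · exact absolutelyContinuousOnInterval_of_dist_le (K := 1) hac fun x _ y _ => by simp [hu]
  · filter_upwards [hw.ae_hasDerivAt_integral] with s hs hmem
    exact (hs (Icc_subset_uIcc hmem) 0 left_mem_uIcc).const_add _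
  · have e1 := htan 0 h0mem
    have e2 := htan ℓ hℓmem
    rw [← hη.tangent_closed, ← hγ.tangent_closed, e1] at e2
    have e3 := mul_left_cancel₀ hγ0 e2
    obtain ⟨n, hn⟩ := Complex.exp_eq_exp_iff_exists_int.1 e3
    refine ⟨-n, ?_⟩
    have h4 : ((u 0 : ℝ) : ℂ) = u ℓ + n * (2 * Real.pi) := by
      have hI := Complex.I_ne_zero
      apply mul_right_cancel₀ hI
      rw [hn]; ring
    have h5 : u 0 = u ℓ + n * (2 * Real.pi) := by exact_mod_cast h4
    rw [h5]; push_cast; ring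

theorem IsAngle.continuousOn (hℓ : 0 < ℓ) {u : ℝ → ℝ} (hu : IsAngle ℓ γ η u) :
    ContinuousOn u (Icc 0 ℓ) := by
  simpa [uIcc_of_le hℓ.le] using hu.absolutelyContinuous.continuousOn

theorem IsAngle.norm_tangent_sub (hγ : ∀ s ∈ Icc 0 ℓ, ‖tangent ℓ γ s‖ = 1) {u : ℝ → ℝ}
    (hu : IsAngle ℓ γ η u) {s : ℝ} (hs : s ∈ Icc 0 ℓ) :
    ‖tangent ℓ η s - tangent ℓ γ s‖ = 2 * |Real.sin (u s / 2)| := by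
  rw [← toC.norm_map, map_sub, hu.toC_tangent s hs, ← norm_exp_sub_one]
  have : toC (tangent ℓ γ s) * Complex.exp (u s * Complex.I) - toC (tangent ℓ γ s) =
      toC (tangent ℓ γ s) * (Complex.exp (u s * Complex.I) - 1) := by ring
  rw [this, norm_mul, toC.norm_map, hγ s hs, one_mul]

/-! ### The flat norm -/

theorem isFiniteMeasure_variation {α : Type*} [MeasurableSpace α] (μ : SignedMeasure α) :
    IsFiniteMeasure μ.variation := by
  rw [← μ.totalVariation_eq_variation]
  infer_instance

theorem integrable_restrict_Icc_of_continuousOn (μ : SignedMeasure ℝ) {φ : ℝ → ℝ}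
    (hφ : ContinuousOn φ (Icc 0 ℓ)) :
    (μ.restrict (Icc 0 ℓ)).Integrable φ := by
  have := isFiniteMeasure_variation μ
  rw [VectorMeasure.Integrable, VectorMeasure.variation_restrict measurableSet_Icc]
  obtain ⟨C, hC⟩ := isCompact_Icc.exists_bound_of_continuousOn hφ
  exact Integrable.of_bound (hφ.aestronglyMeasurable measurableSet_Icc) C
    ((ae_restrict_iff' measurableSet_Icc).2 (Eventually.of_forall hC))

/-- Integration of a bounded function against a signed measure with an integrable density. -/
theorem integral_withDensityᵥ_eq {α : Type*} [MeasurableSpace α] {μ : Measure α} {f φ : α → ℝ}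
    (hf : Integrable f μ) (hφ : AEStronglyMeasurable φ μ) {C : ℝ} (hC : ∀ᵐ x ∂μ, ‖φ x‖ ≤ C) :
    VectorMeasure.integral (μ.withDensityᵥ f) φ (ContinuousLinearMap.lsmul ℝ ℝ).flip =
      ∫ x, f x * φ x ∂μ := by
  have h1 : IsFiniteMeasure (μ.withDensity fun x => ENNReal.ofReal (f x)) :=
    isFiniteMeasure_withDensity_ofReal hf.2
  have h2 : IsFiniteMeasure (μ.withDensity fun x => ENNReal.ofReal (-f x)) :=
    isFiniteMeasure_withDensity_ofReal hf.neg.2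
  have hint : ∀ g : α → ℝ, IsFiniteMeasure (μ.withDensity fun x => ENNReal.ofReal (g x)) →
      Integrable φ (μ.withDensity fun x => ENNReal.ofReal (g x)) := fun g hg =>
    Integrable.of_bound (hφ.mono_ac (withDensity_absolutelyContinuous _ _)) C
      ((withDensity_absolutelyContinuous _ _).ae_le hC)
  have key : ∀ g : α → ℝ, Integrable g μ →
      ∫ x, φ x ∂(μ.withDensity fun x => ENNReal.ofReal (g x)) = ∫ x, max (g x) 0 * φ x ∂μ := by
    intro g hg
    rw [integral_withDensity_eq_integral_toReal_smul₀
      (hg.1.aemeasurable.ennreal_ofReal) (by simp)]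
    simp [ENNReal.toReal_ofReal']
  rw [withDensityᵥ_eq_withDensity_pos_part_sub_withDensity_neg_part hf,
    VectorMeasure.integral_sub_vectorMeasure, VectorMeasure.integral_toSignedMeasure,
    VectorMeasure.integral_toSignedMeasure, key f hf, key (fun x => -f x) hf.neg, ← integral_sub]
  · refine integral_congr_ae (Eventually.of_forall fun x => ?_)
    simp only
    rw [← sub_mul]
    congr 1
    rcases le_total (f x) 0 with h | h
    · rw [max_eq_right h, max_eq_left (by linarith)]; ring
    · rw [max_eq_left h, max_eq_right (by linarith)]; ring
  · exact (hf.sup (integrable_zero _ _ _)).mul_bdd hφ hC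
  · exact (hf.neg.sup (integrable_zero _ _ _)).mul_bdd hφ hC
  · rw [VectorMeasure.Integrable, Measure.variation_toSignedMeasure]; exact hint f h1
  · rw [VectorMeasure.Integrable, Measure.variation_toSignedMeasure]; exact hint (fun x => -f x) h2

theorem curvatureMeasure_restrict :
    (curvatureMeasure ℓ η).restrict (Icc 0 ℓ) = curvatureMeasure ℓ η := by
  by_cases hf : Integrable (curvature ℓ η) (volume.restrict (Icc 0 ℓ))
  · ext s hs
    rw [VectorMeasure.restrict_apply _ measurableSet_Icc hs, curvatureMeasure,
      withDensityᵥ_apply hf hs, withDensityᵥ_apply hf (hs.inter measurableSet_Icc),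
      Measure.restrict_restrict hs, Measure.restrict_restrict (hs.inter measurableSet_Icc),
      inter_assoc, inter_self]
  · simp [curvatureMeasure, Measure.withDensityᵥ, hf]

theorem integral_curvatureMeasure (hℓ : 0 < ℓ) (hη : IsClosedH2Curve ℓ η) {φ : ℝ → ℝ}
    (hφ : ContinuousOn φ (Icc 0 ℓ)) :
    VectorMeasure.integral ((curvatureMeasure ℓ η).restrict (Icc 0 ℓ)) φ
      (ContinuousLinearMap.lsmul ℝ ℝ).flip = ∫ s in (0)..ℓ, φ s * curvature ℓ η s := by
  obtain ⟨C, hC⟩ := isCompact_Icc.exists_bound_of_continuousOn hφ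
  rw [curvatureMeasure_restrict, curvatureMeasure,
    integral_withDensityᵥ_eq (hη.integrable_curvature hℓ)
      (hφ.aestronglyMeasurable measurableSet_Icc)
      ((ae_restrict_iff' measurableSet_Icc).2 (Eventually.of_forall hC)),
    intervalIntegral.integral_of_le hℓ.le, integral_Icc_eq_integral_Ioc]
  simp_rw [mul_comm]

theorem integral_atomicMeasure {c : ℝ →₀ ℤ} (hc : ∀ s ∈ c.support, s ∈ Icc 0 ℓ) (φ : ℝ → ℝ) :
    VectorMeasure.integral ((atomicMeasure c).restrict (Icc 0 ℓ)) φ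
      (ContinuousLinearMap.lsmul ℝ ℝ).flip = 2 * Real.pi * c.sum fun s n => (n : ℝ) * φ s := by
  have h : (atomicMeasure c).restrict (Icc 0 ℓ) = atomicMeasure c := by
    have : (atomicMeasure c).restrict (Icc 0 ℓ) =
        VectorMeasure.restrictGm (Icc 0 ℓ) (atomicMeasure c) := rfl
    rw [this, atomicMeasure, map_sum]
    exact Finset.sum_congr rfl fun s hs =>
      VectorMeasure.restrict_dirac_of_mem measurableSet_Icc (hc s hs)
  rw [h, atomicMeasure, VectorMeasure.integral_finsetSum_vectorMeasure, Finsupp.sum,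
    Finset.mul_sum]
  · refine Finset.sum_congr rfl fun s _ => ?_
    rw [VectorMeasure.integral_dirac]
    simp [mul_assoc]
  · intro s _
    rw [VectorMeasure.Integrable, VectorMeasure.variation_dirac]
    exact (integrable_dirac (by simp)).smul_measure enorm_ne_top

/-- The integral of a continuous function against `κ_η ds - μ`, `μ = κ_γ ds + 2π ∑ⱼ cⱼ δ_{sⱼ}`. -/
theorem integral_curvatureMeasure_sub (hℓ : 0 < ℓ) (hγ : IsClosedH2Curve ℓ γ)
    (hη : IsClosedH2Curve ℓ η) {c : ℝ →₀ ℤ} (hc : ∀ s ∈ c.support, s ∈ Icc 0 ℓ) {φ : ℝ → ℝ}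
    (hφ : ContinuousOn φ (Icc 0 ℓ)) :
    VectorMeasure.integral ((curvatureMeasure ℓ η - pointedMeasure ℓ γ c).restrict (Icc 0 ℓ)) φ
      (ContinuousLinearMap.lsmul ℝ ℝ).flip =
      (∫ s in (0)..ℓ, φ s * (curvature ℓ η s - curvature ℓ γ s)) -
        2 * Real.pi * c.sum fun s n => (n : ℝ) * φ s := by
  have hr : (curvatureMeasure ℓ η - pointedMeasure ℓ γ c).restrict (Icc 0 ℓ) =
      (curvatureMeasure ℓ η).restrict (Icc 0 ℓ) - ((curvatureMeasure ℓ γ).restrict (Icc 0 ℓ) +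
        (atomicMeasure c).restrict (Icc 0 ℓ)) := by
    rw [← VectorMeasure.restrict_add]
    exact map_sub (VectorMeasure.restrictGm (Icc 0 ℓ)) _ _
  have i1 := integrable_restrict_Icc_of_continuousOn (curvatureMeasure ℓ η) hφ
  have i2 := integrable_restrict_Icc_of_continuousOn (curvatureMeasure ℓ γ) hφ
  have i3 := integrable_restrict_Icc_of_continuousOn (atomicMeasure c) hφ
  rw [hr, VectorMeasure.integral_sub_vectorMeasure i1 (i2.add_vectorMeasure i3),
    VectorMeasure.integral_add_vectorMeasure i2 i3, integral_curvatureMeasure hℓ hη hφ,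
    integral_curvatureMeasure hℓ hγ hφ, integral_atomicMeasure hc, ← sub_sub]
  congr 1
  have hφ' : ContinuousOn φ (uIcc 0 ℓ) := by rwa [uIcc_of_le hℓ.le]
  rw [← intervalIntegral.integral_sub ((hη.intervalIntegrable_curvature hℓ).continuousOn_mul hφ')
    ((hγ.intervalIntegrable_curvature hℓ).continuousOn_mul hφ')]
  simp_rw [mul_sub]

theorem IsFlatTest.continuousOn {φ : ℝ → ℝ} (h : IsFlatTest ℓ φ) : ContinuousOn φ (Icc 0 ℓ) := by
  obtain ⟨-, M, K, -, -, hK⟩ := h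
  exact hK.continuousOn

theorem IsFlatTest.abs_le {φ : ℝ → ℝ} (h : IsFlatTest ℓ φ) {s : ℝ} (hs : s ∈ Icc 0 ℓ) :
    |φ s| ≤ 1 := by
  obtain ⟨-, M, K, hMK, hM, -⟩ := h
  refine (hM s hs).trans ?_
  exact_mod_cast (le_self_add.trans hMK : M ≤ 1)

theorem IsFlatTest.lipschitzOnWith {φ : ℝ → ℝ} (h : IsFlatTest ℓ φ) :
    LipschitzOnWith 1 φ (Icc 0 ℓ) := by
  obtain ⟨-, M, K, hMK, -, hK⟩ := h
  exact hK.weaken (le_add_self.trans hMK)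

theorem flatNorm_curvatureMeasure_sub_le (hℓ : 0 < ℓ) (hγ : IsClosedH2Curve ℓ γ)
    (hη : IsClosedH2Curve ℓ η) {c : ℝ →₀ ℤ} (hc : ∀ s ∈ c.support, s ∈ Icc 0 ℓ) {δ : ℝ}
    (h : ∀ φ, IsFlatTest ℓ φ → (∫ s in (0)..ℓ, φ s * (curvature ℓ η s - curvature ℓ γ s)) -
        2 * Real.pi * (c.sum fun s n => (n : ℝ) * φ s) ≤ δ) :
    flatNorm ℓ (curvatureMeasure ℓ η - pointedMeasure ℓ γ c) ≤ ENNReal.ofReal δ := by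
  refine iSup₂_le fun φ hφ => ENNReal.ofReal_le_ofReal ?_
  rw [integral_curvatureMeasure_sub hℓ hγ hη hc hφ.continuousOn]
  exact h φ hφ

/-- Convergence in the flat norm implies convergence of the integrals of a periodic Lipschitz
function. -/
theorem tendsto_integral_of_flatNorm (hℓ : 0 < ℓ) (hγ : IsClosedH2Curve ℓ γ) {ι : Type*}
    {F : Filter ι} {η : ι → ℝ → Plane} (hη : ∀ᶠ i in F, IsClosedH2Curve ℓ (η i)) {c : ℝ →₀ ℤ}
    (hc : ∀ s ∈ c.support, s ∈ Icc 0 ℓ)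
    (h : Tendsto (fun i => flatNorm ℓ (curvatureMeasure ℓ (η i) - pointedMeasure ℓ γ c)) F (𝓝 0))
    {φ : ℝ → ℝ} {M K : ℝ≥0} (hper : φ 0 = φ ℓ) (hM : ∀ x ∈ Icc 0 ℓ, |φ x| ≤ M)
    (hK : LipschitzOnWith K φ (Icc 0 ℓ)) :
    Tendsto (fun i => ∫ s in (0)..ℓ, φ s * (curvature ℓ (η i) s - curvature ℓ γ s)) F
      (𝓝 (2 * Real.pi * c.sum fun s n => (n : ℝ) * φ s)) := by
  set a : ℝ≥0 := (M + K + 1)⁻¹ with ha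
  have hpos : 0 < M + K + 1 := by positivity
  have hle : a * M + a * K ≤ 1 := by
    rw [← mul_add, ha, inv_mul_le_iff₀ hpos, mul_one]
    exact le_self_add
  have htest : ∀ b : ℝ, |b| = a → IsFlatTest ℓ (fun s => b * φ s) := by
    intro b hb
    refine ⟨by simp [hper], a * M, a * K, hle, fun x hx => ?_, ?_⟩
    · rw [abs_mul, hb]; push_cast
      exact mul_le_mul_of_nonneg_left (hM x hx) a.2
    · refine LipschitzOnWith.of_dist_le_mul fun x hx y hy => ?_
      rw [Real.dist_eq, ← mul_sub, abs_mul, hb, ← Real.dist_eq]; push_cast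
      rw [mul_assoc]
      exact mul_le_mul_of_nonneg_left (hK.dist_le_mul x hx y hy) a.2
  rw [tendsto_iff_norm_sub_tendsto_zero]
  have hreal : Tendsto (fun i => ((a : ℝ)⁻¹ *
      (flatNorm ℓ (curvatureMeasure ℓ (η i) - pointedMeasure ℓ γ c)).toReal)) F (𝓝 0) := by
    simpa using ((ENNReal.tendsto_toReal ENNReal.zero_ne_top).comp h).const_mul (a : ℝ)⁻¹
  have hfin : ∀ᶠ i in F, flatNorm ℓ (curvatureMeasure ℓ (η i) - pointedMeasure ℓ γ c) < 1 :=
    h.eventually_lt_const (by norm_num)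
  refine squeeze_zero' (Eventually.of_forall fun _ => norm_nonneg _) ?_ hreal
  filter_upwards [hfin, hη] with i hi hηi
  have ha0 : (0 : ℝ) < a := by rw [ha]; positivity
  rw [le_inv_mul_iff₀ ha0, Real.norm_eq_abs, ← abs_of_pos ha0, ← abs_mul]
  have hcase : ∀ b : ℝ, |b| = a →
      b * ((∫ s in (0)..ℓ, φ s * (curvature ℓ (η i) s - curvature ℓ γ s)) -
        2 * Real.pi * c.sum fun s n => (n : ℝ) * φ s) ≤
      (flatNorm ℓ (curvatureMeasure ℓ (η i) - pointedMeasure ℓ γ c)).toReal := by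
    intro b hb
    have ht := htest b hb
    have h1 : ENNReal.ofReal (VectorMeasure.integral
        ((curvatureMeasure ℓ (η i) - pointedMeasure ℓ γ c).restrict (Icc 0 ℓ)) (fun s => b * φ s)
        (ContinuousLinearMap.lsmul ℝ ℝ).flip) ≤
        flatNorm ℓ (curvatureMeasure ℓ (η i) - pointedMeasure ℓ γ c) :=
      le_iSup₂ (f := fun (φ : ℝ → ℝ) (_ : IsFlatTest ℓ φ) =>
        ENNReal.ofReal (VectorMeasure.integral
          ((curvatureMeasure ℓ (η i) - pointedMeasure ℓ γ c).restrict (Icc 0 ℓ)) φ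
            (ContinuousLinearMap.lsmul ℝ ℝ).flip)) _ ht
    rw [integral_curvatureMeasure_sub hℓ hγ hηi hc ht.continuousOn] at h1
    have h2 := (ENNReal.ofReal_le_iff_le_toReal (hi.trans ENNReal.one_lt_top).ne).1 h1
    convert h2 using 1
    rw [mul_sub, ← intervalIntegral.integral_const_mul, Finsupp.sum, Finsupp.sum,
      Finset.mul_sum, Finset.mul_sum, Finset.mul_sum]
    congr 1
    · simp_rw [mul_assoc]
    · refine Finset.sum_congr rfl fun s _ => ?_
      ring
  rw [abs_le']
  constructor
  · exact hcase a (abs_of_pos ha0)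
  · rw [← neg_mul]
    exact hcase (-a) (by rw [abs_neg, abs_of_pos ha0])

/-! ### The lower bound -/

theorem sq_integral_le_mul_integral_sq (hℓ : 0 < ℓ) {f : ℝ → ℝ} (hf : ContinuousOn f (Icc 0 ℓ)) :
    (∫ s in (0)..ℓ, f s) ^ 2 ≤ ℓ * ∫ s in (0)..ℓ, f s ^ 2 := by
  have hf' : ContinuousOn f (uIcc 0 ℓ) := by rwa [uIcc_of_le hℓ.le]
  set m := (∫ s in (0)..ℓ, f s) / ℓ with hm
  have h0 : 0 ≤ ∫ s in (0)..ℓ, (f s - m) ^ 2 :=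
    intervalIntegral.integral_nonneg hℓ.le fun s _ => sq_nonneg _
  have hexp : ∀ s, (f s - m) ^ 2 = f s ^ 2 - 2 * m * f s + m ^ 2 := fun s => by ring
  simp_rw [hexp] at h0
  have hi2 : IntervalIntegrable (fun s => f s ^ 2) volume 0 ℓ := (hf'.pow 2).intervalIntegrable
  have hi1 : IntervalIntegrable (fun s => 2 * m * f s) volume 0 ℓ :=
    hf'.intervalIntegrable.const_mul _
  rw [intervalIntegral.integral_add (hi2.sub hi1) (by simp),
    intervalIntegral.integral_sub hi2 hi1, intervalIntegral.integral_const_mul,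
    intervalIntegral.integral_const, sub_zero, smul_eq_mul] at h0
  have hmℓ : (∫ s in (0)..ℓ, f s) = m * ℓ := by rw [hm]; field_simp
  rw [hmℓ] at h0 ⊢
  nlinarith [mul_le_mul_of_nonneg_left h0 hℓ.le]

/-- The primitive of `|sin (y / 2)| - 2 / π`. Since `2 / π` is the mean of `|sin (y / 2)|`, this is
a periodic function. -/
def transitionDefect (x : ℝ) : ℝ := ∫ y in (0)..x, (|Real.sin (y / 2)| - 2 / Real.pi)

theorem continuous_abs_sin_half : Continuous fun y : ℝ => |Real.sin (y / 2)| :=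
  (Real.continuous_sin.comp (continuous_id.div_const 2)).abs

theorem hasDerivAt_transitionDefect (x : ℝ) :
    HasDerivAt transitionDefect (|Real.sin (x / 2)| - 2 / Real.pi) x := by
  have hc : Continuous fun y : ℝ => |Real.sin (y / 2)| - 2 / Real.pi :=
    continuous_abs_sin_half.sub continuous_const
  exact hc.integral_hasStrictDerivAt 0 x |>.hasDerivAt

theorem abs_sin_half_sub_le (x : ℝ) : |(|Real.sin (x / 2)| - 2 / Real.pi)| ≤ 1 := by
  have h1 := Real.abs_sin_le_one (x / 2)
  have h2 := abs_nonneg (Real.sin (x / 2))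
  have h3 : 2 / Real.pi ≤ 1 := by
    rw [div_le_one Real.pi_pos]; exact Real.two_le_pi
  have h4 : 0 ≤ 2 / Real.pi := by positivity
  rw [abs_le]; constructor <;> linarith

theorem dist_transitionDefect_le (x y : ℝ) :
    dist (transitionDefect x) (transitionDefect y) ≤ dist x y := by
  have h : LipschitzWith 1 transitionDefect := by
    refine lipschitzWith_of_nnnorm_deriv_le
      (fun x => (hasDerivAt_transitionDefect x).differentiableAt) fun x => ?_
    rw [(hasDerivAt_transitionDefect x).deriv, ← NNReal.coe_le_coe, coe_nnnorm]
    exact abs_sin_half_sub_le x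
  simpa using h.dist_le_mul x y

theorem abs_sin_half_periodic : Function.Periodic (fun y : ℝ => |Real.sin (y / 2)|)
    (2 * Real.pi) := by
  intro y
  have : (y + 2 * Real.pi) / 2 = y / 2 + Real.pi := by ring
  simp only [this, Real.sin_add_pi, abs_neg]

theorem integral_abs_sin_half : ∫ y in (0)..(2 * Real.pi), |Real.sin (y / 2)| = 4 := by
  have h : ∫ y in (0)..(2 * Real.pi), |Real.sin (y / 2)| =
      ∫ y in (0)..(2 * Real.pi), Real.sin (y / 2) := by
    refine intervalIntegral.integral_congr fun y hy => ?_
    rw [uIcc_of_le (by positivity)] at hy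
    exact abs_of_nonneg (Real.sin_nonneg_of_nonneg_of_le_pi (by linarith [hy.1])
      (by linarith [hy.2]))
  rw [h, intervalIntegral.integral_comp_div (fun y => Real.sin y) (by norm_num), integral_sin]
  have : 2 * Real.pi / 2 = Real.pi := by ring
  rw [this]
  norm_num

theorem transitionDefect_periodic : Function.Periodic transitionDefect (2 * Real.pi) := by
  intro x
  have hc : Continuous fun y : ℝ => |Real.sin (y / 2)| - 2 / Real.pi :=
    continuous_abs_sin_half.sub continuous_const
  have hper : Function.Periodic (fun y : ℝ => |Real.sin (y / 2)| - 2 / Real.pi)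
      (2 * Real.pi) := fun y => by
    have := abs_sin_half_periodic y
    simp only at this ⊢
    rw [this]
  have h1 : transitionDefect (x + 2 * Real.pi) - transitionDefect x =
      ∫ y in x..(x + 2 * Real.pi), (|Real.sin (y / 2)| - 2 / Real.pi) := by
    exact intervalIntegral.integral_interval_sub_left (hc.intervalIntegrable _ _)
      (hc.intervalIntegrable _ _)
  have h2 : ∫ y in x..(x + 2 * Real.pi), (|Real.sin (y / 2)| - 2 / Real.pi) = 0 := by
    rw [hper.intervalIntegral_add_eq x 0, zero_add,
      intervalIntegral.integral_sub (continuous_abs_sin_half.intervalIntegrable _ _) (by simp),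
      integral_abs_sin_half, intervalIntegral.integral_const, smul_eq_mul]
    have := Real.pi_ne_zero
    field_simp
    ring
  linarith

/-- The oscillation of `transitionDefect` is controlled by the distance to the wells `2πℤ`. -/
theorem abs_transitionDefect_le (x : ℝ) :
    |transitionDefect x| ≤ Real.pi * |Real.sin (x / 2)| := by
  have hper : Function.Periodic (fun x => (transitionDefect x, |Real.sin (x / 2)|))
      (2 * Real.pi) := fun x =>
    Prod.ext (transitionDefect_periodic x) (abs_sin_half_periodic x)
  obtain ⟨y, hy, hxy⟩ := hper.exists_mem_Ico Real.two_pi_pos x (-Real.pi)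
  obtain ⟨h1, h2⟩ := Prod.ext_iff.1 hxy
  simp only at h1 h2
  rw [h1, h2]
  have hyπ : |y| ≤ Real.pi := abs_le.2 ⟨hy.1, by linarith [hy.2]⟩
  have h3 : |transitionDefect y| ≤ |y| := by
    have := dist_transitionDefect_le y 0
    simpa [Real.dist_eq, transitionDefect] using this
  have h4 := Real.mul_abs_le_abs_sin (x := y / 2) (by rw [abs_div]; norm_num; linarith)
  rw [abs_div, abs_two] at h4
  have hπ := Real.pi_pos
  have : |y| ≤ Real.pi * |Real.sin (y / 2)| := by
    calc |y| = Real.pi * (2 / Real.pi * (|y| / 2)) := by field_simp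
      _ ≤ _ := mul_le_mul_of_nonneg_left h4 hπ.le
  exact h3.trans this

/-- Integration by parts against a Lipschitz function. -/
theorem abs_integral_mul_deriv_le (hℓ : 0 < ℓ) {φ g : ℝ → ℝ} {K : ℝ≥0}
    (hφ : LipschitzOnWith K φ (Icc 0 ℓ)) (hper : φ 0 = φ ℓ)
    (hg : AbsolutelyContinuousOnInterval g 0 ℓ) (hgper : g 0 = g ℓ) :
    |∫ s in (0)..ℓ, φ s * deriv g s| ≤ K * ∫ s in (0)..ℓ, |g s| := by
  have hφac : AbsolutelyContinuousOnInterval φ 0 ℓ :=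
    LipschitzOnWith.absolutelyContinuousOnInterval (by rwa [uIcc_of_le hℓ.le])
  rw [hφac.integral_mul_deriv_eq_deriv_mul hg, hper, hgper, sub_self, zero_sub, abs_neg,
    ← intervalIntegral.integral_const_mul, ← Real.norm_eq_abs]
  have hgint : IntervalIntegrable (fun s => (K : ℝ) * |g s|) volume 0 ℓ :=
    hg.continuousOn.abs.intervalIntegrable.const_mul _
  refine intervalIntegral.norm_integral_le_of_norm_le hℓ.le ?_ hgint
  filter_upwards [ae_mem_Icc_imp_mem_Ioo 0 ℓ] with s hs hmem
  have hs' := hs (Ioc_subset_Icc_self hmem)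
  rw [norm_mul]
  exact mul_le_mul_of_nonneg_right
    (norm_deriv_le_of_lipschitzOn (Icc_mem_nhds hs'.1 hs'.2) hφ) (norm_nonneg _)

theorem exists_lipschitzWith_eqOn_finset (A : Finset ℝ) (g : ℝ → ℝ) (hg : ∀ s, |g s| ≤ 1) :
    ∃ (K : ℝ≥0) (φ : ℝ → ℝ), LipschitzWith K φ ∧ (∀ s, |φ s| ≤ 1) ∧ ∀ s ∈ A, φ s = g s := by
  set K : ℝ≥0 := ∑ x ∈ A, ∑ y ∈ A, nndist (g x) (g y) / nndist x y with hK
  have hlip : LipschitzOnWith K g (A : Set ℝ) := by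
    refine LipschitzOnWith.of_dist_le_mul fun x hx y hy => ?_
    rcases eq_or_ne x y with rfl | hxy
    · simp
    have h1 : nndist (g x) (g y) / nndist x y ≤ K := by
      refine le_trans ?_ (Finset.single_le_sum (f := fun x => ∑ y ∈ A, nndist (g x) (g y) /
        nndist x y) (fun _ _ => zero_le) hx)
      exact Finset.single_le_sum (f := fun y => nndist (g x) (g y) / nndist x y)
        (fun _ _ => zero_le) hy
    have h2 : 0 < nndist x y := by
      rw [pos_iff_ne_zero]; exact fun h => hxy (nndist_eq_zero.1 h)
    rw [div_le_iff₀ h2] at h1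
    exact_mod_cast h1
  obtain ⟨ψ, hψ, heq⟩ := hlip.extend_real
  refine ⟨K, fun s => max (-1) (min (ψ s) 1), ?_, fun s => ?_, fun s hs => ?_⟩
  · exact (hψ.min_const 1).const_max (-1)
  · rw [abs_le]
    exact ⟨le_max_left _ _, max_le (by norm_num) (min_le_right _ _)⟩
  · have h := abs_le.1 (hg s)
    simp only
    rw [← heq hs, min_eq_left h.2, max_eq_right h.1]

/-- A periodic Lipschitz function which detects the signs of the multiplicities. -/
theorem exists_sign_test {c : ℝ →₀ ℤ} (hc : IsSingularity ℓ c) :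
    ∃ (K : ℝ≥0) (φ : ℝ → ℝ), LipschitzWith K φ ∧ (∀ s, |φ s| ≤ 1) ∧ φ 0 = φ ℓ ∧
      (c.sum fun s n => (n : ℝ) * φ s) = totalMultiplicity c := by
  classical
  -- on the closed curve `0` and `ℓ` are one point, which carries at most one of the two values
  set g : ℝ → ℝ := fun s => if s = 0 ∨ s = ℓ then ((SignType.sign (c 0 + c ℓ) : ℤ) : ℝ)
    else ((SignType.sign (c s) : ℤ) : ℝ) with hg
  have hsign : ∀ n : ℤ, |((SignType.sign n : ℤ) : ℝ)| ≤ 1 := fun n => by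
    rcases lt_trichotomy n 0 with h | h | h <;> simp [h]
  have hg1 : ∀ s, |g s| ≤ 1 := fun s => by
    simp only [hg]; split_ifs <;> exact hsign _
  obtain ⟨K, φ, hK, hφ, heq⟩ := exists_lipschitzWith_eqOn_finset (c.support ∪ {0, ℓ}) g hg1
  have hmul : ∀ n : ℤ, (n : ℝ) * ((SignType.sign n : ℤ) : ℝ) = |(n : ℝ)| := fun n => by
    rw [mul_comm]; exact_mod_cast congrArg (Int.cast (R := ℝ)) (sign_mul_self n)
  refine ⟨K, φ, hK, hφ, ?_, ?_⟩
  · rw [heq 0 (by simp), heq ℓ (by simp)]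
    simp [hg]
  · rw [Finsupp.sum, totalMultiplicity]
    refine Finset.sum_congr rfl fun s hs => ?_
    rw [heq s (Finset.mem_union_left _ hs), ← hmul]
    congr 2
    have hnot := hc.2
    by_cases h : s = 0 ∨ s = ℓ
    · simp only [hg, h, if_true]
      by_cases h0 : (0 : ℝ) ∈ c.support
      · have hl : c ℓ = 0 := by
          by_contra hl; exact hnot ⟨h0, Finsupp.mem_support_iff.2 hl⟩
        rcases h with rfl | rfl
        · rw [hl, add_zero]
        · exact absurd hl (Finsupp.mem_support_iff.1 hs)
      · have h0' := Finsupp.notMem_support_iff.1 h0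
        rcases h with rfl | rfl
        · exact absurd hs h0
        · rw [h0', zero_add]
    · simp only [hg, h, if_false]

theorem IsAngle.continuousOn_abs_sin_half (hℓ : 0 < ℓ) {u : ℝ → ℝ} (hu : IsAngle ℓ γ η u) :
    ContinuousOn (fun s => |Real.sin (u s / 2)|) (uIcc 0 ℓ) := by
  rw [uIcc_of_le hℓ.le]
  exact continuous_abs_sin_half.comp_continuousOn (hu.continuousOn hℓ)

theorem IsAngle.integral_norm_tangent_sub (hℓ : 0 < ℓ)
    (hγ : ∀ s ∈ Icc 0 ℓ, ‖tangent ℓ γ s‖ = 1) {u : ℝ → ℝ} (hu : IsAngle ℓ γ η u) :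
    ∫ s in (0)..ℓ, ‖tangent ℓ η s - tangent ℓ γ s‖ = 2 * ∫ s in (0)..ℓ, |Real.sin (u s / 2)| := by
  rw [← intervalIntegral.integral_const_mul]
  refine intervalIntegral.integral_congr fun s hs => ?_
  rw [uIcc_of_le hℓ.le] at hs
  exact hu.norm_tangent_sub hγ hs

/-- The energy in terms of the angle, whose wells are the points of `2πℤ`. -/
theorem IsAngle.energy_eq (hℓ : 0 < ℓ) (hγ : ∀ s ∈ Icc 0 ℓ, ‖tangent ℓ γ s‖ = 1) {u : ℝ → ℝ}
    (hu : IsAngle ℓ γ η u) (ε : ℝ) :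
    energy ℓ γ ε η = √ε * (∫ s in (0)..ℓ, curvature ℓ η s ^ 2) +
      2 / √ε * ∫ s in (0)..ℓ, |Real.sin (u s / 2)| ^ 2 := by
  have h : ∫ s in (0)..ℓ, ‖tangent ℓ η s - tangent ℓ γ s‖ ^ 2 =
      4 * ∫ s in (0)..ℓ, |Real.sin (u s / 2)| ^ 2 := by
    rw [← intervalIntegral.integral_const_mul]
    refine intervalIntegral.integral_congr fun s hs => ?_
    rw [uIcc_of_le hℓ.le] at hs
    rw [hu.norm_tangent_sub hγ hs]; ring
  rw [energy, h]
  ring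

/-- The Modica–Mortola inequality. -/
theorem IsAngle.le_energy (hℓ : 0 < ℓ) (hγ : ∀ s ∈ Icc 0 ℓ, ‖tangent ℓ γ s‖ = 1)
    (hη : IsClosedH2Curve ℓ η) {u : ℝ → ℝ} (hu : IsAngle ℓ γ η u) {ε : ℝ} (hε : 0 < ε) :
    2 * √2 * ∫ s in (0)..ℓ, |curvature ℓ η s| * |Real.sin (u s / 2)| ≤ energy ℓ γ ε η := by
  have hsin := hu.continuousOn_abs_sin_half hℓ
  have i1 : IntervalIntegrable (fun s => |curvature ℓ η s| * |Real.sin (u s / 2)|) volume 0 ℓ :=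
    (hη.intervalIntegrable_curvature hℓ).abs.mul_continuousOn hsin
  have i2 := (hη.intervalIntegrable_curvature_sq hℓ).const_mul (√ε)
  have i3 : IntervalIntegrable (fun s => 2 / √ε * |Real.sin (u s / 2)| ^ 2) volume 0 ℓ :=
    ((hsin.pow 2).const_smul (2 / √ε)).intervalIntegrable
  rw [hu.energy_eq hℓ hγ, ← intervalIntegral.integral_const_mul,
    ← intervalIntegral.integral_const_mul, ← intervalIntegral.integral_const_mul,
    ← intervalIntegral.integral_add i2 i3]
  refine intervalIntegral.integral_mono_on hℓ.le (i1.const_mul _) (i2.add i3) fun s _ => ?_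
  have hs0 : 0 < √ε := Real.sqrt_pos.2 hε
  set r := √(√ε) with hr
  have hr0 : 0 < r := Real.sqrt_pos.2 hs0
  have hrr : r ^ 2 = √ε := Real.sq_sqrt hs0.le
  have h2 : (√2 : ℝ) ^ 2 = 2 := Real.sq_sqrt (by norm_num)
  set a := |curvature ℓ η s| with ha
  set b := |Real.sin (u s / 2)|
  have haa : curvature ℓ η s ^ 2 = a ^ 2 := (sq_abs _).symm
  rw [haa, ← hrr]
  have h0 : 0 ≤ (r * a - √2 / r * b) ^ 2 := sq_nonneg _
  have h3 : (r * a - √2 / r * b) ^ 2 =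
      r ^ 2 * a ^ 2 - 2 * √2 * (a * b) + (√2) ^ 2 / r ^ 2 * b ^ 2 := by
    field_simp
    ring
  rw [h3, h2] at h0
  linarith

/-- The lower bound for the energy, tested with a periodic Lipschitz function `φ`: the weight
`|sin (u / 2)|` of the Modica–Mortola inequality can be replaced by its mean `2 / π`, up to the
derivative of the small function `transitionDefect ∘ u`. -/
theorem IsAngle.le_energy_of_test (hℓ : 0 < ℓ) (hγ : IsClosedC2Curve ℓ γ)
    (hη : IsClosedH2Curve ℓ η) {u : ℝ → ℝ} (hu : IsAngle ℓ γ η u) {ε : ℝ} (hε : 0 < ε)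
    {φ : ℝ → ℝ} {K : ℝ≥0} (hφ : LipschitzOnWith K φ (Icc 0 ℓ)) (hper : φ 0 = φ ℓ)
    (hφ1 : ∀ s, |φ s| ≤ 1) {B : ℝ} (hB : ∀ s ∈ Icc 0 ℓ, |curvature ℓ γ s| ≤ B) :
    2 * √2 * (2 / Real.pi * (∫ s in (0)..ℓ, φ s * (curvature ℓ η s - curvature ℓ γ s)) -
      (K * Real.pi + B) / 2 * ∫ s in (0)..ℓ, ‖tangent ℓ η s - tangent ℓ γ s‖) ≤
      energy ℓ γ ε η := by
  have hγ' := hγ.isClosedH2Curve hℓ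
  refine le_trans (mul_le_mul_of_nonneg_left ?_ (by positivity))
    (hu.le_energy hℓ hγ.unitSpeed hη hε)
  rw [hu.integral_norm_tangent_sub hℓ hγ.unitSpeed]
  have hsin := hu.continuousOn_abs_sin_half hℓ
  have hκη := hη.intervalIntegrable_curvature hℓ
  have hκγ := hγ'.intervalIntegrable_curvature hℓ
  have hφc : ContinuousOn φ (uIcc 0 ℓ) := by rw [uIcc_of_le hℓ.le]; exact hφ.continuousOn
  set g : ℝ → ℝ := fun s => transitionDefect (u s) with hg
  have hgac : AbsolutelyContinuousOnInterval g 0 ℓ :=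
    absolutelyContinuousOnInterval_of_dist_le (K := 1) hu.absolutelyContinuous
      fun x _ y _ => by rw [one_mul]; exact dist_transitionDefect_le _ _
  have hgper : g 0 = g ℓ := by
    obtain ⟨n, hn⟩ := hu.periodic
    have : u ℓ = u 0 + n * (2 * Real.pi) := by linarith
    simp only [hg, this]
    exact (transitionDefect_periodic.int_mul n (u 0)).symm
  have hibp := abs_integral_mul_deriv_le hℓ hφ hper hgac hgper
  have hgle : ∫ s in (0)..ℓ, |g s| ≤ Real.pi * ∫ s in (0)..ℓ, |Real.sin (u s / 2)| := by
    rw [← intervalIntegral.integral_const_mul]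
    exact intervalIntegral.integral_mono_on hℓ.le hgac.continuousOn.abs.intervalIntegrable
      (hsin.intervalIntegrable.const_mul _) fun s _ => abs_transitionDefect_le _
  have hderiv : ∫ s in (0)..ℓ, φ s * deriv g s = ∫ s in (0)..ℓ,
      φ s * ((|Real.sin (u s / 2)| - 2 / Real.pi) * (curvature ℓ η s - curvature ℓ γ s)) := by
    refine intervalIntegral.integral_congr_ae ?_
    filter_upwards [hu.ae_hasDerivAt] with s hs hmem
    rw [uIoc_of_le hℓ.le] at hmem
    have h1 := (hasDerivAt_transitionDefect (u s)).comp s (hs (Ioc_subset_Icc_self hmem))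
    rw [show g = transitionDefect ∘ u from rfl, h1.deriv]
  set I := ∫ s in (0)..ℓ, |Real.sin (u s / 2)| with hI
  set p := ∫ s in (0)..ℓ, φ s * (curvature ℓ η s - curvature ℓ γ s) with hp
  have hwφ : IntervalIntegrable (fun s => φ s * (curvature ℓ η s - curvature ℓ γ s)) volume 0 ℓ :=
    (hκη.sub hκγ).continuousOn_mul hφc
  have e1 : IntervalIntegrable (fun s => φ s * ((|Real.sin (u s / 2)| - 2 / Real.pi) *
      (curvature ℓ η s - curvature ℓ γ s))) volume 0 ℓ :=
    ((hκη.sub hκγ).continuousOn_mul (hsin.sub continuousOn_const)).continuousOn_mul hφc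
  have e2 : IntervalIntegrable (fun s => B * |Real.sin (u s / 2)|) volume 0 ℓ :=
    hsin.intervalIntegrable.const_mul B
  have hmain : 2 / Real.pi * p + (∫ s in (0)..ℓ, φ s * deriv g s) - B * I ≤
      ∫ s in (0)..ℓ, |curvature ℓ η s| * |Real.sin (u s / 2)| := by
    rw [hderiv, hp, hI, ← intervalIntegral.integral_const_mul,
      ← intervalIntegral.integral_add (hwφ.const_mul _) e1, ← intervalIntegral.integral_const_mul,
      ← intervalIntegral.integral_sub ((hwφ.const_mul _).add e1) e2]
    refine intervalIntegral.integral_mono_on hℓ.le (((hwφ.const_mul _).add e1).sub e2)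
      (hκη.abs.mul_continuousOn hsin) fun s hs => ?_
    have h1 : 2 / Real.pi * (φ s * (curvature ℓ η s - curvature ℓ γ s)) +
        φ s * ((|Real.sin (u s / 2)| - 2 / Real.pi) * (curvature ℓ η s - curvature ℓ γ s)) =
        (φ s * curvature ℓ η s - φ s * curvature ℓ γ s) * |Real.sin (u s / 2)| := by ring
    rw [h1, ← sub_mul]
    refine mul_le_mul_of_nonneg_right ?_ (abs_nonneg _)
    have h2 : φ s * curvature ℓ η s ≤ |curvature ℓ η s| := by
      refine (le_abs_self _).trans ?_
      rw [abs_mul]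
      exact mul_le_of_le_one_left (abs_nonneg _) (hφ1 s)
    have h3 : -(φ s * curvature ℓ γ s) ≤ B := by
      refine (neg_le_abs _).trans ?_
      rw [abs_mul]
      exact (mul_le_of_le_one_left (abs_nonneg _) (hφ1 s)).trans (hB s hs)
    linarith
  have h5 := (abs_le.1 hibp).1
  have h6 := mul_le_mul_of_nonneg_left hgle K.2
  have h7 : (K * Real.pi + B) / 2 * (2 * I) = K * (Real.pi * I) + B * I := by ring
  rw [h7]
  have h8 : (K : ℝ) * ∫ s in (0)..ℓ, |g s| ≤ K * (Real.pi * I) := h6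
  linarith

theorem tendsto_integral_norm_tangent_sub (hℓ : 0 < ℓ) (hγ : IsClosedH2Curve ℓ γ) {ι : Type*}
    {F : Filter ι} {η : ι → ℝ → Plane} (hη : ∀ᶠ i in F, IsClosedH2Curve ℓ (η i))
    (h : Tendsto (fun i => ∫ s in (0)..ℓ, ‖tangent ℓ (η i) s - tangent ℓ γ s‖ ^ 2) F (𝓝 0)) :
    Tendsto (fun i => ∫ s in (0)..ℓ, ‖tangent ℓ (η i) s - tangent ℓ γ s‖) F (𝓝 0) := by
  have hsq : Tendsto (fun i => √(ℓ * ∫ s in (0)..ℓ, ‖tangent ℓ (η i) s - tangent ℓ γ s‖ ^ 2)) F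
      (𝓝 0) := by
    simpa [Function.comp_def] using (Real.continuous_sqrt.tendsto _).comp (h.const_mul ℓ)
  refine squeeze_zero' (Eventually.of_forall fun i =>
    intervalIntegral.integral_nonneg hℓ.le fun s _ => norm_nonneg _) ?_ hsq
  filter_upwards [hη] with i hi
  refine Real.le_sqrt_of_sq_le ?_
  exact sq_integral_le_mul_integral_sq hℓ
    ((hi.continuousOn_tangent hℓ).sub (hγ.continuousOn_tangent hℓ)).norm

/-- The `Γ`-liminf inequality along an arbitrary filter: the energies are bounded below by
functions with limit `8 √2 ∑ⱼ |cⱼ|`. -/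
theorem exists_tendsto_le_energy (hℓ : 0 < ℓ) (hγ : IsClosedC2Curve ℓ γ) {ι : Type*}
    {F : Filter ι} {ε : ι → ℝ} {η : ι → ℝ → Plane} {c : ℝ →₀ ℤ} (hε : ∀ᶠ i in F, 0 < ε i)
    (hη : ∀ᶠ i in F, IsClosedH2Curve ℓ (η i)) (hc : IsSingularity ℓ c)
    (hconv : ConvergesTo F ℓ η γ (pointedMeasure ℓ γ c)) :
    ∃ a : ι → ℝ, Tendsto a F (𝓝 (8 * √2 * totalMultiplicity c)) ∧
      ∀ᶠ i in F, a i ≤ energy ℓ γ (ε i) (η i) := by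
  have hγ' := hγ.isClosedH2Curve hℓ
  obtain ⟨K, φ, hK, hφ1, hper, hsum⟩ := exists_sign_test hc
  obtain ⟨B, hB⟩ := isCompact_Icc.exists_bound_of_continuousOn (hγ.continuousOn_curvature hℓ)
  have htan : Tendsto (fun i => ∫ s in (0)..ℓ, ‖tangent ℓ (η i) s - tangent ℓ γ s‖ ^ 2) F
      (𝓝 0) := by
    refine squeeze_zero (fun i => intervalIntegral.integral_nonneg hℓ.le fun s _ => sq_nonneg _)
      (fun i => ?_) hconv.1
    rw [h1DistSq]
    exact le_add_of_nonneg_left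
      (intervalIntegral.integral_nonneg hℓ.le fun s _ => sq_nonneg _)
  have hD := tendsto_integral_norm_tangent_sub hℓ hγ' hη htan
  have hpair := tendsto_integral_of_flatNorm hℓ hγ' hη hc.1 hconv.2 (M := 1) hper
    (fun x _ => by simpa using hφ1 x) hK.lipschitzOnWith
  refine ⟨fun i => 2 * √2 * (2 / Real.pi *
    (∫ s in (0)..ℓ, φ s * (curvature ℓ (η i) s - curvature ℓ γ s)) -
      (K * Real.pi + B) / 2 * ∫ s in (0)..ℓ, ‖tangent ℓ (η i) s - tangent ℓ γ s‖), ?_, ?_⟩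
  · have := ((hpair.const_mul (2 / Real.pi)).sub
      (hD.const_mul ((K * Real.pi + B) / 2))).const_mul (2 * √2)
    convert this using 2
    rw [hsum]
    have := Real.pi_ne_zero
    field_simp
    ring
  · filter_upwards [hε, hη] with i h1 h2
    obtain ⟨u, hu⟩ := exists_isAngle hℓ hγ' h2
    exact hu.le_energy_of_test hℓ hγ h2 h1 hK.lipschitzOnWith hper hφ1 hB

/-! ### Compactness -/

/-- A continuous function `u` such that the variation of `cos u` is less than `N` stays at distance
`3π/2` from a step function with values in `2πℤ` which has at most `N` unit jumps. The step
function jumps to the neighbouring well only when `u` has left the current well by `3π/2`; between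
two jumps `u` has moved from a maximum distance `π` to `3π/2`, which costs variation `1`. -/
theorem exists_step_approximation {u V : ℝ → ℝ} {b : ℝ} (N : ℕ) : ∀ (a : ℝ) (m : ℤ), a ≤ b →
    ContinuousOn u (Icc a b) →
    (∀ s ∈ Icc a b, ∀ t ∈ Icc a b, s ≤ t → |Real.cos (u t) - Real.cos (u s)| ≤ V t - V s) →
    V b - V a < N → |u a - 2 * Real.pi * m| ≤ Real.pi →
    ∃ (t : Fin N → ℝ) (c : Fin N → ℤ), (∀ i, t i ∈ Icc a b) ∧ (∀ i, |c i| ≤ 1) ∧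
      ∀ s ∈ Icc a b,
        |u s - 2 * Real.pi * (m + ∑ i, if t i ≤ s then c i else 0 : ℤ)| ≤ 3 * Real.pi / 2 := by
  have hπ := Real.pi_pos
  induction N with
  | zero =>
    intro a m hab _ hV hN _
    have := (abs_nonneg _).trans (hV a (left_mem_Icc.2 hab) b (right_mem_Icc.2 hab) hab)
    norm_num at hN
    linarith
  | succ N ih =>
    intro a m hab hu hV hN hm
    by_cases hall : ∀ s ∈ Icc a b, |u s - 2 * Real.pi * m| ≤ 3 * Real.pi / 2
    · exact ⟨fun _ => a, fun _ => 0, fun _ => left_mem_Icc.2 hab, by simp, by simpa using hall⟩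
    push Not at hall
    obtain ⟨s₀, hs₀, hs₀'⟩ := hall
    have hd : ContinuousOn (fun s => |u s - 2 * Real.pi * m|) (Icc a b) :=
      (hu.sub continuousOn_const).abs
    -- the first time at which `u` has left the current well
    have hcomp : IsCompact (Icc a b ∩ (fun s => |u s - 2 * Real.pi * m|) ⁻¹'
        Ici (3 * Real.pi / 2)) :=
      isCompact_Icc.of_isClosed_subset (hd.preimage_isClosed_of_isClosed isClosed_Icc isClosed_Ici)
        inter_subset_left
    obtain ⟨t₁, ⟨ht₁, ht₁'⟩, hleast⟩ := hcomp.exists_isLeast ⟨s₀, hs₀, hs₀'.le⟩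
    simp only [mem_preimage, mem_Ici] at ht₁'
    have hbefore : ∀ s ∈ Icc a b, s < t₁ → |u s - 2 * Real.pi * m| < 3 * Real.pi / 2 := by
      intro s hs hst
      by_contra hcon
      exact absurd (hleast ⟨hs, not_lt.1 hcon⟩) (not_le.2 hst)
    have hsub : Icc a t₁ ⊆ Icc a b := Icc_subset_Icc_right ht₁.2
    have hivt := intermediate_value_Icc ht₁.1 (hd.mono hsub)
    have ht₁eq : |u t₁ - 2 * Real.pi * m| = 3 * Real.pi / 2 := by
      obtain ⟨r, hr, hr'⟩ := hivt ⟨hm.trans (by linarith), ht₁'⟩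
      simp only at hr'
      rcases hr.2.lt_or_eq with h | h
      · exact absurd hr' (hbefore r (hsub hr) h).ne
      · rwa [h] at hr'
    obtain ⟨r, hr, hr'⟩ := hivt ⟨hm, by linarith⟩
    simp only at hr'
    have hcosr : Real.cos (u r) = -1 := by
      have h1 : Real.cos (u r) = Real.cos (u r - 2 * Real.pi * m) := by
        rw [mul_comm (2 * Real.pi) (m : ℝ), Real.cos_sub_int_mul_two_pi]
      rw [h1, ← Real.cos_abs, hr', Real.cos_pi]
    have hcost : Real.cos (u t₁) = 0 := by
      have h1 : Real.cos (u t₁) = Real.cos (u t₁ - 2 * Real.pi * m) := by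
        rw [mul_comm (2 * Real.pi) (m : ℝ), Real.cos_sub_int_mul_two_pi]
      rw [h1, ← Real.cos_abs, ht₁eq]
      have : 3 * Real.pi / 2 = Real.pi / 2 + Real.pi := by ring
      rw [this, Real.cos_add_pi, Real.cos_pi_div_two, neg_zero]
    have hcost1 : 1 ≤ V t₁ - V r := by
      have := hV r (hsub hr) t₁ ht₁ hr.2
      rw [hcosr, hcost] at this
      norm_num at this
      exact this
    have hmono : 0 ≤ V r - V a :=
      (abs_nonneg _).trans (hV a (left_mem_Icc.2 hab) r (hsub hr) hr.1)
    obtain ⟨σ, hσ, hσ'⟩ : ∃ σ : ℤ, |σ| ≤ 1 ∧ |u t₁ - 2 * Real.pi * (m + σ : ℤ)| ≤ Real.pi := by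
      rcases abs_eq (by positivity : 0 ≤ 3 * Real.pi / 2) |>.1 ht₁eq with h | h
      · refine ⟨1, by simp, ?_⟩
        push_cast
        rw [abs_le]; constructor <;> nlinarith
      · refine ⟨-1, by simp, ?_⟩
        push_cast
        rw [abs_le]; constructor <;> nlinarith
    have hsub' : Icc t₁ b ⊆ Icc a b := Icc_subset_Icc_left ht₁.1
    obtain ⟨t, c, ht, hc, happ⟩ := ih t₁ (m + σ) ht₁.2 (hu.mono hsub')
      (fun s hs t ht => hV s (hsub' hs) t (hsub' ht)) (by push_cast at hN; linarith) hσ'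
    refine ⟨Fin.cons t₁ t, Fin.cons σ c, ?_, ?_, ?_⟩
    · intro i
      refine Fin.cases ht₁ (fun i => hsub' (ht i)) i
    · intro i
      refine Fin.cases hσ (fun i => hc i) i
    · intro s hs
      rw [Fin.sum_univ_succ]
      simp only [Fin.cons_zero, Fin.cons_succ]
      rcases lt_or_ge s t₁ with h | h
      · have h1 : ∀ i, ¬ t i ≤ s := fun i => not_le.2 (h.trans_le (ht i).1)
        simp only [not_le.2 h, h1, if_false, Finset.sum_const_zero, add_zero]
        exact (hbefore s hs h).le
      · have := happ s ⟨h, hs.2⟩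
        simp only [h, if_true, ← add_assoc]
        exact this

/-- Up to `3π/2`, the distance to the well `0` is controlled by `|sin (x / 2)|`; the next wells are
at distance `2π`. -/
theorem abs_le_mul_abs_sin_half {x : ℝ} (hx : |x| ≤ 3 * Real.pi / 2) :
    |x| ≤ 10 * |Real.sin (x / 2)| := by
  have hπ := Real.pi_pos
  have hπ4 := Real.pi_lt_four
  wlog h0 : 0 ≤ x generalizing x
  · have := this (x := -x) (by rwa [abs_neg]) (by linarith)
    rwa [abs_neg, neg_div, Real.sin_neg, abs_neg] at this
  rw [abs_of_nonneg h0] at hx ⊢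
  rcases le_or_gt x Real.pi with h | h
  · have h1 := Real.mul_abs_le_abs_sin (x := x / 2)
      (by rw [abs_of_nonneg (by positivity)]; linarith)
    rw [abs_of_nonneg (by positivity : 0 ≤ x / 2)] at h1
    have h2 : (1 : ℝ) / 2 ≤ 2 / Real.pi := by
      rw [div_le_div_iff₀ two_pos hπ]; linarith
    nlinarith
  · have h1 : Real.sin (x / 2) = Real.cos (x / 2 - Real.pi / 2) := (Real.cos_sub_pi_div_two _).symm
    have h2 : Real.cos (Real.pi / 3) ≤ Real.cos (x / 2 - Real.pi / 2) :=
      Real.cos_le_cos_of_nonneg_of_le_pi (by linarith) (by linarith) (by linarith)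
    rw [Real.cos_pi_div_three] at h2
    rw [h1, abs_of_nonneg (by linarith)]
    have : Real.pi < 3.15 := Real.pi_lt_d2
    linarith

theorem integral_norm_tangent_sub_le (hℓ : 0 < ℓ) (hγ : IsClosedH2Curve ℓ γ)
    (hη : IsClosedH2Curve ℓ η) :
    ∫ s in (0)..ℓ, ‖tangent ℓ η s - tangent ℓ γ s‖ ≤ 2 * ℓ := by
  have hc : ContinuousOn (fun s => ‖tangent ℓ η s - tangent ℓ γ s‖) (uIcc 0 ℓ) := by
    rw [uIcc_of_le hℓ.le]
    exact ((hη.continuousOn_tangent hℓ).sub (hγ.continuousOn_tangent hℓ)).norm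
  have := intervalIntegral.integral_mono_on (μ := volume) (g := fun _ => (2 : ℝ)) hℓ.le
    hc.intervalIntegrable intervalIntegrable_const fun s hs => by
      refine (norm_sub_le _ _).trans ?_
      rw [hη.unitSpeed s hs, hγ.unitSpeed s hs]; norm_num
  simpa [mul_comm] using this

/-- The variation of the cosine of the angle is bounded by the energy. -/
theorem IsAngle.exists_variation_bound (hℓ : 0 < ℓ) (hγ : IsClosedC2Curve ℓ γ)
    (hη : IsClosedH2Curve ℓ η) {u : ℝ → ℝ} (hu : IsAngle ℓ γ η u) {ε : ℝ} (hε : 0 < ε) {B : ℝ}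
    (hB : ∀ s ∈ Icc 0 ℓ, |curvature ℓ γ s| ≤ B) :
    ∃ V : ℝ → ℝ, (∀ s ∈ Icc 0 ℓ, ∀ t ∈ Icc 0 ℓ, s ≤ t →
      |Real.cos (u t) - Real.cos (u s)| ≤ V t - V s) ∧
      V ℓ - V 0 ≤ energy ℓ γ ε η + 2 * B * ℓ := by
  have hγ' := hγ.isClosedH2Curve hℓ
  have hsin := hu.continuousOn_abs_sin_half hℓ
  have hκη := hη.intervalIntegrable_curvature hℓ
  have hκγ := hγ'.intervalIntegrable_curvature hℓ
  set f : ℝ → ℝ := fun s => 2 * (|curvature ℓ η s - curvature ℓ γ s| * |Real.sin (u s / 2)|)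
    with hf
  have hfi : IntervalIntegrable f volume 0 ℓ :=
    ((hκη.sub hκγ).abs.mul_continuousOn hsin).const_mul 2
  have hcos : AbsolutelyContinuousOnInterval (fun s => Real.cos (u s)) 0 ℓ :=
    absolutelyContinuousOnInterval_of_dist_le (K := 1) hu.absolutelyContinuous
      fun x _ y _ => by
        rw [one_mul, Real.dist_eq, Real.dist_eq]
        exact Real.abs_cos_sub_cos_le (u x) (u y)
  refine ⟨fun s => ∫ r in (0)..s, f r, fun s hs t ht hst => ?_, ?_⟩
  · have hsub : uIcc s t ⊆ uIcc 0 ℓ := by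
      rw [uIcc_of_le hst, uIcc_of_le hℓ.le]; exact Icc_subset_Icc hs.1 ht.2
    have hsub0 : ∀ r ∈ Icc 0 ℓ, uIcc 0 r ⊆ uIcc 0 ℓ := fun r hr => by
      rw [uIcc_of_le hr.1, uIcc_of_le hℓ.le]; exact Icc_subset_Icc_right hr.2
    rw [intervalIntegral.integral_interval_sub_left (hfi.mono_set (hsub0 t ht))
      (hfi.mono_set (hsub0 s hs)), ← (hcos.mono hsub).integral_deriv_eq_sub, ← Real.norm_eq_abs]
    refine intervalIntegral.norm_integral_le_of_norm_le hst ?_ (hfi.mono_set hsub)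
    filter_upwards [hu.ae_hasDerivAt] with r hr hmem
    have hr' := hr ⟨hs.1.trans hmem.1.le, hmem.2.trans ht.2⟩
    have h2 : Real.sin (u r) = 2 * Real.sin (u r / 2) * Real.cos (u r / 2) := by
      rw [← Real.sin_two_mul]; congr 1; ring
    rw [hr'.cos.deriv, Real.norm_eq_abs, abs_mul, abs_neg, h2, abs_mul, abs_mul, abs_two, hf]
    have h3 := Real.abs_cos_le_one (u r / 2)
    have h4 : 0 ≤ |Real.sin (u r / 2)| * |curvature ℓ η r - curvature ℓ γ r| := by positivity
    nlinarith
  · simp only [intervalIntegral.integral_same, sub_zero]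
    have hMM := hu.le_energy hℓ hγ.unitSpeed hη hε
    have hI := hu.integral_norm_tangent_sub hℓ hγ.unitSpeed
    have hI' := integral_norm_tangent_sub_le hℓ hγ' hη
    have e1 : IntervalIntegrable (fun s => |curvature ℓ η s| * |Real.sin (u s / 2)|) volume 0 ℓ :=
      hκη.abs.mul_continuousOn hsin
    have e2 : IntervalIntegrable (fun s => B * |Real.sin (u s / 2)|) volume 0 ℓ :=
      hsin.intervalIntegrable.const_mul B
    have hle : ∫ s in (0)..ℓ, f s ≤ 2 * ((∫ s in (0)..ℓ, |curvature ℓ η s| *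
        |Real.sin (u s / 2)|) + B * ∫ s in (0)..ℓ, |Real.sin (u s / 2)|) := by
      rw [← intervalIntegral.integral_const_mul, ← intervalIntegral.integral_add e1 e2,
        ← intervalIntegral.integral_const_mul]
      refine intervalIntegral.integral_mono_on hℓ.le hfi ((e1.add e2).const_mul 2) fun s hs => ?_
      have h1 := abs_sub (curvature ℓ η s) (curvature ℓ γ s)
      have h2 := hB s hs
      rw [hf]
      simp only
      rw [← add_mul]
      exact mul_le_mul_of_nonneg_left
        (mul_le_mul_of_nonneg_right (by linarith) (abs_nonneg _)) (by norm_num)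
    have hnn : 0 ≤ ∫ s in (0)..ℓ, |curvature ℓ η s| * |Real.sin (u s / 2)| :=
      intervalIntegral.integral_nonneg hℓ.le fun s _ => by positivity
    have hB0 : 0 ≤ B := (abs_nonneg _).trans (hB 0 (left_mem_Icc.2 hℓ.le))
    have hsqrt : (1 : ℝ) ≤ √2 := Real.one_le_sqrt.2 (by norm_num)
    nlinarith [mul_le_mul_of_nonneg_left hI' hB0]

theorem integral_deriv_mul_step (hℓ : 0 < ℓ) {φ : ℝ → ℝ} {K : ℝ≥0}
    (hφ : LipschitzOnWith K φ (Icc 0 ℓ)) {t : ℝ} (ht : t ∈ Icc 0 ℓ) :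
    IntervalIntegrable (fun s => deriv φ s * if t ≤ s then 1 else 0) volume 0 ℓ ∧
      ∫ s in (0)..ℓ, deriv φ s * (if t ≤ s then 1 else 0) = φ ℓ - φ t := by
  have hac : AbsolutelyContinuousOnInterval φ 0 ℓ :=
    LipschitzOnWith.absolutelyContinuousOnInterval (by rwa [uIcc_of_le hℓ.le])
  have hsub1 : uIcc 0 t ⊆ uIcc 0 ℓ := by
    rw [uIcc_of_le ht.1, uIcc_of_le hℓ.le]; exact Icc_subset_Icc_right ht.2
  have hsub2 : uIcc t ℓ ⊆ uIcc 0 ℓ := by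
    rw [uIcc_of_le ht.2, uIcc_of_le hℓ.le]; exact Icc_subset_Icc_left ht.1
  have hne : ∀ᵐ s : ℝ, s ≠ t := by simp [ae_iff, measure_singleton]
  have h1 : ∀ᵐ s : ℝ, s ∈ uIoc 0 t → 0 = deriv φ s * if t ≤ s then 1 else 0 := by
    filter_upwards [hne] with s hs hmem
    rw [uIoc_of_le ht.1] at hmem
    simp [not_le.2 (lt_of_le_of_ne hmem.2 hs)]
  have h2 : ∀ᵐ s : ℝ, s ∈ uIoc t ℓ → deriv φ s = deriv φ s * if t ≤ s then 1 else 0 := by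
    refine Eventually.of_forall fun s hmem => ?_
    rw [uIoc_of_le ht.2] at hmem
    simp [hmem.1.le]
  have i1 : IntervalIntegrable (fun s => deriv φ s * if t ≤ s then 1 else 0) volume 0 t :=
    (intervalIntegrable_const : IntervalIntegrable (fun _ => (0 : ℝ)) volume 0 t).congr_ae
      ((ae_restrict_iff' measurableSet_uIoc).2 h1)
  have i2 : IntervalIntegrable (fun s => deriv φ s * if t ≤ s then 1 else 0) volume t ℓ :=
    (hac.mono hsub2).intervalIntegrable_deriv.congr_ae
      ((ae_restrict_iff' measurableSet_uIoc).2 h2)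
  refine ⟨i1.trans i2, ?_⟩
  rw [← intervalIntegral.integral_add_adjacent_intervals i1 i2,
    ← intervalIntegral.integral_congr_ae h1, ← intervalIntegral.integral_congr_ae h2,
    intervalIntegral.integral_zero, zero_add, (hac.mono hsub2).integral_deriv_eq_sub]

/-- If the angle `u` from `γ` to `η` is close to a step function with jumps `2π cᵢ` at `tᵢ`, then
`(κ_η - κ_γ) ds` is close to the corresponding atomic measure; the first atom, at the base point,
takes care of the jump of the step function from `ℓ` to `0`. -/
theorem IsAngle.exists_atoms (hℓ : 0 < ℓ) (hγ : IsClosedC2Curve ℓ γ)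
    (hη : IsClosedH2Curve ℓ η) {u : ℝ → ℝ} (hu : IsAngle ℓ γ η u) {ε : ℝ} (hε : 0 < ε) {B : ℝ}
    (hB : ∀ s ∈ Icc 0 ℓ, |curvature ℓ γ s| ≤ B) {N : ℕ}
    (hN : energy ℓ γ ε η + 2 * B * ℓ < N) :
    ∃ x : Fin (N + 1) → ℝ × ℤ, (∀ i, x i ∈ Icc 0 ℓ ×ˢ Icc (-1) 1) ∧
      ∀ φ, φ 0 = φ ℓ → LipschitzOnWith 1 φ (Icc 0 ℓ) →
        (∫ s in (0)..ℓ, φ s * (curvature ℓ η s - curvature ℓ γ s)) -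
          2 * Real.pi * (∑ i, (x i).2 * φ (x i).1) ≤
            5 * ∫ s in (0)..ℓ, ‖tangent ℓ η s - tangent ℓ γ s‖ := by
  have hπ := Real.pi_pos
  obtain ⟨V, hV, hVN⟩ := hu.exists_variation_bound hℓ hγ hη hε hB
  set m : ℤ := round (u 0 / (2 * Real.pi)) with hm
  have hm' : |u 0 - 2 * Real.pi * m| ≤ Real.pi := by
    have h1 := abs_sub_round (u 0 / (2 * Real.pi))
    have h2 : u 0 - 2 * Real.pi * m = 2 * Real.pi * (u 0 / (2 * Real.pi) - m) := by field_simp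
    rw [h2, abs_mul, abs_of_pos Real.two_pi_pos]
    nlinarith
  obtain ⟨t, c, ht, hc, happ⟩ := exists_step_approximation N 0 m hℓ.le (hu.continuousOn hℓ) hV
    (hVN.trans_lt hN) hm'
  obtain ⟨n, hn⟩ := hu.periodic
  have h0mem : (0 : ℝ) ∈ Icc 0 ℓ := left_mem_Icc.2 hℓ.le
  have hℓmem : ℓ ∈ Icc 0 ℓ := right_mem_Icc.2 hℓ.le
  have hlast : |n - ∑ i, c i| ≤ 1 := by
    have h1 := happ ℓ hℓmem
    have h2 : ∀ i, t i ≤ ℓ := fun i => (ht i).2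
    simp only [h2, if_true] at h1
    have h3 : 2 * Real.pi * ((n - ∑ i, c i : ℤ) : ℝ) =
        (u ℓ - 2 * Real.pi * ((m + ∑ i, c i : ℤ) : ℝ)) - (u 0 - 2 * Real.pi * m) := by
      push_cast; linarith
    have h4 : 2 * Real.pi * |((n - ∑ i, c i : ℤ) : ℝ)| ≤ 5 * Real.pi / 2 := by
      rw [← abs_of_pos Real.two_pi_pos, ← abs_mul, h3]
      exact (abs_sub _ _).trans (by linarith)
    have h5 : |((n - ∑ i, c i : ℤ) : ℝ)| < 2 := by nlinarith
    have h6 : |n - ∑ i, c i| < 2 := by exact_mod_cast h5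
    omega
  refine ⟨Fin.cons (0, n - ∑ i, c i) fun i => (t i, c i), ?_, ?_⟩
  · intro i
    refine Fin.cases ⟨h0mem, abs_le.1 hlast⟩ (fun i => ⟨ht i, abs_le.1 (hc i)⟩) i
  intro φ hper hφ
  have hφac : AbsolutelyContinuousOnInterval φ 0 ℓ :=
    LipschitzOnWith.absolutelyContinuousOnInterval (by rwa [uIcc_of_le hℓ.le])
  have hderiv : ∫ s in (0)..ℓ, φ s * (curvature ℓ η s - curvature ℓ γ s) =
      ∫ s in (0)..ℓ, φ s * deriv u s := by
    refine intervalIntegral.integral_congr_ae ?_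
    filter_upwards [hu.ae_hasDerivAt] with s hs hmem
    rw [uIoc_of_le hℓ.le] at hmem
    rw [(hs (Ioc_subset_Icc_self hmem)).deriv]
  set S : ℝ → ℝ := fun s => 2 * Real.pi * ((m + ∑ i, if t i ≤ s then c i else 0 : ℤ) : ℝ) with hS
  have hS' : ∀ s, deriv φ s * S s = 2 * Real.pi * m * deriv φ s +
      ∑ i, 2 * Real.pi * c i * (deriv φ s * if t i ≤ s then 1 else 0) := by
    intro s
    simp only [hS]
    push_cast
    rw [mul_add, mul_add, Finset.mul_sum, Finset.mul_sum]
    congr 1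
    · ring
    · refine Finset.sum_congr rfl fun i _ => ?_
      split_ifs <;> ring
  have hstep := fun i => integral_deriv_mul_step hℓ hφ (ht i)
  have hφ'int := hφac.intervalIntegrable_deriv
  have j1 : IntervalIntegrable (fun s => 2 * Real.pi * m * deriv φ s) volume 0 ℓ :=
    hφ'int.const_mul _
  have j2 : ∀ i ∈ Finset.univ, IntervalIntegrable
      (fun s => 2 * Real.pi * c i * (deriv φ s * if t i ≤ s then 1 else 0)) volume 0 ℓ :=
    fun i _ => (hstep i).1.const_mul _
  have j3 : IntervalIntegrable (fun s => ∑ i, 2 * Real.pi * c i *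
      (deriv φ s * if t i ≤ s then 1 else 0)) volume 0 ℓ := by
    have := IntervalIntegrable.sum Finset.univ j2
    rwa [Finset.sum_fn] at this
  have hSint : IntervalIntegrable (fun s => deriv φ s * S s) volume 0 ℓ := by
    simp_rw [hS']
    exact j1.add j3
  have hSval : ∫ s in (0)..ℓ, deriv φ s * S s = 2 * Real.pi * ∑ i, c i * (φ ℓ - φ (t i)) := by
    simp_rw [hS']
    rw [intervalIntegral.integral_add j1 j3, intervalIntegral.integral_finsetSum j2,
      intervalIntegral.integral_const_mul, hφac.integral_deriv_eq_sub, hper, sub_self, mul_zero,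
      zero_add, Finset.mul_sum]
    refine Finset.sum_congr rfl fun i _ => ?_
    rw [intervalIntegral.integral_const_mul, (hstep i).2]
    ring
  have hui : IntervalIntegrable (fun s => deriv φ s * u s) volume 0 ℓ :=
    hφ'int.mul_continuousOn hu.absolutelyContinuous.continuousOn
  have herr : |∫ s in (0)..ℓ, (deriv φ s * u s - deriv φ s * S s)| ≤
      10 * ∫ s in (0)..ℓ, |Real.sin (u s / 2)| := by
    rw [← intervalIntegral.integral_const_mul, ← Real.norm_eq_abs]
    refine intervalIntegral.norm_integral_le_of_norm_le hℓ.le ?_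
      ((hu.continuousOn_abs_sin_half hℓ).intervalIntegrable.const_mul _)
    filter_upwards [ae_mem_Icc_imp_mem_Ioo 0 ℓ] with s hs hmem
    have hs' := hs (Ioc_subset_Icc_self hmem)
    have h1 := norm_deriv_le_of_lipschitzOn (Icc_mem_nhds hs'.1 hs'.2) hφ
    have h2 := abs_le_mul_abs_sin_half (happ s (Ioc_subset_Icc_self hmem))
    rw [← mul_sub, norm_mul, Real.norm_eq_abs (u s - S s)]
    refine (mul_le_of_le_one_left (abs_nonneg _) (by simpa using h1)).trans (h2.trans_eq ?_)
    congr 1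
    set k : ℤ := m + ∑ i, if t i ≤ s then c i else 0
    have h3 : (u s - 2 * Real.pi * k) / 2 = u s / 2 - k * Real.pi := by ring
    rw [h3, Real.sin_sub_int_mul_pi, abs_mul]
    simp
  rw [intervalIntegral.integral_sub hui hSint, hSval] at herr
  rw [hderiv, hφac.integral_mul_deriv_eq_deriv_mul hu.absolutelyContinuous,
    hu.integral_norm_tangent_sub hℓ hγ.unitSpeed, Fin.sum_univ_succ]
  simp only [Fin.cons_zero, Fin.cons_succ]
  have h7 := (abs_le.1 herr).1
  simp_rw [mul_sub] at h7
  rw [Finset.sum_sub_distrib, ← Finset.sum_mul] at h7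
  have h8 : φ ℓ * u ℓ - φ 0 * u 0 = φ ℓ * (2 * Real.pi * n) := by
    rw [hper, ← mul_sub, hn]
  rw [h8, hper]
  push_cast
  linarith

/-- The atoms `cᵢ δ_{tᵢ}` as a function of finite support on the closed curve, whose base point is
represented by `0`. -/
def sumAtoms (ℓ : ℝ) {ι : Type*} [Fintype ι] (x : ι → ℝ × ℤ) : ℝ →₀ ℤ :=
  ∑ i, Finsupp.single (if (x i).1 = ℓ then 0 else (x i).1) (x i).2

theorem isSingularity_sumAtoms (hℓ : 0 < ℓ) {ι : Type*} [Fintype ι] {x : ι → ℝ × ℤ}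
    (hx : ∀ i, (x i).1 ∈ Icc 0 ℓ) : IsSingularity ℓ (sumAtoms ℓ x) := by
  classical
  have h : ∀ s ∈ (sumAtoms ℓ x).support, s ∈ Ico 0 ℓ := by
    intro s hs
    obtain ⟨i, -, hi⟩ := Finset.mem_biUnion.1 (Finsupp.support_finsetSum hs)
    have := Finset.mem_singleton.1 (Finsupp.support_single_subset hi)
    rw [this]
    split_ifs with h
    · exact ⟨le_rfl, hℓ⟩
    · exact ⟨(hx i).1, lt_of_le_of_ne (hx i).2 h⟩
  exact ⟨fun s hs => Ico_subset_Icc_self (h s hs), fun hs => lt_irrefl _ (h ℓ hs.2).2⟩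

theorem sum_sumAtoms {ι : Type*} [Fintype ι] (x : ι → ℝ × ℤ) {φ : ℝ → ℝ} (hper : φ 0 = φ ℓ) :
    ((sumAtoms ℓ x).sum fun s n => (n : ℝ) * φ s) = ∑ i, (x i).2 * φ (x i).1 := by
  rw [sumAtoms, ← Finsupp.sum_finsetSum_index (by simp) (by intros; push_cast; ring)]
  refine Finset.sum_congr rfl fun i _ => ?_
  rw [Finsupp.sum_single_index (by simp)]
  split_ifs with h
  · rw [hper, h]
  · rfl

theorem tangent_translate (v w : Plane) :
    tangent ℓ (fun s => η s - v + w) = tangent ℓ η := by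
  funext s
  rw [tangent, tangent, derivWithin_add_const, derivWithin_sub_const]

theorem curvature_translate (v w : Plane) :
    curvature ℓ (fun s => η s - v + w) = curvature ℓ η := by
  funext s
  simp only [curvature, secondDeriv, tangent_translate]

theorem IsClosedH2Curve.translate (hη : IsClosedH2Curve ℓ η) (v w : Plane) :
    IsClosedH2Curve ℓ (fun s => η s - v + w) where
  isH2 :=
    { contDiffOn := (hη.isH2.contDiffOn.sub contDiffOn_const).add contDiffOn_const
      absolutelyContinuous := by rw [tangent_translate]; exact hη.isH2.absolutelyContinuous
      memLp := by
        have : secondDeriv ℓ (fun s => η s - v + w) = secondDeriv ℓ η := by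
          simp only [secondDeriv, tangent_translate]
        rw [this]; exact hη.isH2.memLp }
  unitSpeed := by rw [tangent_translate]; exact hη.unitSpeed
  closed := by rw [hη.closed]
  tangent_closed := by rw [tangent_translate]; exact hη.tangent_closed

theorem integral_norm_tangent_sub_sq_le (hℓ : 0 < ℓ) {ε : ℝ} (hε : 0 < ε) :
    ∫ s in (0)..ℓ, ‖tangent ℓ η s - tangent ℓ γ s‖ ^ 2 ≤ 2 * √ε * energy ℓ γ ε η := by
  have hs0 : 0 < √ε := Real.sqrt_pos.2 hε
  have h0 : 0 ≤ ∫ s in (0)..ℓ, curvature ℓ η s ^ 2 :=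
    intervalIntegral.integral_nonneg hℓ.le fun s _ => sq_nonneg _
  rw [energy, mul_add]
  have h1 : 2 * √ε * (1 / (2 * √ε) * ∫ s in (0)..ℓ, ‖tangent ℓ η s - tangent ℓ γ s‖ ^ 2) =
      ∫ s in (0)..ℓ, ‖tangent ℓ η s - tangent ℓ γ s‖ ^ 2 := by field_simp
  rw [h1]
  have : 0 ≤ 2 * √ε * (√ε * ∫ s in (0)..ℓ, curvature ℓ η s ^ 2) := by positivity
  linarith

/-- Curves with a common base point are close in `H¹` as soon as their tangents are close. -/
theorem h1DistSq_le (hℓ : 0 < ℓ) (hγ : IsClosedH2Curve ℓ γ) (hη : IsClosedH2Curve ℓ η)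
    (h0 : η 0 = γ 0) {ε : ℝ} (hε : 0 < ε) :
    h1DistSq ℓ η γ ≤ (ℓ ^ 2 + 1) * (2 * √ε * energy ℓ γ ε η) := by
  have hcon : ContinuousOn (fun s => tangent ℓ η s - tangent ℓ γ s) (Icc 0 ℓ) :=
    (hη.continuousOn_tangent hℓ).sub (hγ.continuousOn_tangent hℓ)
  have hcon' : ContinuousOn (fun s => tangent ℓ η s - tangent ℓ γ s) (uIcc 0 ℓ) := by
    rwa [uIcc_of_le hℓ.le]
  set D := ∫ s in (0)..ℓ, ‖tangent ℓ η s - tangent ℓ γ s‖ with hD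
  set T := ∫ s in (0)..ℓ, ‖tangent ℓ η s - tangent ℓ γ s‖ ^ 2 with hT
  have hDT : D ^ 2 ≤ ℓ * T := sq_integral_le_mul_integral_sq hℓ hcon.norm
  have hTE : T ≤ 2 * √ε * energy ℓ γ ε η := integral_norm_tangent_sub_sq_le hℓ hε
  have hpt : ∀ s ∈ Icc 0 ℓ, ‖η s - γ s‖ ≤ D := by
    intro s hs
    have hsub : uIcc 0 s ⊆ uIcc 0 ℓ := by
      rw [uIcc_of_le hs.1, uIcc_of_le hℓ.le]; exact Icc_subset_Icc_right hs.2
    have hsub' : uIcc 0 s ⊆ Icc 0 ℓ := by rwa [uIcc_of_le hℓ.le] at hsub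
    have h1 : η s - γ s = ∫ r in (0)..s, (tangent ℓ η r - tangent ℓ γ r) := by
      rw [intervalIntegral.integral_sub
        ((hη.continuousOn_tangent hℓ).mono hsub').intervalIntegrable
        ((hγ.continuousOn_tangent hℓ).mono hsub').intervalIntegrable,
        ← hη.sub_eq_integral hℓ hs, ← hγ.sub_eq_integral hℓ hs, h0]
      abel
    rw [h1]
    refine (intervalIntegral.norm_integral_le_integral_norm hs.1).trans ?_
    exact intervalIntegral.integral_mono_interval le_rfl hs.1 hs.2
      (Eventually.of_forall fun _ => norm_nonneg _) hcon'.norm.intervalIntegrable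
  have hcurve : ContinuousOn (fun s => ‖η s - γ s‖ ^ 2) (uIcc 0 ℓ) := by
    rw [uIcc_of_le hℓ.le]
    exact (hη.isH2.contDiffOn.continuousOn.sub hγ.isH2.contDiffOn.continuousOn).norm.pow 2
  have h2 : ∫ s in (0)..ℓ, ‖η s - γ s‖ ^ 2 ≤ ℓ * D ^ 2 := by
    have := intervalIntegral.integral_mono_on (μ := volume) (g := fun _ => D ^ 2) hℓ.le
      hcurve.intervalIntegrable intervalIntegrable_const fun s hs =>
        pow_le_pow_left₀ (norm_nonneg _) (hpt s hs) 2
    simpa using this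
  have hT0 : 0 ≤ T := intervalIntegral.integral_nonneg hℓ.le fun s _ => sq_nonneg _
  have h3 : ℓ * D ^ 2 ≤ ℓ * (ℓ * T) := mul_le_mul_of_nonneg_left hDT hℓ.le
  rw [h1DistSq]
  calc _ ≤ (ℓ ^ 2 + 1) * T := by rw [← hT]; linarith
    _ ≤ _ := mul_le_mul_of_nonneg_left hTE (by positivity)

/-- Convergence towards `(γ, μ)` follows from a bound for the energies and the convergence of the
integrals of test functions. -/
theorem convergesTo_of_energy_le (hℓ : 0 < ℓ) (hγ : IsClosedH2Curve ℓ γ) {ι : Type*}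
    {F : Filter ι} {ε : ι → ℝ} {η : ι → ℝ → Plane} {c : ℝ →₀ ℤ} (hε : ∀ᶠ i in F, 0 < ε i)
    (hε0 : Tendsto ε F (𝓝 0)) (hη : ∀ᶠ i in F, IsClosedH2Curve ℓ (η i))
    (h0 : ∀ᶠ i in F, η i 0 = γ 0) {C : ℝ} (hC : ∀ᶠ i in F, energy ℓ γ (ε i) (η i) ≤ C)
    (hc : IsSingularity ℓ c) {δ : ι → ℝ} (hδ : Tendsto δ F (𝓝 0))
    (hflat : ∀ᶠ i in F, ∀ φ, IsFlatTest ℓ φ →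
      (∫ s in (0)..ℓ, φ s * (curvature ℓ (η i) s - curvature ℓ γ s)) -
        2 * Real.pi * (c.sum fun s n => (n : ℝ) * φ s) ≤ δ i) :
    ConvergesTo F ℓ η γ (pointedMeasure ℓ γ c) := by
  constructor
  · have hlim : Tendsto (fun i => (ℓ ^ 2 + 1) * (2 * √(ε i) * C)) F (𝓝 0) := by
      have := (((Real.continuous_sqrt.tendsto 0).comp hε0).const_mul 2).mul_const C
      simpa [Function.comp_def] using this.const_mul (ℓ ^ 2 + 1)
    refine squeeze_zero' (Eventually.of_forall fun i => ?_) ?_ hlim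
    · exact add_nonneg (intervalIntegral.integral_nonneg hℓ.le fun s _ => sq_nonneg _)
        (intervalIntegral.integral_nonneg hℓ.le fun s _ => sq_nonneg _)
    · filter_upwards [hε, hη, h0, hC] with i h1 h2 h3 h4
      exact (h1DistSq_le hℓ hγ h2 h3 h1).trans (by gcongr)
  · have hlim : Tendsto (fun i => ENNReal.ofReal (δ i)) F (𝓝 0) := by
      simpa using ENNReal.tendsto_ofReal hδ
    refine tendsto_of_tendsto_of_tendsto_of_le_of_le' tendsto_const_nhds hlim
      (Eventually.of_forall fun _ => zero_le) ?_
    filter_upwards [hη, hflat] with i h1 h2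
    exact flatNorm_curvatureMeasure_sub_le hℓ hγ h1 hc.1 h2

/-- Sequences with bounded energy have, up to subsequences and translations, limits of the form
`(γ, μ)`: the angles yield atomic measures with a fixed number of atoms, whose positions and
weights range in a compact set. -/
theorem compactness (hℓ : 0 < ℓ) (hγ : IsClosedC2Curve ℓ γ) {ε : ℕ → ℝ} {η : ℕ → ℝ → Plane}
    (hε : ∀ k, 0 < ε k) (hε0 : Tendsto ε atTop (𝓝 0)) (hη : ∀ k, IsClosedH2Curve ℓ (η k)) {C : ℝ}
    (hC : ∀ k, energy ℓ γ (ε k) (η k) ≤ C) :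
    ∃ (n : ℕ → ℕ) (c : ℝ →₀ ℤ), StrictMono n ∧ IsSingularity ℓ c ∧
      ConvergesTo atTop ℓ (fun k s => η (n k) s - η (n k) 0 + γ 0) γ (pointedMeasure ℓ γ c) := by
  have hγ' := hγ.isClosedH2Curve hℓ
  obtain ⟨B, hB⟩ := isCompact_Icc.exists_bound_of_continuousOn (hγ.continuousOn_curvature hℓ)
  obtain ⟨N, hN⟩ := exists_nat_gt (C + 2 * B * ℓ)
  have hx : ∀ k, ∃ x : Fin (N + 1) → ℝ × ℤ, (∀ i, x i ∈ Icc 0 ℓ ×ˢ Icc (-1) 1) ∧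
      ∀ φ, φ 0 = φ ℓ → LipschitzOnWith 1 φ (Icc 0 ℓ) →
        (∫ s in (0)..ℓ, φ s * (curvature ℓ (η k) s - curvature ℓ γ s)) -
          2 * Real.pi * (∑ i, (x i).2 * φ (x i).1) ≤
            5 * ∫ s in (0)..ℓ, ‖tangent ℓ (η k) s - tangent ℓ γ s‖ := by
    intro k
    obtain ⟨u, hu⟩ := exists_isAngle hℓ hγ' (hη k)
    exact hu.exists_atoms hℓ hγ (hη k) (hε k) hB ((add_le_add_left (hC k) _).trans_lt hN)
  choose x hx hxφ using hx
  have hcomp : IsCompact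
      (Set.pi univ fun _ : Fin (N + 1) => (Icc 0 ℓ ×ˢ Icc (-1) 1 : Set (ℝ × ℤ))) :=
    isCompact_univ_pi fun _ => isCompact_Icc.prod isCompact_Icc
  obtain ⟨y, hy, n, hn, hlim⟩ := hcomp.tendsto_subseq (x := x) fun k i _ => hx k i
  have hsing : IsSingularity ℓ (sumAtoms ℓ y) :=
    isSingularity_sumAtoms hℓ fun i => (hy i (mem_univ i)).1
  refine ⟨n, sumAtoms ℓ y, hn, hsing, ?_⟩
  have hlim1 : ∀ i, Tendsto (fun k => (x (n k) i).1) atTop (𝓝 (y i).1) := fun i =>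
    (continuous_fst.tendsto _).comp (tendsto_pi_nhds.1 hlim i)
  have hlim2 : ∀ᶠ k in atTop, ∀ i, (x (n k) i).2 = (y i).2 := by
    rw [eventually_all]
    intro i
    have := (continuous_snd.tendsto _).comp (tendsto_pi_nhds.1 hlim i)
    rw [nhds_discrete, tendsto_pure] at this
    exact this
  have hεn := hε0.comp hn.tendsto_atTop
  have htan : Tendsto (fun k => ∫ s in (0)..ℓ, ‖tangent ℓ (η (n k)) s - tangent ℓ γ s‖ ^ 2) atTop
      (𝓝 0) := by
    have hlim : Tendsto (fun k => 2 * √(ε (n k)) * C) atTop (𝓝 0) := by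
      simpa [Function.comp_def] using
        (((Real.continuous_sqrt.tendsto 0).comp hεn).const_mul 2).mul_const C
    refine squeeze_zero (fun k => intervalIntegral.integral_nonneg hℓ.le fun s _ => sq_nonneg _)
      (fun k => (integral_norm_tangent_sub_sq_le hℓ (hε (n k))).trans ?_) hlim
    gcongr
    exact hC (n k)
  have hD := tendsto_integral_norm_tangent_sub hℓ hγ' (Eventually.of_forall fun k => hη (n k)) htan
  have hener : ∀ k, energy ℓ γ (ε (n k)) (fun s => η (n k) s - η (n k) 0 + γ 0) =
      energy ℓ γ (ε (n k)) (η (n k)) := fun k => by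
    simp only [energy, curvature_translate, tangent_translate]
  have hδ : Tendsto (fun k => 5 * (∫ s in (0)..ℓ, ‖tangent ℓ (η (n k)) s - tangent ℓ γ s‖) +
      2 * Real.pi * ∑ i, |(x (n k) i).1 - (y i).1|) atTop (𝓝 0) := by
    have h1 : Tendsto (fun k => ∑ i, |(x (n k) i).1 - (y i).1|) atTop (𝓝 0) := by
      have : Tendsto (fun k => ∑ i, |(x (n k) i).1 - (y i).1|) atTop
          (𝓝 (∑ i : Fin (N + 1), |(y i).1 - (y i).1|)) :=
        tendsto_finsetSum _ fun i _ => ((hlim1 i).sub_const _).abs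
      simpa using this
    simpa using (hD.const_mul 5).add (h1.const_mul (2 * Real.pi))
  refine convergesTo_of_energy_le hℓ hγ' (ε := fun k => ε (n k)) (C := C)
    (Eventually.of_forall fun k => hε _) hεn
    (Eventually.of_forall fun k => (hη _).translate _ _) (Eventually.of_forall fun k => by simp)
    (Eventually.of_forall fun k => by rw [hener]; exact hC _) hsing hδ ?_
  filter_upwards [hlim2] with k hk φ hφ
  have h1 := hxφ (n k) φ hφ.1 hφ.lipschitzOnWith
  rw [curvature_translate, sum_sumAtoms y hφ.1]
  have h2 : (∑ i, ((x (n k) i).2 : ℝ) * φ (x (n k) i).1) - ∑ i, ((y i).2 : ℝ) * φ (y i).1 ≤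
      ∑ i, |(x (n k) i).1 - (y i).1| := by
    rw [← Finset.sum_sub_distrib]
    refine Finset.sum_le_sum fun i _ => ?_
    rw [hk i, ← mul_sub]
    refine (le_abs_self _).trans ?_
    rw [abs_mul]
    have hcast : |((y i).2 : ℝ)| ≤ 1 := by exact_mod_cast abs_le.2 (hy i (mem_univ i)).2
    have hlip := hφ.lipschitzOnWith.dist_le_mul _ (hx (n k) i).1 _ (hy i (mem_univ i)).1
    rw [Real.dist_eq, Real.dist_eq, NNReal.coe_one, one_mul] at hlip
    exact (mul_le_of_le_one_left (abs_nonneg _) hcast).trans hlip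
  have h3 := mul_le_mul_of_nonneg_left h2 Real.two_pi_pos.le
  rw [mul_sub] at h3
  linarith

/-! ### Curves with prescribed angle -/

/-- A `C¹` angle function whose rotation of `∂ₛγ` has mean zero is the angle of a closed curve. -/
theorem exists_curve_of_angle (hℓ : 0 < ℓ) (hγ : IsClosedC2Curve ℓ γ) {u : ℝ → ℝ}
    (hu : ContDiffOn ℝ 1 u (Icc 0 ℓ)) (hper : ∃ n : ℤ, u ℓ - u 0 = 2 * Real.pi * n)
    (hclose : ∫ s in (0)..ℓ, toC (tangent ℓ γ s) * Complex.exp (u s * Complex.I) = 0) :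
    ∃ η, IsClosedH2Curve ℓ η ∧ η 0 = γ 0 ∧ IsAngle ℓ γ η u := by
  have hγ' := hγ.isClosedH2Curve hℓ
  have hud : UniqueDiffOn ℝ (Icc 0 ℓ) := uniqueDiffOn_Icc hℓ
  have h0mem : (0 : ℝ) ∈ Icc 0 ℓ := left_mem_Icc.2 hℓ.le
  have hℓmem : ℓ ∈ Icc 0 ℓ := right_mem_Icc.2 hℓ.le
  have hTc : ContDiffOn ℝ 1 (tangent ℓ γ) (Icc 0 ℓ) := hγ.contDiffOn.derivWithin hud (by norm_num)
  set g : ℝ → Plane := fun s => toC.symm (toC (tangent ℓ γ s) * Complex.exp (u s * Complex.I))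
    with hg
  have hgC : ContDiffOn ℝ 1 g (Icc 0 ℓ) := by
    have h1 : ContDiffOn ℝ 1 (fun s => toC (tangent ℓ γ s)) (Icc 0 ℓ) :=
      toC.toContinuousLinearEquiv.contDiff.comp_contDiffOn hTc
    have h2 : ContDiffOn ℝ 1 (fun s => (u s : ℂ)) (Icc 0 ℓ) :=
      Complex.ofRealCLM.contDiff.comp_contDiffOn hu
    exact toC.symm.toContinuousLinearEquiv.contDiff.comp_contDiffOn
      (h1.mul ((h2.mul contDiffOn_const).cexp))
  have hgc : Continuous (fun s => g (projIcc 0 ℓ hℓ.le s)) :=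
    (continuousOn_iff_continuous_domRestrict.1 hgC.continuousOn).comp continuous_projIcc
  set G : ℝ → Plane := fun s => g (projIcc 0 ℓ hℓ.le s) with hG
  have hGg : ∀ s ∈ Icc 0 ℓ, G s = g s := fun s hs => by simp only [hG, projIcc_of_mem hℓ.le hs]
  set η : ℝ → Plane := fun s => γ 0 + ∫ r in (0)..s, G r with hη
  have hηd : ∀ s, HasDerivAt η (G s) s := fun s =>
    (hgc.integral_hasStrictDerivAt 0 s).hasDerivAt.const_add _
  have htan : ∀ s ∈ Icc 0 ℓ, tangent ℓ η s = g s := fun s hs => by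
    rw [tangent, ((hηd s).hasDerivWithinAt).derivWithin (hud s hs), hGg s hs]
  have hη2 : ContDiffOn ℝ 2 η (Icc 0 ℓ) := by
    have : ContDiffOn ℝ (1 + 1) η (Icc 0 ℓ) := by
      rw [contDiffOn_succ_iff_derivWithin hud]
      exact ⟨fun s _ => (hηd s).differentiableAt.differentiableWithinAt, by simp,
        hgC.congr htan⟩
    simpa [one_add_one_eq_two] using this
  have hunit : ∀ s ∈ Icc 0 ℓ, ‖tangent ℓ η s‖ = 1 := fun s hs => by
    rw [htan s hs, hg]
    simp only
    rw [toC.symm.norm_map, norm_mul, Complex.norm_exp_ofReal_mul_I, mul_one, toC.norm_map,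
      hγ.unitSpeed s hs]
  have htanC : ∀ s ∈ Icc 0 ℓ,
      toC (tangent ℓ η s) = toC (tangent ℓ γ s) * Complex.exp (u s * Complex.I) := fun s hs => by
    rw [htan s hs, hg]
    simp only [LinearIsometryEquiv.apply_symm_apply]
  have hcl : η 0 = η ℓ := by
    simp only [hη, intervalIntegral.integral_same, add_zero]
    have h1 : ∫ r in (0)..ℓ, G r = ∫ r in (0)..ℓ, g r :=
      intervalIntegral.integral_congr fun s hs => hGg s (by rwa [uIcc_of_le hℓ.le] at hs)
    have h2 : IntervalIntegrable (fun s => toC (tangent ℓ γ s) * Complex.exp (u s * Complex.I))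
        volume 0 ℓ := by
      have := toC.continuous.comp_continuousOn hgC.continuousOn
      refine (ContinuousOn.congr (f := fun s => toC (g s)) ?_ fun s hs => ?_).intervalIntegrable
      · rwa [uIcc_of_le hℓ.le]
      · simp [hg]
    have h3 := toC.symm.toContinuousLinearEquiv.toContinuousLinearMap.intervalIntegral_comp_comm h2
    rw [hclose, map_zero] at h3
    rw [h1]
    exact left_eq_add.2 h3
  have htcl : tangent ℓ η 0 = tangent ℓ η ℓ := by
    apply toC.injective
    rw [htanC 0 h0mem, htanC ℓ hℓmem, hγ.tangent_closed]
    obtain ⟨n, hn⟩ := hper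
    have : u ℓ = u 0 + 2 * Real.pi * n := by linarith
    rw [this]
    congr 1
    rw [Complex.exp_eq_exp_iff_exists_int]
    exact ⟨-n, by push_cast; ring⟩
  have hηcl := isClosedH2Curve_of_contDiffOn_two hℓ hη2 hunit hcl htcl
  refine ⟨η, hηcl, by simp [hη], ?_, ?_, htanC, hper⟩
  · exact ContDiffOn.absolutelyContinuousOnInterval (by rwa [uIcc_of_le hℓ.le])
  · filter_upwards [hηcl.ae_hasDerivAt_tangent, hγ'.ae_hasDerivAt_tangent] with s h1 h2 hs
    obtain ⟨hs', h1⟩ := h1 hs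
    have h2 := (h2 hs).2
    have hd : HasDerivAt u (deriv u s) s :=
      ((hu.differentiableOn (by norm_num) s hs).differentiableAt
        (Icc_mem_nhds hs'.1 hs'.2)).hasDerivAt
    have e1 : HasDerivAt (fun s => toC (tangent ℓ η s)) (toC (secondDeriv ℓ η s)) s :=
      toC.toContinuousLinearEquiv.toContinuousLinearMap.hasFDerivAt.comp_hasDerivAt s h1
    have e2 : HasDerivAt (fun s => toC (tangent ℓ γ s)) (toC (secondDeriv ℓ γ s)) s :=
      toC.toContinuousLinearEquiv.toContinuousLinearMap.hasFDerivAt.comp_hasDerivAt s h2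
    have e3 := e2.fun_mul ((hd.ofReal_comp.mul_const Complex.I).cexp)
    have e4 : (fun s => toC (tangent ℓ η s)) =ᶠ[𝓝 s]
        fun s => toC (tangent ℓ γ s) * Complex.exp (u s * Complex.I) := by
      filter_upwards [Icc_mem_nhds hs'.1 hs'.2] with r hr using htanC r hr
    have e5 := e1.unique (e3.congr_of_eventuallyEq e4)
    rw [toC_secondDeriv_eq hunit hs' h1, toC_secondDeriv_eq hγ.unitSpeed hs' h2,
      htanC s hs] at e5
    have hne : toC (tangent ℓ γ s) * Complex.exp (u s * Complex.I) * Complex.I ≠ 0 := by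
      refine mul_ne_zero (mul_ne_zero ?_ (Complex.exp_ne_zero _)) Complex.I_ne_zero
      exact norm_ne_zero_iff.1 (by rw [toC.norm_map, hγ.unitSpeed s hs]; norm_num)
    have e6 : ((curvature ℓ η s : ℝ) : ℂ) = ((curvature ℓ γ s + deriv u s : ℝ) : ℂ) := by
      apply mul_right_cancel₀ hne
      push_cast
      linear_combination e5
    have e7 : curvature ℓ η s - curvature ℓ γ s = deriv u s := by
      rw [Complex.ofReal_inj.1 e6]; ring
    rwa [e7]

/-! ### Closing a curve by a small rotation of its tangent -/

theorem integral_toC_tangent (hℓ : 0 < ℓ) (hγ : IsClosedH2Curve ℓ γ) :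
    ∫ s in (0)..ℓ, toC (tangent ℓ γ s) = 0 := by
  have hi : IntervalIntegrable (tangent ℓ γ) volume 0 ℓ :=
    ContinuousOn.intervalIntegrable (by
      rw [uIcc_of_le hℓ.le]; exact hγ.continuousOn_tangent hℓ)
  have h1 := toC.toContinuousLinearEquiv.toContinuousLinearMap.intervalIntegral_comp_comm hi
  rw [← hγ.sub_eq_integral hℓ (right_mem_Icc.2 hℓ.le), hγ.closed, sub_self, map_zero] at h1
  exact h1

/-- The tangent of a closed curve is not contained in a line: the Gram operator
`p ↦ ∫ ⟨p, ∂ₛγ⟩ ∂ₛγ` is injective. -/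
theorem eq_zero_of_integral_inner_smul (hℓ : 0 < ℓ) (hγ : IsClosedH2Curve ℓ γ) {p : ℂ}
    (hp : ∫ s in (0)..ℓ, inner ℝ p (toC (tangent ℓ γ s)) • toC (tangent ℓ γ s) = 0) : p = 0 := by
  have hT : ContinuousOn (fun s => toC (tangent ℓ γ s)) (Icc 0 ℓ) :=
    toC.continuous.comp_continuousOn (hγ.continuousOn_tangent hℓ)
  have hT' : ContinuousOn (fun s => toC (tangent ℓ γ s)) (uIcc 0 ℓ) := by rwa [uIcc_of_le hℓ.le]
  have hin : ∀ q : ℂ, ContinuousOn (fun s => inner ℝ q (toC (tangent ℓ γ s))) (Icc 0 ℓ) :=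
    fun q => continuousOn_const.inner hT
  have hin' : ∀ q : ℂ, ContinuousOn (fun s => inner ℝ q (toC (tangent ℓ γ s))) (uIcc 0 ℓ) := by
    rwa [uIcc_of_le hℓ.le]
  have hzero : ∀ s ∈ Icc 0 ℓ, inner ℝ p (toC (tangent ℓ γ s)) = 0 := by
    have h0 : IntervalIntegrable
        (fun s => inner ℝ p (toC (tangent ℓ γ s)) • toC (tangent ℓ γ s)) volume 0 ℓ :=
      ((hin' p).smul hT').intervalIntegrable
    have h1 := (innerSL ℝ p).intervalIntegral_comp_comm h0
    rw [hp, map_zero] at h1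
    simp only [innerSL_apply_apply, inner_smul_right] at h1
    by_contra! hcon
    obtain ⟨s, hs, hs'⟩ := hcon
    have := intervalIntegral.integral_pos hℓ ((hin p).mul (hin p))
      (fun s _ => mul_self_nonneg _) ⟨s, hs, mul_self_pos.2 hs'⟩
    exact this.ne' h1
  by_contra hp0
  have hnorm : ∀ s ∈ Icc 0 ℓ, inner ℝ (Complex.I * p) (toC (tangent ℓ γ s)) ≠ 0 := by
    intro s hs h0
    have h1 := hzero s hs
    rw [Complex.inner] at h0 h1
    have h2 : Complex.normSq p * Complex.normSq (toC (tangent ℓ γ s)) = 0 := by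
      simp only [map_mul, Complex.conj_I, Complex.mul_re, Complex.mul_im, Complex.conj_re,
        Complex.conj_im, Complex.neg_re, Complex.neg_im, Complex.I_re, Complex.I_im] at h0 h1
      simp only [Complex.normSq_apply]
      linear_combination ((toC (tangent ℓ γ s)).re * p.re + (toC (tangent ℓ γ s)).im * p.im) * h1 +
        ((toC (tangent ℓ γ s)).im * p.re - (toC (tangent ℓ γ s)).re * p.im) * h0
    rcases mul_eq_zero.1 h2 with h | h
    · exact hp0 (Complex.normSq_eq_zero.1 h)
    · have h3 := Complex.normSq_eq_zero.1 h
      have h4 := hγ.unitSpeed s hs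
      rw [← toC.norm_map, h3, norm_zero] at h4
      exact zero_ne_one h4
  set w : ℝ → ℝ := fun s => inner ℝ (Complex.I * p) (toC (tangent ℓ γ s)) with hw
  have h0mem : (0 : ℝ) ∈ Icc 0 ℓ := left_mem_Icc.2 hℓ.le
  have hwint : ∫ s in (0)..ℓ, w s = 0 := by
    have h0 : IntervalIntegrable (fun s => toC (tangent ℓ γ s)) volume 0 ℓ :=
      hT'.intervalIntegrable
    have h1 := (innerSL ℝ (Complex.I * p)).intervalIntegral_comp_comm h0
    rw [integral_toC_tangent hℓ hγ, map_zero] at h1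
    exact h1
  have hwc : ContinuousOn (fun s => w 0 * w s) (Icc 0 ℓ) := (hin _).const_smul (w 0)
  have hpos : ∀ s ∈ Icc 0 ℓ, 0 < w 0 * w s := by
    intro s hs
    by_contra hcon
    have hpre := isPreconnected_Icc.intermediate_value hs h0mem hwc
    obtain ⟨r, hr, hr'⟩ := hpre ⟨not_lt.1 hcon, mul_self_nonneg _⟩
    exact mul_ne_zero (hnorm 0 h0mem) (hnorm r hr) hr'
  have := intervalIntegral.integral_pos hℓ hwc
    (fun s hs => (hpos s (Ioc_subset_Icc_self hs)).le) ⟨0, h0mem, hpos 0 h0mem⟩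
  rw [intervalIntegral.integral_const_mul, hwint, mul_zero] at this
  exact lt_irrefl _ this

theorem norm_exp_sub_exp_sub_le {a b r : ℝ} (ha : |a| ≤ r) (hb : |b| ≤ r) :
    ‖Complex.exp (a * Complex.I) - Complex.exp (b * Complex.I) - ((a - b : ℝ) : ℂ) * Complex.I‖ ≤
      r * |a - b| := by
  set f : ℝ → ℂ := fun x => Complex.exp (x * Complex.I) - x * Complex.I with hf
  have hd : ∀ x : ℝ, HasDerivAt f ((Complex.exp (x * Complex.I) - 1) * Complex.I) x := by
    intro x
    have h1 : HasDerivAt (fun x : ℝ => (x : ℂ) * Complex.I) (1 * Complex.I) x :=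
      (Complex.ofRealCLM.hasDerivAt (x := x)).mul_const Complex.I
    have h2 := h1.cexp.fun_sub h1
    have e : Complex.exp (x * Complex.I) * (1 * Complex.I) - 1 * Complex.I =
        (Complex.exp (x * Complex.I) - 1) * Complex.I := by ring
    rwa [e] at h2
  have hbound : ∀ x ∈ Icc (-r) r, ‖(Complex.exp (x * Complex.I) - 1) * Complex.I‖ ≤ r := by
    intro x hx
    rw [norm_mul, Complex.norm_I, mul_one, mul_comm]
    exact Real.norm_exp_I_mul_ofReal_sub_one_le.trans (abs_le.2 hx)
  have := (convex_Icc (-r) r).norm_image_sub_le_of_norm_hasDerivWithin_le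
    (fun x _ => (hd x).hasDerivWithinAt) hbound (abs_le.1 hb) (abs_le.1 ha)
  have e : f a - f b = Complex.exp (a * Complex.I) - Complex.exp (b * Complex.I) -
      ((a - b : ℝ) : ℂ) * Complex.I := by
    simp only [hf]
    push_cast
    ring
  rwa [Real.norm_eq_abs, e] at this

/-- A small rotation `u₀` of the tangent of a closed curve `γ` can be corrected by a rotation of
the form `⟨p, ∂ₛγ⟩`, with `p` of the order of the perturbation, such that the result has mean zero,
i.e. is again the tangent of a closed curve. -/
theorem exists_closing_correction (hℓ : 0 < ℓ) (hγ : IsClosedH2Curve ℓ γ) :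
    ∃ C θ₀ : ℝ, 0 ≤ C ∧ 0 < θ₀ ∧ ∀ u₀ : ℝ → ℝ, ContinuousOn u₀ (Icc 0 ℓ) →
      ∫ s in (0)..ℓ, ‖Complex.exp (u₀ s * Complex.I) - 1‖ ≤ θ₀ →
      ∃ p : ℂ, ‖p‖ ≤ C * ∫ s in (0)..ℓ, ‖Complex.exp (u₀ s * Complex.I) - 1‖ ∧
        ∫ s in (0)..ℓ, toC (tangent ℓ γ s) *
          Complex.exp ((u₀ s + inner ℝ p (toC (tangent ℓ γ s)) : ℝ) * Complex.I) = 0 := by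
  set T : ℝ → ℂ := fun s => toC (tangent ℓ γ s) with hTdef
  have hT : ContinuousOn T (uIcc 0 ℓ) := by
    rw [uIcc_of_le hℓ.le]
    exact toC.continuous.comp_continuousOn (hγ.continuousOn_tangent hℓ)
  have hTn : ∀ s ∈ Icc 0 ℓ, ‖T s‖ = 1 := fun s hs => by
    simp only [hTdef]
    rw [toC.norm_map, hγ.unitSpeed s hs]
  have hin : ∀ q : ℂ, ContinuousOn (fun s => inner ℝ q (T s)) (uIcc 0 ℓ) :=
    fun q => continuousOn_const.inner hT
  have hinb : ∀ (q : ℂ), ∀ s ∈ Icc 0 ℓ, |inner ℝ q (T s)| ≤ ‖q‖ := fun q s hs => by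
    have := abs_real_inner_le_norm q (T s)
    rwa [hTn s hs, mul_one] at this
  have hgi : ∀ q : ℂ, IntervalIntegrable (fun s => inner ℝ q (T s) • T s) volume 0 ℓ :=
    fun q => ((hin q).smul hT).intervalIntegrable
  -- the derivative at `q = 0` of the closing defect `q ↦ ∫ ∂ₛγ e^{i (u₀ + ⟨q, ∂ₛγ⟩)}` for `u₀ = 0`
  set A₀ : ℂ →ₗ[ℝ] ℂ :=
    { toFun := fun q => Complex.I * ∫ s in (0)..ℓ, inner ℝ q (T s) • T s
      map_add' := fun q₁ q₂ => by
        rw [← mul_add, ← intervalIntegral.integral_add (hgi q₁) (hgi q₂)]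
        simp_rw [inner_add_left, add_smul]
      map_smul' := fun a q => by
        simp_rw [inner_smul_left, mul_smul]
        rw [intervalIntegral.integral_smul, conj_trivial, RingHom.id_apply, Complex.real_smul,
          Complex.real_smul]
        ring } with hA₀
  set A : ℂ →L[ℝ] ℂ := LinearMap.toContinuousLinearMap A₀ with hA
  have hAapp : ∀ q, A q = Complex.I * ∫ s in (0)..ℓ, inner ℝ q (T s) • T s := fun q => rfl
  have hinj : Function.Injective A₀ := by
    rw [← LinearMap.ker_eq_bot, LinearMap.ker_eq_bot']
    intro q hq
    exact eq_zero_of_integral_inner_smul hℓ hγ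
      ((mul_eq_zero.1 hq).resolve_left Complex.I_ne_zero)
  have hsurj : A.range = ⊤ := LinearMap.range_eq_top.2 (LinearMap.injective_iff_surjective.1 hinj)
  set R := A.nonlinearRightInverseOfSurjective hsurj with hR
  have hν : 0 < R.nnnorm := A.nonlinearRightInverseOfSurjective_nnnorm_pos hsurj
  obtain ⟨ν, hνdef⟩ : ∃ ν : ℝ, ν = NNReal.toReal R.nnnorm := ⟨_, rfl⟩
  have hν' : 0 < ν := hνdef ▸ NNReal.coe_pos.2 hν
  refine ⟨2 * ν, ν⁻¹ / (2 * (2 * ν * ℓ + 1)), by positivity, by positivity, ?_⟩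
  intro u₀ hu₀ hθ
  have hu₀' : ContinuousOn u₀ (uIcc 0 ℓ) := by rwa [uIcc_of_le hℓ.le]
  set θ := ∫ s in (0)..ℓ, ‖Complex.exp (u₀ s * Complex.I) - 1‖ with hθdef
  have hcexp : ∀ {f : ℝ → ℝ}, ContinuousOn f (uIcc 0 ℓ) →
      ContinuousOn (fun s => Complex.exp (f s * Complex.I)) (uIcc 0 ℓ) := fun hf =>
    ((Complex.continuous_ofReal.comp_continuousOn hf).mul continuousOn_const).cexp
  have hθ0 : 0 ≤ θ := intervalIntegral.integral_nonneg hℓ.le fun s _ => norm_nonneg _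
  set Φ : ℂ → ℂ := fun q => ∫ s in (0)..ℓ,
    T s * Complex.exp ((u₀ s + inner ℝ q (T s) : ℝ) * Complex.I) with hΦ
  have hΦi : ∀ q : ℂ, IntervalIntegrable
      (fun s => T s * Complex.exp ((u₀ s + inner ℝ q (T s) : ℝ) * Complex.I)) volume 0 ℓ :=
    fun q => (hT.mul (hcexp (hu₀'.add (hin q)))).intervalIntegrable
  have hθi : IntervalIntegrable (fun s => ‖Complex.exp (u₀ s * Complex.I) - 1‖) volume 0 ℓ :=
    ((hcexp hu₀').sub continuousOn_const).norm.intervalIntegrable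
  set r : ℝ := 2 * ν * θ with hr
  have hr0 : 0 ≤ r := by positivity
  have hc0 : 0 ≤ r * ℓ + θ := by positivity
  -- for small `u₀` the defect is, in the `C¹` sense, close to its linearization `A`, so that it is
  -- still onto a neighbourhood of `0`
  have happrox : ApproximatesLinearOn Φ A (Metric.closedBall 0 r) (NNReal.mk (r * ℓ + θ) hc0) := by
    intro p hp q hq
    rw [mem_closedBall_zero_iff] at hp hq
    have e1 : Φ p - Φ q - A (p - q) = ∫ s in (0)..ℓ,
        (T s * Complex.exp ((u₀ s + inner ℝ p (T s) : ℝ) * Complex.I) -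
        T s * Complex.exp ((u₀ s + inner ℝ q (T s) : ℝ) * Complex.I) -
          Complex.I * (inner ℝ (p - q) (T s) • T s)) := by
      rw [intervalIntegral.integral_sub ((hΦi p).sub (hΦi q)) ((hgi _).const_mul _),
        intervalIntegral.integral_sub (hΦi p) (hΦi q), intervalIntegral.integral_const_mul, hAapp]
    have e2 : ∫ s in (0)..ℓ, (r * ‖p - q‖ + ‖Complex.exp (u₀ s * Complex.I) - 1‖ * ‖p - q‖) =
        (r * ℓ + θ) * ‖p - q‖ := by
      rw [intervalIntegral.integral_add intervalIntegrable_const (hθi.mul_const _),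
        intervalIntegral.integral_const, intervalIntegral.integral_mul_const _ (fun s =>
          ‖Complex.exp (u₀ s * Complex.I) - 1‖), ← hθdef]
      simp only [sub_zero, smul_eq_mul]
      ring
    rw [e1]
    refine (intervalIntegral.norm_integral_le_of_norm_le hℓ.le (Eventually.of_forall fun s hs => ?_)
      (intervalIntegrable_const.add (hθi.mul_const _))).trans_eq e2
    have hs' := Ioc_subset_Icc_self hs
    set a := inner ℝ p (T s) with ha
    set b := inner ℝ q (T s) with hb
    have hab : inner ℝ (p - q) (T s) = a - b := inner_sub_left _ _ _
    have hfac : T s * Complex.exp ((u₀ s + a : ℝ) * Complex.I) -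
        T s * Complex.exp ((u₀ s + b : ℝ) * Complex.I) - Complex.I * ((a - b) • T s) =
        T s * (Complex.exp (u₀ s * Complex.I) * (Complex.exp (a * Complex.I) -
          Complex.exp (b * Complex.I) - ((a - b : ℝ) : ℂ) * Complex.I) +
          (Complex.exp (u₀ s * Complex.I) - 1) * (((a - b : ℝ) : ℂ) * Complex.I)) := by
      rw [Complex.real_smul]
      push_cast
      rw [add_mul, add_mul, Complex.exp_add, Complex.exp_add]
      ring
    rw [hab, hfac, norm_mul, hTn s hs', one_mul]
    have hle : |a - b| ≤ ‖p - q‖ := hab ▸ hinb (p - q) s hs'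
    refine (norm_add_le _ _).trans (add_le_add ?_ ?_)
    · rw [norm_mul, Complex.norm_exp_ofReal_mul_I, one_mul]
      exact (norm_exp_sub_exp_sub_le ((hinb p s hs').trans hp) ((hinb q s hs').trans hq)).trans
        (mul_le_mul_of_nonneg_left hle hr0)
    · rw [norm_mul, norm_mul, Complex.norm_I, mul_one, Complex.norm_real, Real.norm_eq_abs]
      exact mul_le_mul_of_nonneg_left hle (norm_nonneg _)
  have hS := happrox.surjOn_closedBall_of_nonlinearRightInverse R hr0 Subset.rfl
  rw [← hνdef, NNReal.coe_mk] at hS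
  have hcle : r * ℓ + θ ≤ ν⁻¹ / 2 := by
    have h1 : r * ℓ + θ = θ * (2 * ν * ℓ + 1) := by rw [hr]; ring
    have h2 : 0 < 2 * ν * ℓ + 1 := by positivity
    rw [h1]
    calc θ * (2 * ν * ℓ + 1) ≤ ν⁻¹ / (2 * (2 * ν * ℓ + 1)) * (2 * ν * ℓ + 1) :=
          mul_le_mul_of_nonneg_right hθ h2.le
      _ = ν⁻¹ / 2 := by field_simp
  have hΦ0 : ‖Φ 0‖ ≤ θ := by
    have h1 : Φ 0 = ∫ s in (0)..ℓ, T s * (Complex.exp (u₀ s * Complex.I) - 1) := by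
      have h2 : ∫ s in (0)..ℓ, T s = 0 := integral_toC_tangent hℓ hγ
      simp only [hΦ, inner_zero_left, add_zero, mul_sub, mul_one]
      have h3 : IntervalIntegrable (fun s => T s * Complex.exp (u₀ s * Complex.I)) volume 0 ℓ :=
        (hT.mul (hcexp hu₀')).intervalIntegrable
      rw [intervalIntegral.integral_sub h3 hT.intervalIntegrable, h2, sub_zero]
    rw [h1]
    refine intervalIntegral.norm_integral_le_of_norm_le hℓ.le (Eventually.of_forall fun s hs => ?_)
      hθi
    rw [norm_mul, hTn s (Ioc_subset_Icc_self hs), one_mul]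
  have hmem : (0 : ℂ) ∈ Metric.closedBall (Φ 0) ((ν⁻¹ - (r * ℓ + θ)) * r) := by
    rw [mem_closedBall_iff_norm, zero_sub, norm_neg]
    refine hΦ0.trans ?_
    have h1 : θ = ν⁻¹ / 2 * r := by rw [hr]; field_simp
    calc θ = ν⁻¹ / 2 * r := h1
      _ ≤ _ := mul_le_mul_of_nonneg_right (by linarith) hr0
  obtain ⟨p, hp, hp'⟩ := hS hmem
  exact ⟨p, by rwa [mem_closedBall_zero_iff] at hp, hp'⟩

/-! ### The optimal transition profile -/

/-- The optimal profile of the transition from the well `0` to the well `2π`: the solution of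
`U' = 2 |sin (U / 2)|` with `U(0) = π`. -/
def profile (x : ℝ) : ℝ := 4 * Real.arctan (Real.exp x)

theorem inv_cosh_pos (x : ℝ) : 0 < (Real.cosh x)⁻¹ := inv_pos.2 (Real.cosh_pos x)

theorem continuous_inv_cosh : Continuous fun x : ℝ => (Real.cosh x)⁻¹ :=
  Real.continuous_cosh.inv₀ fun x => (Real.cosh_pos x).ne'

theorem inv_cosh_eq (x : ℝ) :
    (Real.cosh x)⁻¹ = 2 * Real.exp x / (1 + Real.exp x ^ 2) := by
  rw [Real.cosh_eq, Real.exp_neg]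
  have := Real.exp_pos x
  field_simp
  ring

theorem hasDerivAt_profile (x : ℝ) : HasDerivAt profile (2 * (Real.cosh x)⁻¹) x := by
  have h := ((Real.hasDerivAt_exp x).arctan).const_mul 4
  have e : 4 * (1 / (1 + Real.exp x ^ 2) * Real.exp x) = 2 * (Real.cosh x)⁻¹ := by
    rw [inv_cosh_eq]; ring
  rwa [e] at h

theorem sin_half_profile (x : ℝ) : Real.sin (profile x / 2) = (Real.cosh x)⁻¹ := by
  have h1 : profile x / 2 = 2 * Real.arctan (Real.exp x) := by rw [profile]; ring
  have h2 : √(1 + Real.exp x ^ 2) ^ 2 = 1 + Real.exp x ^ 2 := Real.sq_sqrt (by positivity)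
  rw [h1, Real.sin_two_mul, Real.sin_arctan, Real.cos_arctan, inv_cosh_eq]
  conv_rhs => rw [← h2]
  ring

theorem profile_nonneg (x : ℝ) : 0 ≤ profile x :=
  mul_nonneg (by norm_num) (Real.arctan_nonneg.2 (Real.exp_pos x).le)

theorem profile_le_two_pi (x : ℝ) : profile x ≤ 2 * Real.pi := by
  have := (Real.arctan_lt_pi_div_two (Real.exp x)).le
  rw [profile]; linarith

theorem profile_neg (x : ℝ) : profile (-x) = 2 * Real.pi - profile x := by
  rw [profile, profile, Real.exp_neg, Real.arctan_inv_of_pos (Real.exp_pos x)]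
  ring

theorem profile_le_exp (x : ℝ) : profile x ≤ 4 * Real.exp x := by
  have h : Real.arctan (Real.exp x) ≤ Real.exp x := by
    have h0 := Real.arctan_nonneg.2 (Real.exp_pos x).le
    have := Real.le_tan h0 (Real.arctan_lt_pi_div_two _)
    rwa [Real.tan_arctan] at this
  rw [profile]; linarith

theorem hasDerivAt_profile_scaled {w : ℝ} (p s : ℝ) :
    HasDerivAt (fun s => profile ((s - p) / w)) (2 / w * (Real.cosh ((s - p) / w))⁻¹) s := by
  have h1 : HasDerivAt (fun s : ℝ => (s - p) / w) (1 / w) s :=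
    ((hasDerivAt_id s).sub_const p).div_const w
  have h := (hasDerivAt_profile ((s - p) / w)).comp s h1
  have e : 2 * (Real.cosh ((s - p) / w))⁻¹ * (1 / w) = 2 / w * (Real.cosh ((s - p) / w))⁻¹ := by
    ring
  rw [e] at h
  exact h

theorem continuous_inv_cosh_scaled (p w : ℝ) :
    Continuous fun s : ℝ => (Real.cosh ((s - p) / w))⁻¹ :=
  continuous_inv_cosh.comp ((continuous_id.sub continuous_const).div_const w)

theorem integral_profile_deriv {w : ℝ} (p a b : ℝ) :
    ∫ s in a..b, 2 / w * (Real.cosh ((s - p) / w))⁻¹ =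
      profile ((b - p) / w) - profile ((a - p) / w) :=
  intervalIntegral.integral_eq_sub_of_hasDerivAt (fun s _ => hasDerivAt_profile_scaled p s)
    ((continuous_inv_cosh_scaled p w).const_mul _ |>.intervalIntegrable _ _)

theorem integral_inv_cosh_le {w : ℝ} (hw : 0 < w) (p a b : ℝ) :
    ∫ s in a..b, (Real.cosh ((s - p) / w))⁻¹ ≤ Real.pi * w := by
  have h := integral_profile_deriv (w := w) p a b
  rw [intervalIntegral.integral_const_mul] at h
  have h1 := profile_le_two_pi ((b - p) / w)
  have h2 := profile_nonneg ((a - p) / w)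
  have h3 : ∫ s in a..b, (Real.cosh ((s - p) / w))⁻¹ =
      w / 2 * (profile ((b - p) / w) - profile ((a - p) / w)) := by
    rw [← h]; field_simp
  rw [h3]
  calc w / 2 * (profile ((b - p) / w) - profile ((a - p) / w)) ≤ w / 2 * (2 * Real.pi) := by
        gcongr; linarith
    _ = Real.pi * w := by ring

theorem integral_inv_cosh_sq_le {w : ℝ} (hw : 0 < w) (p a b : ℝ) :
    ∫ s in a..b, (Real.cosh ((s - p) / w))⁻¹ * (Real.cosh ((s - p) / w))⁻¹ ≤ 2 * w := by
  have hd : ∀ s, HasDerivAt (fun s => w * (Real.sinh ((s - p) / w) / Real.cosh ((s - p) / w)))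
      ((Real.cosh ((s - p) / w))⁻¹ * (Real.cosh ((s - p) / w))⁻¹) s := by
    intro s
    have h1 : HasDerivAt (fun s : ℝ => (s - p) / w) (1 / w) s :=
      ((hasDerivAt_id s).sub_const p).div_const w
    have hc := (Real.cosh_pos ((s - p) / w)).ne'
    have h2 := (h1.sinh.fun_div h1.cosh hc).const_mul w
    have e : w * ((Real.cosh ((s - p) / w) * (1 / w) * Real.cosh ((s - p) / w) -
        Real.sinh ((s - p) / w) * (Real.sinh ((s - p) / w) * (1 / w))) /
          Real.cosh ((s - p) / w) ^ 2) =
        (Real.cosh ((s - p) / w))⁻¹ * (Real.cosh ((s - p) / w))⁻¹ := by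
      have h3 := Real.cosh_sq ((s - p) / w)
      field_simp
      linarith
    rwa [e] at h2
  have hc := continuous_inv_cosh_scaled p w
  rw [intervalIntegral.integral_eq_sub_of_hasDerivAt (fun s _ => hd s)
    ((hc.mul hc).intervalIntegrable _ _), ← Real.tanh_eq_sinh_div_cosh,
    ← Real.tanh_eq_sinh_div_cosh]
  have h1 := (Real.tanh_lt_one ((b - p) / w)).le
  have h2 := (Real.neg_one_lt_tanh ((a - p) / w)).le
  nlinarith

theorem inv_cosh_mul_le (x y : ℝ) :
    (Real.cosh x)⁻¹ * (Real.cosh y)⁻¹ ≤ 4 * Real.exp (-|x - y|) := by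
  have h1 : Real.exp |x - y| ≤ 2 * Real.cosh (x - y) := by
    rw [← Real.cosh_abs, Real.cosh_eq]
    linarith [Real.exp_pos (-|x - y|)]
  have h2 : Real.cosh (x - y) ≤ 2 * (Real.cosh x * Real.cosh y) := by
    have h3 := Real.cosh_pos (x + y)
    rw [Real.cosh_add] at h3
    rw [Real.cosh_sub]
    linarith
  have hx := Real.cosh_pos x
  have hy := Real.cosh_pos y
  rw [← mul_inv, Real.exp_neg, ← div_eq_mul_inv, inv_eq_one_div,
    div_le_div_iff₀ (by positivity) (Real.exp_pos _)]
  linarith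

theorem abs_mul_inv_cosh_le (y : ℝ) : |y| * (Real.cosh y)⁻¹ ≤ (Real.cosh (y / 2))⁻¹ := by
  have h1 : |y| * Real.cosh (y / 2) ≤ Real.cosh y := by
    have h2 : |y| / 2 ≤ Real.sinh (|y| / 2) := Real.self_le_sinh_iff.2 (by positivity)
    have h3 : Real.cosh (y / 2) = Real.cosh (|y| / 2) := by
      rw [← Real.cosh_abs, abs_div, abs_two]
    have h4 : Real.cosh y = Real.cosh (2 * (|y| / 2)) := by
      rw [← Real.cosh_abs]; congr 1; ring
    have h5 := Real.cosh_pos (|y| / 2)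
    rw [h3, h4, Real.cosh_two_mul]
    nlinarith [sq_nonneg (Real.cosh (|y| / 2) - Real.sinh (|y| / 2))]
  have hy := Real.cosh_pos y
  have hy2 := Real.cosh_pos (y / 2)
  rw [← div_eq_mul_inv, inv_eq_one_div, div_le_div_iff₀ hy hy2]
  linarith

/-- A single transition in the interior of `[0, ℓ]` acts on test functions like a Dirac mass. -/
theorem abs_integral_profile_deriv_sub_le {φ : ℝ → ℝ} (hφ : IsFlatTest ℓ φ) {w d p s₀ : ℝ}
    (hw : 0 < w) (hd : 0 < d) (hp : d ≤ p) (hp' : p + d ≤ ℓ) (hs₀ : s₀ ∈ Icc 0 ℓ) :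
    |(∫ s in (0)..ℓ, φ s * (2 / w * (Real.cosh ((s - p) / w))⁻¹)) - 2 * Real.pi * φ s₀| ≤
      4 * Real.pi * w + 8 * Real.exp (-(d / w)) + 2 * Real.pi * |p - s₀| := by
  have hℓ : 0 < ℓ := by linarith
  have hpm : p ∈ Icc 0 ℓ := ⟨by linarith, by linarith⟩
  have hφc : ContinuousOn φ (uIcc 0 ℓ) := by rw [uIcc_of_le hℓ.le]; exact hφ.continuousOn
  have hlip : ∀ x ∈ Icc 0 ℓ, ∀ y ∈ Icc 0 ℓ, |φ x - φ y| ≤ |x - y| := fun x hx y hy => by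
    simpa [Real.dist_eq] using hφ.lipschitzOnWith.dist_le_mul x hx y hy
  have hk := ((continuous_inv_cosh_scaled p w).const_mul (2 / w)).continuousOn (s := uIcc 0 ℓ)
  have i1 : IntervalIntegrable (fun s => φ s * (2 / w * (Real.cosh ((s - p) / w))⁻¹)) volume 0 ℓ :=
    (hφc.mul hk).intervalIntegrable
  have i2 : IntervalIntegrable (fun s => φ p * (2 / w * (Real.cosh ((s - p) / w))⁻¹)) volume 0 ℓ :=
    (continuousOn_const.mul hk).intervalIntegrable
  have e : (∫ s in (0)..ℓ, φ s * (2 / w * (Real.cosh ((s - p) / w))⁻¹)) - 2 * Real.pi * φ s₀ =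
      (∫ s in (0)..ℓ, (φ s * (2 / w * (Real.cosh ((s - p) / w))⁻¹) -
        φ p * (2 / w * (Real.cosh ((s - p) / w))⁻¹))) +
      φ p * (profile ((ℓ - p) / w) - profile ((0 - p) / w) - 2 * Real.pi) +
      2 * Real.pi * (φ p - φ s₀) := by
    rw [intervalIntegral.integral_sub i1 i2, intervalIntegral.integral_const_mul (φ p),
      integral_profile_deriv]
    ring
  have b1 : |∫ s in (0)..ℓ, (φ s * (2 / w * (Real.cosh ((s - p) / w))⁻¹) -
        φ p * (2 / w * (Real.cosh ((s - p) / w))⁻¹))| ≤ 4 * Real.pi * w := by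
    have hc2 := continuous_inv_cosh_scaled p (2 * w)
    have h1 : ∫ s in (0)..ℓ, 2 * (Real.cosh ((s - p) / (2 * w)))⁻¹ ≤ 4 * Real.pi * w := by
      rw [intervalIntegral.integral_const_mul]
      have := integral_inv_cosh_le (w := 2 * w) (by positivity) p 0 ℓ
      linarith
    rw [← Real.norm_eq_abs]
    refine (intervalIntegral.norm_integral_le_of_norm_le hℓ.le (Eventually.of_forall fun s hs => ?_)
      ((hc2.const_mul 2).intervalIntegrable _ _)).trans h1
    have hs' := Ioc_subset_Icc_self hs
    have h2 : |φ s - φ p| ≤ w * |(s - p) / w| := by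
      rw [abs_div, abs_of_pos hw, mul_div_cancel₀ _ hw.ne']
      exact hlip s hs' p hpm
    have h3 := abs_mul_inv_cosh_le ((s - p) / w)
    have h4 : (s - p) / w / 2 = (s - p) / (2 * w) := by rw [div_div, mul_comm w 2]
    have h5 := inv_cosh_pos ((s - p) / w)
    rw [h4] at h3
    rw [← sub_mul, Real.norm_eq_abs, abs_mul, abs_of_pos (by positivity : 0 <
      2 / w * (Real.cosh ((s - p) / w))⁻¹)]
    calc |φ s - φ p| * (2 / w * (Real.cosh ((s - p) / w))⁻¹)
        ≤ (w * |(s - p) / w|) * (2 / w * (Real.cosh ((s - p) / w))⁻¹) := by gcongr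
      _ = 2 * (|(s - p) / w| * (Real.cosh ((s - p) / w))⁻¹) := by field_simp
      _ ≤ _ := by linarith
  have b2 : |φ p * (profile ((ℓ - p) / w) - profile ((0 - p) / w) - 2 * Real.pi)| ≤
      8 * Real.exp (-(d / w)) := by
    have h1 : profile ((ℓ - p) / w) - 2 * Real.pi = -profile (-((ℓ - p) / w)) := by
      rw [profile_neg]; ring
    have h2 : profile (-((ℓ - p) / w)) ≤ 4 * Real.exp (-(d / w)) := by
      refine (profile_le_exp _).trans ?_
      gcongr
      linarith
    have h3 : profile ((0 - p) / w) ≤ 4 * Real.exp (-(d / w)) := by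
      refine (profile_le_exp _).trans ?_
      rw [zero_sub, neg_div]
      gcongr
    have h4 := profile_nonneg (-((ℓ - p) / w))
    have h5 := profile_nonneg ((0 - p) / w)
    rw [abs_mul]
    calc |φ p| * |profile ((ℓ - p) / w) - profile ((0 - p) / w) - 2 * Real.pi|
        ≤ 1 * (8 * Real.exp (-(d / w))) := by
          refine mul_le_mul (hφ.abs_le hpm) ?_ (abs_nonneg _) zero_le_one
          rw [abs_le]
          constructor <;> linarith
      _ = _ := one_mul _
  have b3 : |2 * Real.pi * (φ p - φ s₀)| ≤ 2 * Real.pi * |p - s₀| := by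
    rw [abs_mul, abs_of_pos Real.two_pi_pos]
    exact mul_le_mul_of_nonneg_left (hlip p hpm s₀ hs₀) Real.two_pi_pos.le
  rw [e]
  exact (abs_add_three _ _ _).trans (by linarith)

/-! ### Superposition of separated transitions -/

/-- Superposition of transitions of width `w`, sign `σ i` and center `p i`. -/
def transitions {ι : Type*} [Fintype ι] (w : ℝ) (p : ι → ℝ) (σ : ι → ℤ) (s : ℝ) : ℝ :=
  ∑ i, σ i * profile ((s - p i) / w)

/-- The derivative of `transitions w p σ`. -/
def transitionsDeriv {ι : Type*} [Fintype ι] (w : ℝ) (p : ι → ℝ) (σ : ι → ℤ) (s : ℝ) : ℝ :=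
  ∑ i, σ i * (2 / w * (Real.cosh ((s - p i) / w))⁻¹)

/-- The sum of the moduli of `sin (U / 2)` over the single transitions `U`. -/
def transitionsBound {ι : Type*} [Fintype ι] (w : ℝ) (p : ι → ℝ) (s : ℝ) : ℝ :=
  ∑ i, (Real.cosh ((s - p i) / w))⁻¹

theorem abs_sin_sum_le {ι : Type*} (t : Finset ι) (x : ι → ℝ) :
    |Real.sin (∑ i ∈ t, x i)| ≤ ∑ i ∈ t, |Real.sin (x i)| := by
  classical
  induction t using Finset.induction_on with
  | empty => simp
  | insert a t ha ih =>
    rw [Finset.sum_insert ha, Finset.sum_insert ha, Real.sin_add]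
    refine (abs_add_le _ _).trans (add_le_add ?_ ?_)
    · rw [abs_mul]
      exact mul_le_of_le_one_right (abs_nonneg _) (Real.abs_cos_le_one _)
    · rw [abs_mul]
      exact (mul_le_of_le_one_left (abs_nonneg _) (Real.abs_cos_le_one _)).trans ih

section Transitions

variable {ι : Type*} [Fintype ι] {w d : ℝ} {p : ι → ℝ} {σ : ι → ℤ}

theorem hasDerivAt_transitions (s : ℝ) :
    HasDerivAt (transitions w p σ) (transitionsDeriv w p σ s) s :=
  HasDerivAt.fun_sum fun i _ => (hasDerivAt_profile_scaled (p i) s).const_mul (σ i : ℝ)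

theorem continuous_transitionsDeriv : Continuous (transitionsDeriv w p σ) :=
  continuous_finsetSum _ fun i _ =>
    ((continuous_inv_cosh_scaled (p i) w).const_mul _).const_mul _

theorem continuous_transitionsBound : Continuous (transitionsBound w p) :=
  continuous_finsetSum _ fun i _ => continuous_inv_cosh_scaled (p i) w

theorem contDiff_transitions : ContDiff ℝ 1 (transitions w p σ) := by
  rw [contDiff_one_iff_deriv]
  refine ⟨fun s => (hasDerivAt_transitions s).differentiableAt, ?_⟩
  have : deriv (transitions w p σ) = transitionsDeriv w p σ :=
    funext fun s => (hasDerivAt_transitions s).deriv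
  rw [this]
  exact continuous_transitionsDeriv

theorem transitionsBound_nonneg (s : ℝ) : 0 ≤ transitionsBound w p s :=
  Finset.sum_nonneg fun _ _ => (inv_cosh_pos _).le

theorem abs_transitionsDeriv_le (hw : 0 < w) (hσ : ∀ i, |σ i| = 1) (s : ℝ) :
    |transitionsDeriv w p σ s| ≤ 2 / w * transitionsBound w p s := by
  rw [transitionsBound, Finset.mul_sum]
  refine (Finset.abs_sum_le_sum_abs _ _).trans (Finset.sum_le_sum fun i _ => ?_)
  have h : |(σ i : ℝ)| = 1 := by exact_mod_cast hσ i
  have h5 := inv_cosh_pos ((s - p i) / w)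
  rw [abs_mul, h, one_mul, abs_of_pos (by positivity)]

theorem abs_sin_half_transitions_le (hσ : ∀ i, |σ i| = 1) (s : ℝ) :
    |Real.sin (transitions w p σ s / 2)| ≤ transitionsBound w p s := by
  rw [transitions, Finset.sum_div]
  refine (abs_sin_sum_le _ _).trans (Finset.sum_le_sum fun i _ => ?_)
  have h : σ i = 1 ∨ σ i = -1 := eq_or_eq_neg_of_abs_eq (hσ i)
  have h1 := sin_half_profile ((s - p i) / w)
  have h2 := inv_cosh_pos ((s - p i) / w)
  rcases h with h | h
  · rw [h, Int.cast_one, one_mul, h1, abs_of_pos h2]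
  · rw [h, Int.cast_neg, Int.cast_one, neg_one_mul, neg_div, Real.sin_neg, h1, abs_neg,
      abs_of_pos h2]

theorem integral_transitionsBound_le (hw : 0 < w) (a b : ℝ) :
    ∫ s in a..b, transitionsBound w p s ≤ Fintype.card ι * (Real.pi * w) := by
  simp only [transitionsBound]
  rw [intervalIntegral.integral_finsetSum fun i _ =>
    (continuous_inv_cosh_scaled (p i) w).intervalIntegrable _ _]
  refine (Finset.sum_le_card_nsmul _ _ _ fun i _ => integral_inv_cosh_le hw (p i) a b).trans_eq ?_
  rw [nsmul_eq_mul, Finset.card_univ]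

/-- The interaction between different transitions is exponentially small in their distance. -/
theorem integral_transitionsBound_sq_le (hℓ : 0 < ℓ) (hw : 0 < w)
    (hsep : ∀ i j, i ≠ j → d ≤ |p i - p j|) :
    ∫ s in (0)..ℓ, transitionsBound w p s ^ 2 ≤
      2 * Fintype.card ι * w + 4 * ℓ * Fintype.card ι ^ 2 * Real.exp (-(d / w)) := by
  classical
  have hc := fun i => continuous_inv_cosh_scaled (p i) w
  have hcc : ∀ i j, Continuous fun s =>
      (Real.cosh ((s - p i) / w))⁻¹ * (Real.cosh ((s - p j) / w))⁻¹ := fun i j =>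
    (hc i).mul (hc j)
  have h1 : ∀ s, transitionsBound w p s ^ 2 =
      ∑ i, ∑ j, (Real.cosh ((s - p i) / w))⁻¹ * (Real.cosh ((s - p j) / w))⁻¹ := fun s => by
    rw [transitionsBound, sq, Finset.sum_mul_sum]
  have h2 : ∀ i j, ∫ s in (0)..ℓ, (Real.cosh ((s - p i) / w))⁻¹ * (Real.cosh ((s - p j) / w))⁻¹ ≤
      (if i = j then 2 * w else 0) + 4 * ℓ * Real.exp (-(d / w)) := by
    intro i j
    split_ifs with hij
    · subst hij
      exact (integral_inv_cosh_sq_le hw (p i) 0 ℓ).trans (le_add_of_nonneg_right (by positivity))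
    · rw [zero_add]
      have h3 : ∫ _ in (0)..ℓ, 4 * Real.exp (-(d / w)) = 4 * ℓ * Real.exp (-(d / w)) := by
        rw [intervalIntegral.integral_const, smul_eq_mul]; ring
      rw [← h3]
      refine intervalIntegral.integral_mono_on hℓ.le ((hcc i j).intervalIntegrable _ _)
        intervalIntegrable_const fun s _ => (inv_cosh_mul_le _ _).trans ?_
      have h4 : (s - p i) / w - (s - p j) / w = -(p i - p j) / w := by ring
      rw [h4, abs_div, abs_neg, abs_of_pos hw]
      have := hsep i j hij
      gcongr
  simp only [h1]
  rw [intervalIntegral.integral_finsetSum fun i _ =>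
    (continuous_finsetSum _ fun j _ => hcc i j).intervalIntegrable _ _]
  have h5 : ∀ i, ∫ s in (0)..ℓ, ∑ j, (Real.cosh ((s - p i) / w))⁻¹ * (Real.cosh ((s - p j) / w))⁻¹ ≤
      2 * w + Fintype.card ι * (4 * ℓ * Real.exp (-(d / w))) := by
    intro i
    rw [intervalIntegral.integral_finsetSum fun j _ =>
      (hcc i j).intervalIntegrable _ _]
    refine (Finset.sum_le_sum fun j _ => h2 i j).trans_eq ?_
    rw [Finset.sum_add_distrib, Finset.sum_ite_eq, if_pos (Finset.mem_univ i), Finset.sum_const,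
      nsmul_eq_mul, Finset.card_univ]
  refine (Finset.sum_le_card_nsmul _ _ _ fun i _ => h5 i).trans_eq ?_
  rw [nsmul_eq_mul, Finset.card_univ]
  ring

theorem abs_integral_transitionsDeriv_sub_le {φ : ℝ → ℝ} (hφ : IsFlatTest ℓ φ) {x : ι → ℝ}
    (hσ : ∀ i, |σ i| = 1) (hw : 0 < w) (hd : 0 < d) (hp : ∀ i, d ≤ p i) (hp' : ∀ i, p i + d ≤ ℓ)
    (hx : ∀ i, x i ∈ Icc 0 ℓ) :
    |(∫ s in (0)..ℓ, φ s * transitionsDeriv w p σ s) - 2 * Real.pi * ∑ i, σ i * φ (x i)| ≤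
      ∑ i, (4 * Real.pi * w + 8 * Real.exp (-(d / w)) + 2 * Real.pi * |p i - x i|) := by
  have hφc : ∀ i, IntervalIntegrable
      (fun s => φ s * (2 / w * (Real.cosh ((s - p i) / w))⁻¹)) volume 0 ℓ := fun i => by
    have hℓ : 0 < ℓ := by linarith [hp i, hp' i]
    refine ContinuousOn.intervalIntegrable ?_
    rw [uIcc_of_le hℓ.le]
    exact hφ.continuousOn.mul ((continuous_inv_cosh_scaled (p i) w).const_mul _).continuousOn
  have e : (∫ s in (0)..ℓ, φ s * transitionsDeriv w p σ s) - 2 * Real.pi * ∑ i, σ i * φ (x i) =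
      ∑ i, σ i * ((∫ s in (0)..ℓ, φ s * (2 / w * (Real.cosh ((s - p i) / w))⁻¹)) -
        2 * Real.pi * φ (x i)) := by
    have h1 : ∀ s, φ s * transitionsDeriv w p σ s =
        ∑ i, σ i * (φ s * (2 / w * (Real.cosh ((s - p i) / w))⁻¹)) := fun s => by
      rw [transitionsDeriv, Finset.mul_sum]
      exact Finset.sum_congr rfl fun i _ => by ring
    simp only [h1]
    rw [intervalIntegral.integral_finsetSum fun i _ => (hφc i).const_mul _, Finset.mul_sum,
      ← Finset.sum_sub_distrib]
    refine Finset.sum_congr rfl fun i _ => ?_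
    rw [intervalIntegral.integral_const_mul]
    ring
  rw [e]
  refine (Finset.abs_sum_le_sum_abs _ _).trans (Finset.sum_le_sum fun i _ => ?_)
  have h : |(σ i : ℝ)| = 1 := by exact_mod_cast hσ i
  rw [abs_mul, h, one_mul]
  exact abs_integral_profile_deriv_sub_le hφ hw hd (hp i) (hp' i) (hx i)

/-- Truncated to `[0, ℓ]`, the transitions miss their total increment `2π ∑ᵢ σᵢ` only by an
exponentially small amount. -/
theorem abs_transitions_sub_le (hσ : ∀ i, |σ i| = 1) (hw : 0 < w)
    (hp : ∀ i, d ≤ p i) (hp' : ∀ i, p i + d ≤ ℓ) :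
    |2 * Real.pi * ((∑ i, σ i : ℤ) : ℝ) - (transitions w p σ ℓ - transitions w p σ 0)| ≤
      8 * Fintype.card ι * Real.exp (-(d / w)) := by
  have e : 2 * Real.pi * ((∑ i, σ i : ℤ) : ℝ) - (transitions w p σ ℓ - transitions w p σ 0) =
      ∑ i, σ i * (profile (-((ℓ - p i) / w)) + profile ((0 - p i) / w)) := by
    simp only [transitions]
    rw [Int.cast_sum, Finset.mul_sum, ← Finset.sum_sub_distrib, ← Finset.sum_sub_distrib]
    refine Finset.sum_congr rfl fun i _ => ?_
    rw [profile_neg]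
    ring
  rw [e]
  have h1 : ∀ i, |σ i * (profile (-((ℓ - p i) / w)) + profile ((0 - p i) / w))| ≤
      8 * Real.exp (-(d / w)) := by
    intro i
    have h : |(σ i : ℝ)| = 1 := by exact_mod_cast hσ i
    have h2 : profile (-((ℓ - p i) / w)) ≤ 4 * Real.exp (-(d / w)) := by
      refine (profile_le_exp _).trans ?_
      gcongr
      linarith [hp' i]
    have h3 : profile ((0 - p i) / w) ≤ 4 * Real.exp (-(d / w)) := by
      refine (profile_le_exp _).trans ?_
      rw [zero_sub, neg_div]
      gcongr
      exact hp i
    have h4 := profile_nonneg (-((ℓ - p i) / w))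
    have h5 := profile_nonneg ((0 - p i) / w)
    rw [abs_mul, h, one_mul, abs_of_nonneg (by positivity)]
    linarith
  refine (Finset.abs_sum_le_sum_abs _ _).trans
    ((Finset.sum_le_card_nsmul _ _ _ fun i _ => h1 i).trans_eq ?_)
  rw [nsmul_eq_mul, Finset.card_univ]
  ring

end Transitions

/-! ### Closed curves with prescribed transitions -/

/-- A superposition of transitions with small total width is, up to a small correction `v`, the
angle between `γ` and another closed curve. The correction has a linear part, which makes the
increment of the angle an exact multiple of `2π`, and a part `⟨q, ∂ₛγ⟩`, which closes the curve. -/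
theorem exists_curve_of_transitions (hℓ : 0 < ℓ) (hγ : IsClosedC2Curve ℓ γ) :
    ∃ C θ₀ : ℝ, 0 ≤ C ∧ 0 < θ₀ ∧ ∀ {ι : Type} [Fintype ι] {w d θ : ℝ} {p : ι → ℝ} {σ : ι → ℤ},
      0 < w → (∀ i, d ≤ p i) → (∀ i, p i + d ≤ ℓ) → (∀ i, |σ i| = 1) →
      2 * (Fintype.card ι * (Real.pi * w)) + ℓ * (8 * Fintype.card ι * Real.exp (-(d / w))) ≤ θ →
      θ ≤ θ₀ →
      ∃ (η : ℝ → Plane) (v : ℝ → ℝ), IsClosedH2Curve ℓ η ∧ η 0 = γ 0 ∧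
        IsAngle ℓ γ η (fun s => transitions w p σ s + v s) ∧ (∀ s ∈ Icc 0 ℓ, |v s| ≤ C * θ) ∧
        ∀ᵐ s, s ∈ Icc 0 ℓ →
          |curvature ℓ η s - curvature ℓ γ s - transitionsDeriv w p σ s| ≤ C * θ := by
  have hγ' := hγ.isClosedH2Curve hℓ
  have hud : UniqueDiffOn ℝ (Icc 0 ℓ) := uniqueDiffOn_Icc hℓ
  obtain ⟨C, θ₀, hC, hθ₀, hclose⟩ := exists_closing_correction hℓ hγ'
  obtain ⟨B, hB⟩ := isCompact_Icc.exists_bound_of_continuousOn (hγ.continuousOn_curvature hℓ)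
  have hB0 : 0 ≤ B := (norm_nonneg _).trans (hB 0 (left_mem_Icc.2 hℓ.le))
  refine ⟨(1 / ℓ + C) + (1 / ℓ / ℓ + C * B), θ₀, by positivity, hθ₀, ?_⟩
  intro ι _ w d θ p σ hw hp hp' hσ hθ hθ'
  have hθ0 : 0 ≤ θ := le_trans (by positivity) hθ
  set lam : ℝ :=
    2 * Real.pi * ((∑ i, σ i : ℤ) : ℝ) - (transitions w p σ ℓ - transitions w p σ 0) with hlam
  have hlam1 := abs_transitions_sub_le hσ hw hp hp'
  rw [← hlam] at hlam1
  have hlamθ : |lam| ≤ 1 / ℓ * θ := by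
    rw [one_div, ← div_eq_inv_mul, le_div_iff₀ hℓ]
    have h1 : 0 ≤ 2 * (Fintype.card ι * (Real.pi * w)) := by positivity
    have h2 := mul_le_mul_of_nonneg_left hlam1 hℓ.le
    linarith
  set u₀ : ℝ → ℝ := fun s => transitions w p σ s + lam * s / ℓ with hu₀
  have hu₀d : ContDiff ℝ 1 u₀ :=
    contDiff_transitions.add ((contDiff_const.mul contDiff_id).div_const ℓ)
  have hsmall : ∫ s in (0)..ℓ, ‖Complex.exp (u₀ s * Complex.I) - 1‖ ≤ θ := by
    have hc : Continuous fun s => 2 * transitionsBound w p s + |lam| :=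
      (continuous_transitionsBound.const_mul 2).add continuous_const
    have hc1 : Continuous fun s => ‖Complex.exp (u₀ s * Complex.I) - 1‖ := by
      have := hu₀d.continuous
      fun_prop
    calc ∫ s in (0)..ℓ, ‖Complex.exp (u₀ s * Complex.I) - 1‖
        ≤ ∫ s in (0)..ℓ, (2 * transitionsBound w p s + |lam|) := by
          refine intervalIntegral.integral_mono_on hℓ.le (hc1.intervalIntegrable _ _)
            (hc.intervalIntegrable _ _) fun s hs => ?_
          have h1 : |Real.sin (u₀ s / 2)| ≤
              |Real.sin (transitions w p σ s / 2)| + |Real.sin (lam * s / ℓ / 2)| := by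
            have := abs_sin_sum_le Finset.univ ![transitions w p σ s / 2, lam * s / ℓ / 2]
            simpa [hu₀, add_div] using this
          have h2 : |Real.sin (lam * s / ℓ / 2)| ≤ |lam| / 2 := by
            refine Real.abs_sin_le_abs.trans ?_
            rw [abs_div, abs_div, abs_mul, abs_of_pos hℓ, abs_two, abs_of_nonneg hs.1]
            have : |lam| * s / ℓ ≤ |lam| := by
              rw [div_le_iff₀ hℓ]
              exact mul_le_mul_of_nonneg_left hs.2 (abs_nonneg _)
            linarith
          have h3 := abs_sin_half_transitions_le (p := p) (w := w) hσ s
          rw [norm_exp_sub_one]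
          linarith
      _ = 2 * (∫ s in (0)..ℓ, transitionsBound w p s) + ℓ * |lam| := by
          rw [intervalIntegral.integral_add
            ((continuous_transitionsBound.const_mul 2).intervalIntegrable _ _)
            intervalIntegrable_const, intervalIntegral.integral_const_mul,
            intervalIntegral.integral_const, sub_zero, smul_eq_mul]
      _ ≤ θ := by
          refine le_trans ?_ hθ
          gcongr
          exact integral_transitionsBound_le hw 0 ℓ
  obtain ⟨q, hq, hq'⟩ := hclose u₀ hu₀d.continuous.continuousOn (hsmall.trans hθ')
  have hqθ : ‖q‖ ≤ C * θ := hq.trans (mul_le_mul_of_nonneg_left hsmall hC)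
  have hTc : ContDiffOn ℝ 1 (fun s => toC (tangent ℓ γ s)) (Icc 0 ℓ) :=
    toC.toContinuousLinearEquiv.contDiff.comp_contDiffOn
      (hγ.contDiffOn.derivWithin hud (by norm_num))
  set v : ℝ → ℝ := fun s => lam * s / ℓ + inner ℝ q (toC (tangent ℓ γ s)) with hv
  have hue : ∀ s, transitions w p σ s + v s = u₀ s + inner ℝ q (toC (tangent ℓ γ s)) :=
    fun s => by simp only [hv, hu₀]; ring
  have huC : ContDiffOn ℝ 1 (fun s => transitions w p σ s + v s) (Icc 0 ℓ) := by
    simp only [hue]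
    exact hu₀d.contDiffOn.add (contDiffOn_const.inner ℝ hTc)
  have hper : ∃ n : ℤ, (transitions w p σ ℓ + v ℓ) - (transitions w p σ 0 + v 0) =
      2 * Real.pi * n := by
    refine ⟨∑ i, σ i, ?_⟩
    simp only [hv]
    rw [hγ.tangent_closed, mul_div_cancel_right₀ _ hℓ.ne', hlam]
    ring
  obtain ⟨η, hη, hη0, hang⟩ := exists_curve_of_angle hℓ hγ huC hper (by
    simp only [hue]
    exact hq')
  refine ⟨η, v, hη, hη0, hang, fun s hs => ?_, ?_⟩
  · have h1 : |lam * s / ℓ| ≤ |lam| := by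
      rw [abs_div, abs_mul, abs_of_pos hℓ, abs_of_nonneg hs.1, div_le_iff₀ hℓ]
      exact mul_le_mul_of_nonneg_left hs.2 (abs_nonneg _)
    have h2 : |inner ℝ q (toC (tangent ℓ γ s))| ≤ ‖q‖ := by
      have := abs_real_inner_le_norm q (toC (tangent ℓ γ s))
      rwa [toC.norm_map, hγ.unitSpeed s hs, mul_one] at this
    have h3 : 0 ≤ (1 / ℓ / ℓ + C * B) * θ := by positivity
    calc |v s| ≤ |lam * s / ℓ| + |inner ℝ q (toC (tangent ℓ γ s))| := abs_add_le _ _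
      _ ≤ (1 / ℓ + C) * θ := by rw [add_mul]; linarith
      _ ≤ _ := by rw [add_mul _ _ θ]; linarith
  · filter_upwards [hang.ae_hasDerivAt, hγ'.ae_hasDerivAt_tangent] with s h1 h2 hs
    have h1 := h1 hs
    obtain ⟨hs', h2⟩ := h2 hs
    have e2 : HasDerivAt (fun s => toC (tangent ℓ γ s)) (toC (secondDeriv ℓ γ s)) s :=
      toC.toContinuousLinearEquiv.toContinuousLinearMap.hasFDerivAt.comp_hasDerivAt s h2
    have e3 : HasDerivAt (fun s => inner ℝ q (toC (tangent ℓ γ s)))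
        (inner ℝ q (toC (secondDeriv ℓ γ s))) s :=
      (innerSL ℝ q).hasFDerivAt.comp_hasDerivAt s e2
    have e4 : HasDerivAt (fun s => lam * s / ℓ) (lam / ℓ) s := by
      have := ((hasDerivAt_id s).const_mul lam).div_const ℓ
      rwa [mul_one] at this
    have e5 := h1.unique ((hasDerivAt_transitions (w := w) (p := p) (σ := σ) s).fun_add
      (e4.fun_add e3))
    rw [e5, add_sub_cancel_left]
    have b1 : |lam / ℓ| ≤ 1 / ℓ / ℓ * θ := by
      rw [abs_div, abs_of_pos hℓ, div_le_iff₀ hℓ]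
      refine hlamθ.trans_eq ?_
      field_simp
    have b2 : |inner ℝ q (toC (secondDeriv ℓ γ s))| ≤ C * B * θ := by
      have h3 := abs_real_inner_le_norm q (toC (secondDeriv ℓ γ s))
      have h4 : ‖toC (secondDeriv ℓ γ s)‖ ≤ B := by
        rw [toC_secondDeriv_eq hγ.unitSpeed hs' h2]
        simp only [norm_mul, Complex.norm_I, mul_one, Complex.norm_real, toC.norm_map,
          hγ.unitSpeed s hs]
        exact hB s hs
      calc _ ≤ ‖q‖ * ‖toC (secondDeriv ℓ γ s)‖ := h3
        _ ≤ (C * θ) * B := by gcongr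
        _ = _ := by ring
    have h3 : 0 ≤ (1 / ℓ + C) * θ := by positivity
    calc _ ≤ |lam / ℓ| + |inner ℝ q (toC (secondDeriv ℓ γ s))| := abs_add_le _ _
      _ ≤ (1 / ℓ / ℓ + C * B) * θ := by rw [add_mul]; linarith
      _ ≤ _ := by rw [add_mul _ _ θ]; linarith

theorem add_sq_le_of_pos {δ : ℝ} (hδ : 0 < δ) (a b : ℝ) :
    (a + b) ^ 2 ≤ (1 + δ) * a ^ 2 + (1 + 1 / δ) * b ^ 2 := by
  have h : 0 ≤ (δ * a - b) ^ 2 / δ := by positivity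
  have e : (δ * a - b) ^ 2 / δ = δ * a ^ 2 - 2 * a * b + 1 / δ * b ^ 2 := by
    field_simp
    ring
  rw [e] at h
  linarith

/-- For transitions of the optimal width `√2 ε^{1/2}`, where `ε = δ⁴`, the two terms of the energy
are equal up to an error. -/
theorem energy_le_of_transitions (hℓ : 0 < ℓ) (hγ : IsClosedH2Curve ℓ γ)
    (hη : IsClosedH2Curve ℓ η) {ι : Type} [Fintype ι] {δ m B : ℝ} {p : ι → ℝ} {σ : ι → ℤ}
    {v : ℝ → ℝ} (hδ : 0 < δ) (hσ : ∀ i, |σ i| = 1)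
    (hu : IsAngle ℓ γ η (fun s => transitions (√2 * δ ^ 2) p σ s + v s))
    (hv : ∀ s ∈ Icc 0 ℓ, |v s| ≤ m) (hB : ∀ s ∈ Icc 0 ℓ, |curvature ℓ γ s| ≤ B)
    (hκ : ∀ᵐ s, s ∈ Icc 0 ℓ →
      |curvature ℓ η s - curvature ℓ γ s - transitionsDeriv (√2 * δ ^ 2) p σ s| ≤ m) :
    energy ℓ γ (δ ^ 4) η ≤
      (1 + δ) * (4 / δ ^ 2) * (∫ s in (0)..ℓ, transitionsBound (√2 * δ ^ 2) p s ^ 2) +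
        (1 + 1 / δ) * ℓ * (δ ^ 2 * (B + m) ^ 2 + m ^ 2 / (2 * δ ^ 2)) := by
  have hm : 0 ≤ m := (abs_nonneg _).trans (hv 0 (left_mem_Icc.2 hℓ.le))
  have hB0 : 0 ≤ B := (abs_nonneg _).trans (hB 0 (left_mem_Icc.2 hℓ.le))
  have hw : 0 < √2 * δ ^ 2 := by positivity
  set w := √2 * δ ^ 2 with hwdef
  have hsqrt : √(δ ^ 4) = δ ^ 2 := by
    rw [show δ ^ 4 = (δ ^ 2) ^ 2 by ring, Real.sqrt_sq (by positivity)]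
  have hww : (2 / w) ^ 2 = 2 / δ ^ 4 := by
    rw [hwdef, div_pow, mul_pow, Real.sq_sqrt (by norm_num)]
    field_simp
  set S := transitionsBound w p with hS
  have hSc : Continuous fun s => S s ^ 2 := continuous_transitionsBound.pow 2
  have hSi := hSc.intervalIntegrable (μ := volume) 0 ℓ
  have hS0 : ∀ s, 0 ≤ S s := transitionsBound_nonneg
  have habs : ∀ {x y : ℝ}, |x| ≤ y → x ^ 2 ≤ y ^ 2 := fun {x y} h => by
    rw [← sq_abs x]
    exact pow_le_pow_left₀ (abs_nonneg _) h 2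
  have hint : ∀ α β : ℝ, ∫ s in (0)..ℓ, (α * S s ^ 2 + β) =
      α * (∫ s in (0)..ℓ, S s ^ 2) + ℓ * β := fun α β => by
    rw [intervalIntegral.integral_add (hSi.const_mul α) intervalIntegrable_const,
      intervalIntegral.integral_const_mul, intervalIntegral.integral_const, sub_zero, smul_eq_mul]
  have h1 : ∫ s in (0)..ℓ, curvature ℓ η s ^ 2 ≤
      (1 + δ) * (2 / δ ^ 4) * (∫ s in (0)..ℓ, S s ^ 2) +
        ℓ * ((1 + 1 / δ) * (B + m) ^ 2) := by
    rw [← hint]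
    refine intervalIntegral.integral_mono_ae_restrict hℓ.le (hη.intervalIntegrable_curvature_sq hℓ)
      ((hSi.const_mul _).add intervalIntegrable_const)
      ((ae_restrict_iff' measurableSet_Icc).2 ?_)
    filter_upwards [hκ] with s h3 hs
    have h3 := h3 hs
    have h4 : |curvature ℓ η s| ≤ 2 / w * S s + (B + m) := by
      have h5 := abs_transitionsDeriv_le (p := p) hw hσ s
      have h6 := abs_add_three (transitionsDeriv w p σ s) (curvature ℓ γ s)
        (curvature ℓ η s - curvature ℓ γ s - transitionsDeriv w p σ s)
      have h7 : transitionsDeriv w p σ s + curvature ℓ γ s +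
        (curvature ℓ η s - curvature ℓ γ s - transitionsDeriv w p σ s) = curvature ℓ η s := by ring
      rw [h7] at h6
      linarith [hB s hs]
    calc curvature ℓ η s ^ 2 ≤ (2 / w * S s + (B + m)) ^ 2 := habs h4
      _ ≤ (1 + δ) * (2 / w * S s) ^ 2 + (1 + 1 / δ) * (B + m) ^ 2 := add_sq_le_of_pos hδ _ _
      _ = _ := by rw [mul_pow, hww]; ring
  have h2 : ∫ s in (0)..ℓ, |Real.sin ((transitions w p σ s + v s) / 2)| ^ 2 ≤
      (1 + δ) * (∫ s in (0)..ℓ, S s ^ 2) + ℓ * ((1 + 1 / δ) * (m / 2) ^ 2) := by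
    rw [← hint]
    refine intervalIntegral.integral_mono_on hℓ.le
      ((hu.continuousOn_abs_sin_half hℓ).pow 2).intervalIntegrable
      ((hSi.const_mul _).add intervalIntegrable_const) fun s hs => ?_
    have h3 : |Real.sin ((transitions w p σ s + v s) / 2)| ≤ S s + m / 2 := by
      have := abs_sin_sum_le Finset.univ ![transitions w p σ s / 2, v s / 2]
      simp only [Fin.sum_univ_two, Matrix.cons_val_zero, Matrix.cons_val_one, ← add_div] at this
      have h4 := abs_sin_half_transitions_le (p := p) (w := w) hσ s
      have h5 : |Real.sin (v s / 2)| ≤ m / 2 := by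
        refine Real.abs_sin_le_abs.trans ?_
        rw [abs_div, abs_two]
        linarith [hv s hs]
      linarith
    exact (pow_le_pow_left₀ (abs_nonneg _) h3 2).trans (add_sq_le_of_pos hδ _ _)
  rw [hu.energy_eq hℓ hγ.unitSpeed, hsqrt]
  calc _ ≤ δ ^ 2 * ((1 + δ) * (2 / δ ^ 4) * (∫ s in (0)..ℓ, S s ^ 2) +
        ℓ * ((1 + 1 / δ) * (B + m) ^ 2)) + 2 / δ ^ 2 * ((1 + δ) * (∫ s in (0)..ℓ, S s ^ 2) +
          ℓ * ((1 + 1 / δ) * (m / 2) ^ 2)) := by gcongr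
    _ = _ := by
      field_simp
      ring

/-- The exponential interaction of transitions of width `√2 δ²` at distance `δ` is smaller than a
power of `δ`. -/
theorem exp_neg_inv_le {δ : ℝ} (hδ : 0 < δ) :
    Real.exp (-(δ / (√2 * δ ^ 2))) ≤ 96 * δ ^ 4 := by
  -- `x ^ 4 / 4! ≤ exp x` at `x = 1 / (√2 δ)`, where `x ^ 4 = 1 / (4 δ ^ 4)`
  have h1 := Real.pow_div_factorial_le_exp (x := δ / (√2 * δ ^ 2)) (by positivity) 4
  have h2 : (δ / (√2 * δ ^ 2)) ^ 4 / (Nat.factorial 4 : ℕ) = (96 * δ ^ 4)⁻¹ := by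
    have h3 : √2 ^ 4 = 4 := by
      rw [show √2 ^ 4 = (√2 ^ 2) ^ 2 by ring, Real.sq_sqrt (by norm_num)]
      norm_num
    rw [div_pow, mul_pow, h3]
    norm_num [Nat.factorial]
    field_simp
    norm_num
  rw [h2] at h1
  rw [Real.exp_neg]
  exact inv_le_of_inv_le₀ (by positivity) h1

/-- Centers of the transitions: they converge to prescribed points, but stay at distance `δ` from
each other and from the end points of `[0, ℓ]`. -/
theorem exists_separated_centers {ι : Type} [Fintype ι] {x : ι → ℝ}
    (hx : ∀ i, x i ∈ Ico 0 ℓ) :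
    ∃ p : ℝ → ι → ℝ, ∀ᶠ δ in 𝓝[>] (0 : ℝ), (∀ i, δ ≤ p δ i) ∧ (∀ i, p δ i + δ ≤ ℓ) ∧
      (∀ i j, i ≠ j → δ ≤ |p δ i - p δ j|) ∧
      ∀ i, |p δ i - x i| ≤ Fintype.card ι * δ := by
  -- an enumeration separates transitions which are to converge to the same point
  set e := Fintype.equivFin ι
  refine ⟨fun δ i => x i + ((e i : ℕ) + 1) * δ, ?_⟩
  have hpos : ∀ᶠ δ in 𝓝[>] (0 : ℝ), 0 < δ := self_mem_nhdsWithin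
  have h1 : ∀ᶠ δ in 𝓝[>] (0 : ℝ), ∀ i, x i + ((e i : ℕ) + 1) * δ + δ ≤ ℓ := by
    refine eventually_all.2 fun i => ?_
    have hc : Tendsto (fun δ : ℝ => x i + ((e i : ℕ) + 1) * δ + δ) (𝓝[>] 0) (𝓝 (x i)) := by
      refine tendsto_nhdsWithin_of_tendsto_nhds (Continuous.tendsto' (by fun_prop) _ _ (by simp))
    exact hc.eventually_le_const (hx i).2
  have h2 : ∀ᶠ δ in 𝓝[>] (0 : ℝ), ∀ i j, i ≠ j →
      δ ≤ |(x i + ((e i : ℕ) + 1) * δ) - (x j + ((e j : ℕ) + 1) * δ)| := by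
    refine eventually_all.2 fun i => eventually_all.2 fun j => ?_
    by_cases hij : i = j
    · exact Eventually.of_forall fun δ h => (h hij).elim
    by_cases hxij : x i = x j
    · filter_upwards [hpos] with δ hδ _
      have hne : (e i : ℕ) ≠ e j := fun h => hij (e.injective (Fin.ext h))
      have h3 : (1 : ℝ) ≤ |((e i : ℕ) : ℝ) - (e j : ℕ)| := by
        have : (1 : ℤ) ≤ |((e i : ℕ) : ℤ) - (e j : ℕ)| :=
          Int.one_le_abs (sub_ne_zero.2 (by exact_mod_cast hne))
        exact_mod_cast this
      have h4 : (x i + ((e i : ℕ) + 1) * δ) - (x j + ((e j : ℕ) + 1) * δ) =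
          (((e i : ℕ) : ℝ) - (e j : ℕ)) * δ := by rw [hxij]; ring
      rw [h4, abs_mul, abs_of_pos hδ]
      exact le_mul_of_one_le_left hδ.le h3
    · have hc : Tendsto (fun δ : ℝ =>
          |(x i + ((e i : ℕ) + 1) * δ) - (x j + ((e j : ℕ) + 1) * δ)| - δ) (𝓝[>] 0)
          (𝓝 |x i - x j|) := by
        refine tendsto_nhdsWithin_of_tendsto_nhds (Continuous.tendsto' (by fun_prop) _ _ (by simp))
      filter_upwards [hc.eventually_const_lt (abs_pos.2 (sub_ne_zero.2 hxij))] with δ hδ _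
      linarith
  filter_upwards [hpos, h1, h2] with δ hδ h1 h2
  refine ⟨fun i => ?_, h1, h2, fun i => ?_⟩
  · have := (hx i).1
    have h3 : 0 ≤ ((e i : ℕ) : ℝ) * δ := by positivity
    linarith
  · have h3 : ((e i : ℕ) : ℝ) + 1 ≤ Fintype.card ι := by exact_mod_cast (e i).2
    rw [add_sub_cancel_left, abs_of_nonneg (by positivity)]
    gcongr

/-- Recovery sequences for unit transitions at given points, in terms of `δ = ε^{1/4}`. -/
theorem exists_recovery_of_transitions (hℓ : 0 < ℓ) (hγ : IsClosedC2Curve ℓ γ) {ι : Type}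
    [Fintype ι] {x : ι → ℝ} {σ : ι → ℤ} (hx : ∀ i, x i ∈ Ico 0 ℓ) (hσ : ∀ i, |σ i| = 1) :
    ∃ (η : ℝ → ℝ → Plane) (f g : ℝ → ℝ), Tendsto f (𝓝 0) (𝓝 (8 * √2 * Fintype.card ι)) ∧
      Tendsto g (𝓝 0) (𝓝 0) ∧ ∀ᶠ δ in 𝓝[>] (0 : ℝ), IsClosedH2Curve ℓ (η δ) ∧ η δ 0 = γ 0 ∧
        energy ℓ γ (δ ^ 4) (η δ) ≤ f δ ∧ ∀ φ, IsFlatTest ℓ φ →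
          (∫ s in (0)..ℓ, φ s * (curvature ℓ (η δ) s - curvature ℓ γ s)) -
            2 * Real.pi * ∑ i, σ i * φ (x i) ≤ g δ := by
  have hγ' := hγ.isClosedH2Curve hℓ
  obtain ⟨C, θ₀, hC, hθ₀, hcurve⟩ := exists_curve_of_transitions hℓ hγ
  obtain ⟨B, hB⟩ := isCompact_Icc.exists_bound_of_continuousOn (hγ.continuousOn_curvature hℓ)
  have hB0 : 0 ≤ B := (norm_nonneg _).trans (hB 0 (left_mem_Icc.2 hℓ.le))
  obtain ⟨p, hp⟩ := exists_separated_centers hx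
  set M := (Fintype.card ι : ℝ) with hM
  have hM0 : 0 ≤ M := Nat.cast_nonneg _
  set K : ℝ := 2 * (M * (Real.pi * √2)) + ℓ * (8 * M * 96) with hK
  have hK0 : 0 ≤ K := by positivity
  -- `K δ²` bounds the total width of the transitions; `f` and `g` collect the resulting error terms
  set f : ℝ → ℝ := fun δ => (1 + δ) * (8 * √2 * M + 1536 * ℓ * M ^ 2 * δ ^ 2) +
    (1 + δ) * ℓ * (δ * (B + C * (K * δ ^ 2)) ^ 2 + (C * K) ^ 2 * δ / 2) with hf
  set g : ℝ → ℝ := fun δ => ℓ * (C * (K * δ ^ 2)) +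
    M * (4 * Real.pi * (√2 * δ ^ 2) + 8 * (96 * δ ^ 4) + 2 * Real.pi * (M * δ)) with hg
  have hsmall : ∀ᶠ δ in 𝓝[>] (0 : ℝ), K * δ ^ 2 ≤ θ₀ := by
    have hc : Tendsto (fun δ : ℝ => K * δ ^ 2) (𝓝[>] 0) (𝓝 0) :=
      tendsto_nhdsWithin_of_tendsto_nhds (Continuous.tendsto' (by fun_prop) _ _ (by simp))
    exact hc.eventually_le_const hθ₀
  have hone : ∀ᶠ δ in 𝓝[>] (0 : ℝ), δ ≤ 1 :=
    (tendsto_nhdsWithin_of_tendsto_nhds tendsto_id).eventually_le_const zero_lt_one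
  have hpos : ∀ᶠ δ in 𝓝[>] (0 : ℝ), 0 < δ := self_mem_nhdsWithin
  have key : ∀ᶠ δ in 𝓝[>] (0 : ℝ), ∃ η : ℝ → Plane, IsClosedH2Curve ℓ η ∧ η 0 = γ 0 ∧
      energy ℓ γ (δ ^ 4) η ≤ f δ ∧ ∀ φ, IsFlatTest ℓ φ →
        (∫ s in (0)..ℓ, φ s * (curvature ℓ η s - curvature ℓ γ s)) -
          2 * Real.pi * ∑ i, σ i * φ (x i) ≤ g δ := by
    filter_upwards [hp, hsmall, hone, hpos] with δ ⟨hp1, hp2, hp3, hp4⟩ hδθ hδ1 hδ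
    have hw : 0 < √2 * δ ^ 2 := by positivity
    have hE := exp_neg_inv_le hδ
    have hδ4 : δ ^ 4 ≤ δ ^ 2 := pow_le_pow_of_le_one hδ.le hδ1 (by norm_num)
    have hθ : 2 * (M * (Real.pi * (√2 * δ ^ 2))) +
        ℓ * (8 * M * Real.exp (-(δ / (√2 * δ ^ 2)))) ≤ K * δ ^ 2 := by
      calc _ ≤ 2 * (M * (Real.pi * (√2 * δ ^ 2))) + ℓ * (8 * M * (96 * δ ^ 2)) := by
            gcongr
            linarith
        _ = _ := by rw [hK]; ring
    obtain ⟨η, v, hη, hη0, hu, hv, hκ⟩ := hcurve hw hp1 hp2 hσ hθ hδθ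
    refine ⟨η, hη, hη0, ?_, fun φ hφ => ?_⟩
    · refine (energy_le_of_transitions hℓ hγ' hη hδ hσ hu hv hB hκ).trans ?_
      have h1 := integral_transitionsBound_sq_le (p := p δ) hℓ hw hp3
      calc _ ≤ (1 + δ) * (4 / δ ^ 2) * (2 * M * (√2 * δ ^ 2) + 4 * ℓ * M ^ 2 * (96 * δ ^ 4)) +
            (1 + 1 / δ) * ℓ * (δ ^ 2 * (B + C * (K * δ ^ 2)) ^ 2 +
              (C * (K * δ ^ 2)) ^ 2 / (2 * δ ^ 2)) := by
            gcongr
            refine h1.trans ?_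
            gcongr
        _ = f δ := by
            simp only [hf]
            field_simp
            ring
    · have hi := hη.intervalIntegrable_curvature hℓ
      have hi' := hγ'.intervalIntegrable_curvature hℓ
      have hti := (continuous_transitionsDeriv (w := √2 * δ ^ 2) (p := p δ)
        (σ := σ)).intervalIntegrable (μ := volume) 0 ℓ
      have hφc : ContinuousOn φ (uIcc 0 ℓ) := by
        rw [uIcc_of_le hℓ.le]; exact hφ.continuousOn
      have e : ∫ s in (0)..ℓ, φ s * (curvature ℓ η s - curvature ℓ γ s) =
          (∫ s in (0)..ℓ, φ s * (curvature ℓ η s - curvature ℓ γ s -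
            transitionsDeriv (√2 * δ ^ 2) (p δ) σ s)) +
          ∫ s in (0)..ℓ, φ s * transitionsDeriv (√2 * δ ^ 2) (p δ) σ s := by
        rw [← intervalIntegral.integral_add (((hi.sub hi').sub hti).continuousOn_mul hφc)
          (hti.continuousOn_mul hφc)]
        exact intervalIntegral.integral_congr fun s _ => by ring
      have b1 : |∫ s in (0)..ℓ, φ s * (curvature ℓ η s - curvature ℓ γ s -
            transitionsDeriv (√2 * δ ^ 2) (p δ) σ s)| ≤ ℓ * (C * (K * δ ^ 2)) := by
        have h1 : ∫ _ in (0)..ℓ, C * (K * δ ^ 2) = ℓ * (C * (K * δ ^ 2)) := by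
          rw [intervalIntegral.integral_const, sub_zero, smul_eq_mul]
        rw [← Real.norm_eq_abs, ← h1]
        refine intervalIntegral.norm_integral_le_of_norm_le hℓ.le ?_ intervalIntegrable_const
        filter_upwards [hκ] with s h2 hs
        have hs' := Ioc_subset_Icc_self hs
        rw [norm_mul, Real.norm_eq_abs, Real.norm_eq_abs]
        exact (mul_le_of_le_one_left (abs_nonneg _) (hφ.abs_le hs')).trans (h2 hs')
      have b2 := abs_integral_transitionsDeriv_sub_le hφ hσ hw hδ hp1 hp2
        (fun i => Ico_subset_Icc_self (hx i))
      have b3 : ∑ i, (4 * Real.pi * (√2 * δ ^ 2) + 8 * Real.exp (-(δ / (√2 * δ ^ 2))) +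
          2 * Real.pi * |p δ i - x i|) ≤
          M * (4 * Real.pi * (√2 * δ ^ 2) + 8 * (96 * δ ^ 4) + 2 * Real.pi * (M * δ)) := by
        refine (Finset.sum_le_card_nsmul _ _ (4 * Real.pi * (√2 * δ ^ 2) + 8 * (96 * δ ^ 4) +
          2 * Real.pi * (M * δ)) fun i _ => ?_).trans_eq ?_
        · have := hp4 i
          gcongr
        · rw [nsmul_eq_mul, Finset.card_univ]
      rw [e]
      have b4 := (abs_le.1 b1).2
      have b5 := (abs_le.1 b2).2
      simp only [hg]
      linarith
  choose! η hη using fun δ (h : ∃ η : ℝ → Plane, IsClosedH2Curve ℓ η ∧ η 0 = γ 0 ∧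
      energy ℓ γ (δ ^ 4) η ≤ f δ ∧ ∀ φ, IsFlatTest ℓ φ →
        (∫ s in (0)..ℓ, φ s * (curvature ℓ η s - curvature ℓ γ s)) -
          2 * Real.pi * ∑ i, σ i * φ (x i) ≤ g δ) => h
  refine ⟨η, f, g, Continuous.tendsto' (by fun_prop) _ _ (by simp [hf]),
    Continuous.tendsto' (by fun_prop) _ _ (by simp [hg]), ?_⟩
  filter_upwards [key] with δ h using hη δ h

/-! ### Recovery sequences and the lower limit of the energies -/

/-- An atomic measure with integer weights is a sum of unit atoms in `[0, ℓ)`; on periodic functions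
an atom at `ℓ` acts like an atom at `0`. -/
theorem exists_unit_atoms (hℓ : 0 < ℓ) {c : ℝ →₀ ℤ} (hc : IsSingularity ℓ c) :
    ∃ (ι : Type) (_ : Fintype ι) (x : ι → ℝ) (σ : ι → ℤ), (∀ i, x i ∈ Ico 0 ℓ) ∧
      (∀ i, |σ i| = 1) ∧ (Fintype.card ι : ℝ) = totalMultiplicity c ∧
      ∀ φ : ℝ → ℝ, φ 0 = φ ℓ → ∑ i, σ i * φ (x i) = c.sum fun s n => (n : ℝ) * φ s := by
  refine ⟨Σ s : c.support, Fin (c s).natAbs, inferInstance,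
    fun i => if (i.1 : ℝ) = ℓ then 0 else i.1,
    fun i => (c i.1).sign, fun i => ?_, fun i => ?_, ?_, fun φ hφ => ?_⟩
  · obtain ⟨h0, h1⟩ := hc.1 i.1 i.1.2
    dsimp only
    split_ifs with h
    · exact ⟨le_rfl, hℓ⟩
    · exact ⟨h0, lt_of_le_of_ne h1 h⟩
  · exact Int.abs_sign_of_ne_zero (Finsupp.mem_support_iff.1 i.1.2)
  · rw [Fintype.card_sigma, totalMultiplicity, ← Finset.sum_coe_sort c.support fun s => |(c s : ℝ)|]
    push_cast [Fintype.card_fin, Nat.cast_natAbs]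
    rfl
  · rw [Fintype.sum_sigma, Finsupp.sum, ← Finset.sum_coe_sort c.support fun s => (c s : ℝ) * φ s]
    refine Finset.sum_congr rfl fun s _ => ?_
    have h1 : φ (if (s : ℝ) = ℓ then 0 else s) = φ s := by
      split_ifs with h
      · rw [h, hφ]
      · rfl
    refine (Finset.sum_congr rfl fun y _ => congrArg (((c s).sign : ℝ) * ·) h1).trans ?_
    rw [Finset.sum_const, Finset.card_univ, Fintype.card_fin, nsmul_eq_mul, ← mul_assoc]
    congr 1
    have h2 : ((c s).natAbs : ℤ) * (c s).sign = c s := by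
      rw [mul_comm]; exact Int.sign_mul_natAbs _
    simpa only [Int.cast_mul, Int.cast_natCast] using congrArg (Int.cast : ℤ → ℝ) h2

/-- The recovery sequence. The upper bound for its energies comes from the construction; the
matching lower bound is the `Γ`-liminf inequality along the filter `𝓝[>] 0`. -/
theorem exists_recovery (hℓ : 0 < ℓ) (hγ : IsClosedC2Curve ℓ γ) {c : ℝ →₀ ℤ}
    (hc : IsSingularity ℓ c) :
    ∃ η : ℝ → ℝ → Plane, (∀ ε, 0 < ε → IsClosedH2Curve ℓ (η ε)) ∧
      ConvergesTo (𝓝[>] 0) ℓ η γ (pointedMeasure ℓ γ c) ∧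
      Tendsto (fun ε => energy ℓ γ ε (η ε)) (𝓝[>] 0) (𝓝 (8 * √2 * totalMultiplicity c)) := by
  classical
  have hγ' := hγ.isClosedH2Curve hℓ
  obtain ⟨ι, _, x, σ, hx, hσ, hcard, hsum⟩ := exists_unit_atoms hℓ hc
  obtain ⟨η₀, f, g, hf, hg, hη₀⟩ := exists_recovery_of_transitions hℓ hγ hx hσ
  rw [hcard] at hf
  have hr0 : Tendsto (fun ε : ℝ => √√ε) (𝓝[>] 0) (𝓝 0) :=
    tendsto_nhdsWithin_of_tendsto_nhds (Continuous.tendsto' (by fun_prop) _ _ (by simp))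
  have hr : Tendsto (fun ε : ℝ => √√ε) (𝓝[>] 0) (𝓝[>] 0) := by
    refine tendsto_nhdsWithin_iff.2 ⟨hr0, ?_⟩
    filter_upwards [self_mem_nhdsWithin] with ε hε
    exact Real.sqrt_pos.2 (Real.sqrt_pos.2 hε)
  have hpos : ∀ᶠ ε in 𝓝[>] (0 : ℝ), 0 < ε := self_mem_nhdsWithin
  -- Only small `ε` matter; for the others the curve `γ` itself is admissible.
  set η : ℝ → ℝ → Plane := fun ε =>
    if IsClosedH2Curve ℓ (η₀ √√ε) then η₀ √√ε else γ with hη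
  have hηcl : ∀ ε, IsClosedH2Curve ℓ (η ε) := fun ε => by
    simp only [hη]
    split_ifs with h
    exacts [h, hγ']
  have hprop : ∀ᶠ ε in 𝓝[>] (0 : ℝ), η ε 0 = γ 0 ∧ energy ℓ γ ε (η ε) ≤ f √√ε ∧
      ∀ φ, IsFlatTest ℓ φ → (∫ s in (0)..ℓ, φ s * (curvature ℓ (η ε) s - curvature ℓ γ s)) -
        2 * Real.pi * (c.sum fun s n => (n : ℝ) * φ s) ≤ g √√ε := by
    filter_upwards [hr.eventually hη₀, hpos] with ε ⟨h1, h2, h3, h4⟩ hε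
    have e : η ε = η₀ √√ε := if_pos h1
    have e4 : √√ε ^ 4 = ε := by
      rw [show √√ε ^ 4 = (√√ε ^ 2) ^ 2 by ring, Real.sq_sqrt (Real.sqrt_nonneg _),
        Real.sq_sqrt hε.le]
    rw [e4] at h3
    rw [e]
    refine ⟨h2, h3, fun φ hφ => ?_⟩
    rw [← hsum φ hφ.1]
    exact h4 φ hφ
  have hconv : ConvergesTo (𝓝[>] 0) ℓ η γ (pointedMeasure ℓ γ c) := by
    refine convergesTo_of_energy_le hℓ hγ' (ε := fun ε => ε) hpos
      (tendsto_nhdsWithin_of_tendsto_nhds tendsto_id)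
      (Eventually.of_forall hηcl) (hprop.mono fun _ h => h.1)
      (C := 8 * √2 * totalMultiplicity c + 1) ?_ hc (hg.comp hr0) (hprop.mono fun _ h => h.2.2)
    filter_upwards [hprop, (hf.comp hr0).eventually_le_const (lt_add_one _)] with ε h1 h2
      using h1.2.1.trans h2
  obtain ⟨a, ha, ha'⟩ := exists_tendsto_le_energy hℓ hγ (ε := fun ε => ε) hpos
    (Eventually.of_forall hηcl) hc hconv
  exact ⟨η, fun ε _ => hηcl ε, hconv, tendsto_of_tendsto_of_tendsto_of_le_of_le' ha (hf.comp hr0)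
    ha' (hprop.mono fun _ h => h.2.1)⟩

theorem le_liminf_energy (hℓ : 0 < ℓ) (hγ : IsClosedC2Curve ℓ γ) {ε : ℕ → ℝ} {η : ℕ → ℝ → Plane}
    {c : ℝ →₀ ℤ} (hε : ∀ k, 0 < ε k) (hη : ∀ k, IsClosedH2Curve ℓ (η k)) (hc : IsSingularity ℓ c)
    (hconv : ConvergesTo atTop ℓ η γ (pointedMeasure ℓ γ c)) :
    ((8 * √2 * totalMultiplicity c : ℝ) : EReal) ≤
      liminf (fun k => ((energy ℓ γ (ε k) (η k) : ℝ) : EReal)) atTop := by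
  obtain ⟨a, ha, ha'⟩ := exists_tendsto_le_energy hℓ hγ (Eventually.of_forall hε)
    (Eventually.of_forall hη) hc hconv
  have h1 : Tendsto (fun k => ((a k : ℝ) : EReal)) atTop
      (𝓝 ((8 * √2 * totalMultiplicity c : ℝ) : EReal)) :=
    (continuous_coe_real_ereal.tendsto _).comp ha
  rw [← h1.liminf_eq]
  exact liminf_le_liminf (ha'.mono fun k hk => EReal.coe_le_coe_iff.2 hk)

end PointedClosedCurve

end

open PointedClosedCurve

theorem theorem6p1 (ℓ : ℝ) (hℓ : 0 < ℓ) (γ : ℝ → Plane) (hγ : IsClosedC2Curve ℓ γ) :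
    -- compactness, up to subsequences and translations of the curves
    (∀ (ε : ℕ → ℝ) (η : ℕ → ℝ → Plane),
      (∀ k, 0 < ε k) → Tendsto ε atTop (𝓝 0) → (∀ k, IsClosedH2Curve ℓ (η k)) →
      (∃ C : ℝ, ∀ k, energy ℓ γ (ε k) (η k) ≤ C) →
      ∃ (n : ℕ → ℕ) (c : ℝ →₀ ℤ), StrictMono n ∧ IsSingularity ℓ c ∧
        ConvergesTo atTop ℓ (fun k s => η (n k) s - η (n k) 0 + γ 0) γ (pointedMeasure ℓ γ c)) ∧
    -- liminf inequality
    (∀ (ε : ℕ → ℝ) (η : ℕ → ℝ → Plane) (c : ℝ →₀ ℤ),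
      (∀ k, 0 < ε k) → Tendsto ε atTop (𝓝 0) → (∀ k, IsClosedH2Curve ℓ (η k)) →
      IsSingularity ℓ c → ConvergesTo atTop ℓ η γ (pointedMeasure ℓ γ c) →
      ((8 * √2 * totalMultiplicity c : ℝ) : EReal) ≤
        liminf (fun k => ((energy ℓ γ (ε k) (η k) : ℝ) : EReal)) atTop) ∧
    -- recovery sequence
    (∀ c : ℝ →₀ ℤ, IsSingularity ℓ c →
      ∃ η : ℝ → ℝ → Plane,
        (∀ ε, 0 < ε → IsClosedH2Curve ℓ (η ε)) ∧
        ConvergesTo (𝓝[>] 0) ℓ η γ (pointedMeasure ℓ γ c) ∧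
        Tendsto (fun ε => energy ℓ γ ε (η ε)) (𝓝[>] 0) (𝓝 (8 * √2 * totalMultiplicity c))) :=
  ⟨fun _ _ hε hε0 hη ⟨_, hC⟩ => compactness hℓ hγ hε hε0 hη hC,
    fun _ _ _ hε _ hη hc hconv => le_liminf_energy hℓ hγ hε hη hc hconv,
    fun _ hc => exists_recovery hℓ hγ hc⟩
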